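/- **Theorem 3.3 (Nonlinear RDE: existence and unicity).** Let $p\in[2,3)$, $T>0$, $n,m,d\in\mathbb N$, $y\in\mathbb R^n$ and $U\subseteq\mathbb R^m$. For a path $X$ write $X_{s,t}:=X_t-X_s$. For $q\ge1$ let $$\|A\|_q:=\Big(\sup_\pi\sum_{[s,t]\in\pi}\|A_{s,t}\|^q\Big)^{1/q}$$ denote the $q$-variation over $[0,T]$ of a two-parameter map $A$ on $[0,T]^2$ (the supremum runs over all finite partitions $\pi$ of $[0,T]$), and let $\|X\|_q$ be that of the increments of a path $X$. Denote by $\mathcal C^q$ the set of continuous paths on $[0,T]$ of finite $q$-variation. Assume the following. * $u\in L^\infty([0,T],U)$, i.e. $u:[0,T]\to U$ is measurable and essentially bounded. * $b:[0,T]\times\mathbb R^n\times U\to\mathbb R^n$ is such that $b(\cdot,x,v)$ is measurable for all $(x,v)\in\mathbb R^n\times U$; $b(t,\cdot,\cdot)$ is continuous on $\mathbb R^n\times U$ for almost every $t\in[0,T]$; and there is $C_b\ge0$ such that, for almost every $t\in[0,T]$, $\|b(t,x,v)\|\le C_b$ and $\|b(t,x,v)-b(t,\tilde x,v)\|\le C_b\|x-\tilde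 x\|$ for all $x,\tilde x\in\mathbb R^n$ and $v\in U$. * $\sigma\in C^3_b([0,T]\times\mathbb R^n,\mathbb R^{n\times d})$, i.e. $\sigma$ is three times continuously differentiable in $(t,x)$, and $\sigma$ and its derivatives up to order $3$ are bounded. * $\mathbf X=(X,\mathbb X)$ is a (continuous) $p$-rough path: $X:[0,T]\to\mathbb R^d$ and $\mathbb X:[0,T]^2\to\mathbb R^{d\times d}$ are continuous, $\mathbb X^{ij}_{s,t}=\mathbb X^{ij}_{s,r}+\mathbb X^{ij}_{r,t}+X^i_{s,r}X^j_{r,t}$ for all $1\le i,j\le d$ and $s,r,t\in[0,T]$, and $\|X\|_p+\|\mathbb X\|_{p/2}<\infty$. For $F=\mathbb R^n$ or $F=\mathbb R^{n\times d}$, let $\mathscr D^p_X([0,T],F)$ be the set of controlled rough paths, i.e. of pairs $(Z,Z')\in\mathcal C^p([0,T],F)\times\mathcal C^p([0,T],\mathcal L(\mathbb R^d,F))$ whose remainder $R^Z_{s,t}:=Z_{s,t}-Z'_sX_{s,t}$ satisfies $\|R^Z\|_{p/2}<\infty$. The rough integral of a controlled rough path $(Z,Z')$ with $F=\mathbb R^{n\times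 d}$ is $$\int_0^tZ_s\,d\mathbf X_s:=\lim_{|\pi|\to0}\sum_{[r,s]\in\pi}\big(Z_rX_{r,s}+Z'_r\mathbb X_{r,s}\big),$$ the limit being over partitions $\pi$ of $[0,t]$ with vanishing mesh, where $Z'_r\mathbb X_{r,s}:=\sum_{i,j}\mathbb X^{ij}_{r,s}\,(Z'_re_i)e_j$. Then there exists a unique pair $(Y,Y')\in\mathscr D^p_X([0,T],\mathbb R^n)$ with $Y'=\sigma(\cdot,Y)$ that solves the RDE $$Y_t=y+\int_0^tb(s,Y_s,u_s)\,ds+\int_0^t\sigma(s,Y_s)\,d\mathbf X_s,\qquad t\in[0,T].$$ Here the first integral is a Lebesgue integral, and the second is the rough integral of $(\sigma(\cdot,Y),\sigma(\cdot,Y)'):=(\sigma(\cdot,Y),\nabla_x\sigma(\cdot,Y)Y')$, which belongs to $\mathscr D^p_X([0,T],\mathbb R^{n\times d})$. -/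

import Mathlib

open Set Filter MeasureTheory Topology
open scoped ENNReal NNReal

namespace RoughDE

/-- A finite partition `a = τ₀ < τ₁ < ⋯ < τₙ = b` of `[a, b]`
(the values of `point` beyond the index `n` play no role). -/
structure Partition (a b : ℝ) where
  /-- the number of subintervals -/
  n : ℕ
  /-- the partition points -/
  point : ℕ → ℝ
  point_zero : point 0 = a
  point_last : point n = b
  lt_succ : ∀ i < n, point i < point (i + 1)

/-- The mesh size, i.e. the maximal length of a subinterval. -/
noncomputable def Partition.mesh {a b : ℝ} (π : Partition a b) : ℝ≥0 :=
  (Finset.range π.n).sup fun i => Real.toNNReal (π.point (i + 1) - π.point i)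

/-- The filter on partitions of `[a, b]` expressing `|π| → 0`. -/
noncomputable def meshToZero (a b : ℝ) : Filter (Partition a b) :=
  comap Partition.mesh (𝓝 0)

/-- The `q`-variation over `[a, b]` of a two-parameter map `A`, with values in `[0, ∞]`:
`(sup_π ∑_{[u,v] ∈ π} ‖A u v‖ ^ q) ^ (1/q)`. -/
noncomputable def twoParamVariation {F : Type*} [NormedAddCommGroup F]
    (q : ℝ) (A : ℝ → ℝ → F) (a b : ℝ) : ℝ≥0∞ :=
  (⨆ π : Partition a b,
    ∑ i ∈ Finset.range π.n, ‖A (π.point i) (π.point (i + 1))‖ₑ ^ q) ^ (1 / q)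

/-- The `q`-variation over `[a, b]` of a path, i.e. that of its increments `X t - X s`. -/
noncomputable def pathVariation {F : Type*} [NormedAddCommGroup F]
    (q : ℝ) (X : ℝ → F) (a b : ℝ) : ℝ≥0∞ :=
  twoParamVariation q (fun s t => X t - X s) a b

/-- The space `𝒞^q([0,T], F)` of continuous paths of finite `q`-variation. -/
def IsVariationPath {F : Type*} [NormedAddCommGroup F] (q T : ℝ) (X : ℝ → F) : Prop :=
  ContinuousOn X (Icc 0 T) ∧ pathVariation q X 0 T < ∞

/-- `(X, 𝕏)` is a (continuous) `p`-rough path over `ℝ^d` on `[0, T]`. The `d × d` matrix `𝕏 s t`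
is written as a vector indexed by `Fin d × Fin d`, with the Euclidean (Frobenius) norm. -/
structure IsRoughPath {d : ℕ} (p T : ℝ) (X : ℝ → EuclideanSpace ℝ (Fin d))
    (XX : ℝ → ℝ → EuclideanSpace ℝ (Fin d × Fin d)) : Prop where
  continuousOn_path : ContinuousOn X (Icc 0 T)
  continuousOn_enhancement :
    ContinuousOn (fun z : ℝ × ℝ => XX z.1 z.2) (Icc 0 T ×ˢ Icc 0 T)
  chen : ∀ s ∈ Icc 0 T, ∀ r ∈ Icc 0 T, ∀ t ∈ Icc 0 T, ∀ i j : Fin d,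
    XX s t (i, j) = XX s r (i, j) + XX r t (i, j) + (X r i - X s i) * (X t j - X r j)
  variation_path_lt_top : pathVariation p X 0 T < ∞
  variation_enhancement_lt_top : twoParamVariation (p / 2) XX 0 T < ∞

/-- The remainder `R^Y_{s,t} = Y_t - Y_s - Y'_s (X_t - X_s)`. -/
noncomputable def remainder {d : ℕ} {F : Type*} [NormedAddCommGroup F] [NormedSpace ℝ F]
    (X : ℝ → EuclideanSpace ℝ (Fin d)) (Y : ℝ → F)
    (Y' : ℝ → EuclideanSpace ℝ (Fin d) →L[ℝ] F) (s t : ℝ) : F :=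
  Y t - Y s - Y' s (X t - X s)

/-- `(Y, Y')` is a controlled rough path with respect to `X`, i.e. belongs to
`𝒟^p_X([0,T], F)`. -/
structure IsControlled {d : ℕ} {F : Type*} [NormedAddCommGroup F] [NormedSpace ℝ F]
    (p T : ℝ) (X : ℝ → EuclideanSpace ℝ (Fin d)) (Y : ℝ → F)
    (Y' : ℝ → EuclideanSpace ℝ (Fin d) →L[ℝ] F) : Prop where
  path : IsVariationPath p T Y
  deriv : IsVariationPath p T Y'
  remainder_lt_top : twoParamVariation (p / 2) (remainder X Y Y') 0 T < ∞

/-- The action of `A ∈ L(ℝ^d, L(ℝ^d, F)) ≅ L(ℝ^{d×d}, F)` on a `d × d` matrix `M`,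
`∑ i j, M i j • A e_i e_j`. The first argument of a Gubinelli derivative `A = Z'` is the direction
of the increment of `X`, so it is paired with the first index of `𝕏`. -/
noncomputable def tensorApply {d : ℕ} {F : Type*} [NormedAddCommGroup F] [NormedSpace ℝ F]
    (A : EuclideanSpace ℝ (Fin d) →L[ℝ] EuclideanSpace ℝ (Fin d) →L[ℝ] F)
    (M : EuclideanSpace ℝ (Fin d × Fin d)) : F :=
  ∑ i : Fin d, ∑ j : Fin d,
    M (i, j) • A (EuclideanSpace.single i (1 : ℝ)) (EuclideanSpace.single j (1 : ℝ))

/-- The compensated Riemann sum `∑_{[s,t] ∈ π} Z_s X_{s,t} + Z'_s 𝕏_{s,t}`. -/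
noncomputable def compensatedSum {d : ℕ} {F : Type*} [NormedAddCommGroup F] [NormedSpace ℝ F]
    (X : ℝ → EuclideanSpace ℝ (Fin d)) (XX : ℝ → ℝ → EuclideanSpace ℝ (Fin d × Fin d))
    (Z : ℝ → EuclideanSpace ℝ (Fin d) →L[ℝ] F)
    (Z' : ℝ → EuclideanSpace ℝ (Fin d) →L[ℝ] EuclideanSpace ℝ (Fin d) →L[ℝ] F)
    {a b : ℝ} (π : Partition a b) : F :=
  ∑ i ∈ Finset.range π.n,
    (Z (π.point i) (X (π.point (i + 1)) - X (π.point i))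
      + tensorApply (Z' (π.point i)) (XX (π.point i) (π.point (i + 1))))

/-- The rough integral `∫_a^b Z d(X, 𝕏)` of `(Z, Z')` exists, as the limit of the compensated
Riemann sums when the mesh size vanishes, and equals `I`. -/
def HasRoughIntegral {d : ℕ} {F : Type*} [NormedAddCommGroup F] [NormedSpace ℝ F]
    (X : ℝ → EuclideanSpace ℝ (Fin d)) (XX : ℝ → ℝ → EuclideanSpace ℝ (Fin d × Fin d))
    (Z : ℝ → EuclideanSpace ℝ (Fin d) →L[ℝ] F)
    (Z' : ℝ → EuclideanSpace ℝ (Fin d) →L[ℝ] EuclideanSpace ℝ (Fin d) →L[ℝ] F)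
    (a b : ℝ) (I : F) : Prop :=
  Tendsto (fun π : Partition a b => compensatedSum X XX Z Z' π) (meshToZero a b) (𝓝 I)

/-- `f ∈ C^k_b(S)`: `f` is `k` times continuously differentiable on `S`, and `f` and its
derivatives up to order `k` are bounded on `S`. -/
def IsCkb {E F : Type*} [NormedAddCommGroup E] [NormedSpace ℝ E] [NormedAddCommGroup F]
    [NormedSpace ℝ F] (k : ℕ) (f : E → F) (S : Set E) : Prop :=
  ContDiffOn ℝ k f S ∧
    ∃ C : ℝ, ∀ j ≤ k, ∀ z ∈ S, ‖iteratedFDerivWithin ℝ j f S z‖ ≤ C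

/-- The regularity assumption on the drift `b : [0,T] × ℝ^n × U → ℝ^n`. Lebesgue measurability on
`[0,T]` is expressed as a.e.-measurability for Lebesgue measure restricted to `[0,T]`. -/
structure IsDrift {n m : ℕ} (T : ℝ) (U : Set (EuclideanSpace ℝ (Fin m)))
    (b : ℝ → EuclideanSpace ℝ (Fin n) → EuclideanSpace ℝ (Fin m) → EuclideanSpace ℝ (Fin n)) :
    Prop where
  measurable : ∀ x, ∀ v ∈ U, AEMeasurable (fun t => b t x v) (volume.restrict (Icc 0 T))
  continuous : ∀ᵐ t ∂volume.restrict (Icc 0 T),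
    ContinuousOn (fun z : EuclideanSpace ℝ (Fin n) × EuclideanSpace ℝ (Fin m) => b t z.1 z.2)
      (univ ×ˢ U)
  bounded_lipschitz : ∃ C : ℝ, 0 ≤ C ∧ ∀ᵐ t ∂volume.restrict (Icc 0 T),
    ∀ v ∈ U, (∀ x, ‖b t x v‖ ≤ C) ∧ ∀ x x', ‖b t x v - b t x' v‖ ≤ C * ‖x - x'‖

/-- `u ∈ L^∞([0,T], U)`. -/
structure IsControl {m : ℕ} (T : ℝ) (U : Set (EuclideanSpace ℝ (Fin m)))
    (u : ℝ → EuclideanSpace ℝ (Fin m)) : Prop where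
  mem : ∀ t ∈ Icc 0 T, u t ∈ U
  measurable : AEMeasurable u (volume.restrict (Icc 0 T))
  bounded : ∃ C : ℝ, ∀ᵐ t ∂volume.restrict (Icc 0 T), ‖u t‖ ≤ C

/-- The Gubinelli derivative `σ(·,Y)' = ∇ₓσ(·,Y) Y'` of the path `σ(·,Y)`. -/
noncomputable def compDeriv {n d : ℕ}
    (σ : ℝ → EuclideanSpace ℝ (Fin n) →
      (EuclideanSpace ℝ (Fin d) →L[ℝ] EuclideanSpace ℝ (Fin n)))
    (Y : ℝ → EuclideanSpace ℝ (Fin n))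
    (Y' : ℝ → EuclideanSpace ℝ (Fin d) →L[ℝ] EuclideanSpace ℝ (Fin n)) (t : ℝ) :
    EuclideanSpace ℝ (Fin d) →L[ℝ] EuclideanSpace ℝ (Fin d) →L[ℝ] EuclideanSpace ℝ (Fin n) :=
  (fderiv ℝ (σ t) (Y t)).comp (Y' t)

/-- `(Y, Y')` is a solution on `[0,T]` of
`Y_t = y + ∫_0^t b(s, Y_s, u_s) ds + ∫_0^t σ(s, Y_s) d(X, 𝕏)_s`:
it is a controlled rough path with `Y' = σ(·,Y)`, both integrals exist, and the equation holds.
The rough integral is that of `(σ(·,Y), ∇ₓσ(·,Y) Y')`. -/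
structure IsRDESolution {n m d : ℕ} (p T : ℝ) (y : EuclideanSpace ℝ (Fin n))
    (b : ℝ → EuclideanSpace ℝ (Fin n) → EuclideanSpace ℝ (Fin m) → EuclideanSpace ℝ (Fin n))
    (u : ℝ → EuclideanSpace ℝ (Fin m))
    (σ : ℝ → EuclideanSpace ℝ (Fin n) →
      (EuclideanSpace ℝ (Fin d) →L[ℝ] EuclideanSpace ℝ (Fin n)))
    (X : ℝ → EuclideanSpace ℝ (Fin d)) (XX : ℝ → ℝ → EuclideanSpace ℝ (Fin d × Fin d))
    (Y : ℝ → EuclideanSpace ℝ (Fin n))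
    (Y' : ℝ → EuclideanSpace ℝ (Fin d) →L[ℝ] EuclideanSpace ℝ (Fin n)) : Prop where
  controlled : IsControlled p T X Y Y'
  deriv_eq : ∀ t ∈ Icc 0 T, Y' t = σ t (Y t)
  integrable_drift : IntegrableOn (fun s => b s (Y s) (u s)) (Icc 0 T)
  equation : ∀ t ∈ Icc 0 T,
    HasRoughIntegral X XX (fun s => σ s (Y s)) (compDeriv σ Y Y') 0 t
      (Y t - y - ∫ s in (0 : ℝ)..t, b s (Y s) (u s))

end RoughDE

/-! The argument is Davie's: a continuous path starting at `y` solves the RDE exactly when it has a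
local expansion whose error is of order greater than one. Let `ω` be a control of the rough path and
of time, and put `ρ = ω ^ α` with `α > 1/3`, so that increments of `X` are bounded by `ρ`, and those
of `𝕏` and of time by `ρ²`. The expansion says that `Y_t - Y_s` equals the drift integral over
`[s,t]` plus `σ(s,Y_s) X_{s,t} + (∇ₓσ σ)(s,Y_s) 𝕏_{s,t}` up to `O(ρ³)`, where `ρ³ = ω ^ (3α)` and
`3α > 1`.

Two facts carry everything. Chen's relation and Taylor's formula make the defect of additivity of
the local increments third order (`localIncrement_defect_eq`, `norm_localIncrement_defect_le`).
Sewing converts a bound on such a defect into a bound on the error itself, with a constant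
independent of the partition (`sewing_discrete_step`, `norm_sub_sum_le`, `norm_le_of_defect_le`).

Existence: Euler schemes along finite sets of times obey a third-order bound independent of the set
(`exists_euler_scheme`). Hence their values stay in a compact ball, and a limit along an ultrafilter
gives a path with the same bound at all times (`exists_local_solution`). From the expansion the
compensated Riemann sums converge (`tendsto_riemann_sum`), and `p`-variation regularity follows
(`dominated_remainder`).

Uniqueness: a solution has the expansion, because its Riemann sums converge and their defect is
third order (`norm_sub_le_of_tendsto_riemann_sum`). For two solutions at distance at most `L` the
difference of the defects is at most a constant times `L ρ³`; this is where the third derivative of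
`σ` enters (`norm_localIncrement_defect_sub_le`). On a short interval with equal initial values `L`
then improves to `L / 2`, so the solutions agree there, and short intervals are chained
(`eqOn_of_expansion`). -/

namespace RoughDE

/-! ### Controls and the discrete sewing lemma -/

/-- A nonnegative superadditive function on the simplex over `[0,T]`, uniformly small on short
intervals. -/
structure RegularControl (T : ℝ) (ω : ℝ → ℝ → ℝ) : Prop where
  nonneg : ∀ s t, 0 ≤ s → s ≤ t → t ≤ T → 0 ≤ ω s t
  superadd : ∀ s u t, 0 ≤ s → s ≤ u → u ≤ t → t ≤ T → ω s u + ω u t ≤ ω s t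
  small : ∀ ε > 0, ∃ h > 0, ∀ s t, 0 ≤ s → s ≤ t → t ≤ T → t - s ≤ h → ω s t ≤ ε

theorem RegularControl.mono {T : ℝ} {ω : ℝ → ℝ → ℝ} (h : RegularControl T ω) {s s' t' t : ℝ}
    (hs : 0 ≤ s) (h1 : s ≤ s') (h2 : s' ≤ t') (h3 : t' ≤ t) (ht : t ≤ T) :
    ω s' t' ≤ ω s t := by
  have a := h.superadd s s' t hs h1 (h2.trans h3) ht
  have b := h.superadd s' t' t (hs.trans h1) h2 h3 ht
  have c := h.nonneg s s' hs h1 (by linarith)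
  have d := h.nonneg t' t (by linarith) h3 ht
  linarith

/-- The constant of the discrete sewing lemma. -/
noncomputable def sewingConst (θ : ℝ) : ℝ := 2 / (1 - 2 ^ (1 - θ))

theorem sewingConst_pos {θ : ℝ} (hθ : 1 < θ) : 0 < sewingConst θ := by
  have : (2 : ℝ) ^ (1 - θ) < 1 := Real.rpow_lt_one_of_one_lt_of_neg (by norm_num) (by linarith)
  unfold sewingConst
  apply div_pos <;> linarith

/-- The fixed-point equation of the bisection recursion: each half carries at most half of the
control, hence a factor `(1/2) ^ θ`, and two defects are added. It has a positive solution because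
`θ > 1`. -/
theorem sewingConst_eq {θ : ℝ} (hθ : 1 < θ) :
    2 * (sewingConst θ * (1 / 2) ^ θ) + 2 = sewingConst θ := by
  have h1 : (2 : ℝ) ^ (1 - θ) < 1 := Real.rpow_lt_one_of_one_lt_of_neg (by norm_num) (by linarith)
  have h2 : (1 / 2 : ℝ) ^ θ = 2 ^ (1 - θ) / 2 := by
    rw [Real.rpow_sub (by norm_num), Real.rpow_one, one_div, Real.inv_rpow (by norm_num)]
    field_simp
  have h3 : (1 : ℝ) - 2 ^ (1 - θ) ≠ 0 := by linarith
  rw [h2]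
  unfold sewingConst
  field_simp
  ring

/-- Let `l + 1` be the first index at which the control from `i` exceeds half of the total. Up to
`l` at most half is used, and superadditivity leaves at most half after `l + 1`. The step from `l`
to `l + 1` belongs to neither piece, and its own control may be large. -/
theorem exists_balanced_split {N : ℕ} {ω : ℕ → ℕ → ℝ}
    (h0 : ∀ i j, i ≤ j → j ≤ N → 0 ≤ ω i j)
    (hs : ∀ i l j, i ≤ l → l ≤ j → j ≤ N → ω i l + ω l j ≤ ω i j)
    {i j : ℕ} (hij : i < j) (hj : j ≤ N) :
    ∃ l, i ≤ l ∧ l < j ∧ ω i l ≤ ω i j / 2 ∧ ω (l + 1) j ≤ ω i j / 2 := by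
  classical
  have hz : ∀ k ≤ N, ω k k = 0 := fun k hk =>
    le_antisymm (by linarith [hs k k k le_rfl le_rfl hk]) (h0 k k le_rfl hk)
  -- The alternative `j ≤ k` ends the search at `j` at the latest; in that case the right piece is a
  -- point, where the control vanishes.
  have hex : ∃ k, i < k ∧ (ω i j / 2 < ω i k ∨ j ≤ k) := ⟨j, hij, Or.inr le_rfl⟩
  obtain ⟨h1, h2⟩ := Nat.find_spec hex
  have hmin := fun m => Nat.find_min hex (m := m)
  have hkj : Nat.find hex ≤ j := Nat.find_min' hex ⟨hij, Or.inr le_rfl⟩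
  generalize Nat.find hex = k at *
  obtain ⟨l, rfl⟩ : ∃ l, k = l + 1 := ⟨k - 1, by omega⟩
  have hpos := h0 i j hij.le hj
  refine ⟨l, by omega, by omega, ?_, ?_⟩
  · rcases Nat.lt_or_ge i l with h | h
    · have := hmin l (by omega)
      push Not at this
      exact (this h).1
    · obtain rfl : i = l := by omega
      rw [hz i (by omega)]
      linarith
  · rcases h2 with h2 | h2
    · have := hs i (l + 1) j (by omega) hkj hj
      linarith
    · obtain rfl : j = l + 1 := by omega
      rw [hz _ hj]
      linarith

section Discrete

variable {V : Type*} [NormedAddCommGroup V]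

theorem sewing_step {θ K w₁ w₂ w : ℝ} (hθ : 1 < θ) (hK : 0 ≤ K)
    (h1 : 0 ≤ w₁) (h2 : 0 ≤ w₂) (h1' : w₁ ≤ w / 2) (h2' : w₂ ≤ w / 2) {x₁ x₂ x₃ x₄ : V}
    (hx1 : ‖x₁‖ ≤ sewingConst θ * K * w₁ ^ θ) (hx2 : ‖x₂‖ ≤ sewingConst θ * K * w₂ ^ θ)
    (hx3 : ‖x₃‖ ≤ K * w ^ θ) (hx4 : ‖x₄‖ ≤ K * w ^ θ) :
    ‖x₁ + x₂ + x₃ + x₄‖ ≤ sewingConst θ * K * w ^ θ := by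
  have hc := sewingConst_pos hθ
  have hw : 0 ≤ w := by linarith
  have e : (w / 2) ^ θ = (1 / 2) ^ θ * w ^ θ := by
    rw [← Real.mul_rpow (by norm_num) hw]; congr 1; ring
  have a1 : w₁ ^ θ ≤ (1 / 2) ^ θ * w ^ θ := e ▸ Real.rpow_le_rpow h1 h1' (by linarith)
  have a2 : w₂ ^ θ ≤ (1 / 2) ^ θ * w ^ θ := e ▸ Real.rpow_le_rpow h2 h2' (by linarith)
  have hcK : 0 ≤ sewingConst θ * K := by positivity
  have b1 := hx1.trans (mul_le_mul_of_nonneg_left a1 hcK)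
  have b2 := hx2.trans (mul_le_mul_of_nonneg_left a2 hcK)
  calc ‖x₁ + x₂ + x₃ + x₄‖ ≤ ‖x₁‖ + ‖x₂‖ + ‖x₃‖ + ‖x₄‖ := norm_add₄_le
    _ ≤ (2 * (sewingConst θ * (1 / 2) ^ θ) + 2) * (K * w ^ θ) := by linarith
    _ = sewingConst θ * K * w ^ θ := by rw [sewingConst_eq hθ]; ring

/-- One bisection step of the discrete sewing lemma, for a two-parameter family with vanishing
short increments. -/
theorem sewing_discrete_step {θ K : ℝ} (hθ : 1 < θ) (hK : 0 ≤ K) {N : ℕ} {ω : ℕ → ℕ → ℝ}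
    (h0 : ∀ i j, i ≤ j → j ≤ N → 0 ≤ ω i j)
    (hs : ∀ i l j, i ≤ l → l ≤ j → j ≤ N → ω i l + ω l j ≤ ω i j)
    {E : ℕ → ℕ → V} (hE0 : ∀ i, E i i = 0) (hE1 : ∀ i, E i (i + 1) = 0)
    {i j : ℕ} (hij : i < j) (hj : j ≤ N)
    (hδ : ∀ k l m, i ≤ k → k < l → l < m → m ≤ j →
      ‖E k m - E k l - E l m‖ ≤ K * ω k m ^ θ)
    (ih : ∀ k l, i ≤ k → k ≤ l → l ≤ j → l - k < j - i →
      ‖E k l‖ ≤ sewingConst θ * K * ω k l ^ θ) :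
    ‖E i j‖ ≤ sewingConst θ * K * ω i j ^ θ := by
  obtain ⟨l, hil, hlj, h1, h2⟩ := exists_balanced_split h0 hs hij hj
  have hδ' : ∀ k l m, i ≤ k → k ≤ l → l ≤ m → m ≤ j →
      ‖E k m - E k l - E l m‖ ≤ K * ω k m ^ θ := by
    intro k l m hk hkl hlm hm
    have hp : 0 ≤ K * ω k m ^ θ :=
      mul_nonneg hK (Real.rpow_nonneg (h0 k m (hkl.trans hlm) (hm.trans hj)) _)
    rcases hkl.eq_or_lt with rfl | hkl
    · simpa [hE0] using hp
    rcases hlm.eq_or_lt with rfl | hlm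
    · simpa [hE0] using hp
    exact hδ k l m hk hkl hlm hm
  -- The omitted step from `l` to `l + 1` costs nothing since `E` vanishes there. What remains is
  -- two shorter intervals, covered by induction, and two defects.
  have e : E i j = E i l + E (l + 1) j + (E i j - E i l - E l j)
      + (E l j - E l (l + 1) - E (l + 1) j) := by rw [hE1]; abel
  rw [e]
  have hm : ω l j ≤ ω i j := by
    have := hs i l j hil hlj.le hj
    have := h0 i l hil (by omega)
    linarith
  refine sewing_step hθ hK (h0 i l hil (by omega)) (h0 (l + 1) j hlj hj) h1 h2
    (ih i l le_rfl hil hlj.le (by omega)) (ih (l + 1) j (by omega) hlj le_rfl (by omega))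
    (hδ' i l j le_rfl hil hlj.le le_rfl) ?_
  refine (hδ' l (l + 1) j hil (by omega) hlj le_rfl).trans ?_
  exact mul_le_mul_of_nonneg_left (Real.rpow_le_rpow (h0 l j hlj.le hj) hm (by linarith)) hK

theorem sewing_discrete {θ K : ℝ} (hθ : 1 < θ) (hK : 0 ≤ K) {N : ℕ} {ω : ℕ → ℕ → ℝ}
    (h0 : ∀ i j, i ≤ j → j ≤ N → 0 ≤ ω i j)
    (hs : ∀ i l j, i ≤ l → l ≤ j → j ≤ N → ω i l + ω l j ≤ ω i j)
    {E : ℕ → ℕ → V} (hE0 : ∀ i, E i i = 0) (hE1 : ∀ i, E i (i + 1) = 0)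
    (hδ : ∀ k l m, k < l → l < m → m ≤ N → ‖E k m - E k l - E l m‖ ≤ K * ω k m ^ θ)
    {i j : ℕ} (hij : i ≤ j) (hj : j ≤ N) :
    ‖E i j‖ ≤ sewingConst θ * K * ω i j ^ θ := by
  induction h : j - i using Nat.strong_induction_on generalizing i j with
  | _ n ih =>
    rcases hij.eq_or_lt with rfl | hlt
    · rw [hE0, norm_zero]
      have := sewingConst_pos hθ
      have := Real.rpow_nonneg (h0 i i le_rfl hj) θ
      positivity
    · exact sewing_discrete_step hθ hK h0 hs hE0 hE1 hlt hj
        (fun k l m _ hkl hlm hm => hδ k l m hkl hlm (hm.trans hj))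
        (fun k l _ hkl hl hlen => ih _ (h ▸ hlen) hkl (hl.trans hj) rfl)

end Discrete

/-! ### Sewing estimates on an interval -/

section Continuous

variable {V : Type*} [NormedAddCommGroup V] {T : ℝ} {ω : ℝ → ℝ → ℝ}

/-- Young's estimate: a two-parameter map with small defect of additivity is close to all its
Riemann sums. -/
theorem norm_sub_sum_le (hω : RegularControl T ω) {θ K : ℝ} (hθ : 1 < θ) (hK : 0 ≤ K)
    {E : ℝ → ℝ → V} {τ : ℕ → ℝ} {N : ℕ} (h0 : 0 ≤ τ 0)
    (hτ : ∀ i < N, τ i ≤ τ (i + 1)) (hT : τ N ≤ T)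
    (hδ : ∀ s u t, τ 0 ≤ s → s ≤ u → u ≤ t → t ≤ τ N →
      ‖E s t - E s u - E u t‖ ≤ K * ω s t ^ θ) (hN : 0 < N) :
    ‖E (τ 0) (τ N) - ∑ i ∈ Finset.range N, E (τ i) (τ (i + 1))‖
      ≤ sewingConst θ * K * ω (τ 0) (τ N) ^ θ := by
  have mono : ∀ i j, i ≤ j → j ≤ N → τ i ≤ τ j := by
    intro i j hij
    induction j, hij using Nat.le_induction with
    | base => intro _; exact le_rfl
    | succ j _ ih => intro hj; exact (ih (by omega)).trans (hτ j (by omega))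
  -- Subtracting the Riemann sum, which is additive, leaves the defects unchanged and makes one-step
  -- values vanish. The diagonal is set to zero by hand because nothing is assumed on `E s s`.
  let S : ℕ → ℕ → V := fun i j => if i = j then 0 else
    E (τ i) (τ j) - ∑ l ∈ Finset.Ico i j, E (τ l) (τ (l + 1))
  have key := sewing_discrete (θ := θ) (K := K) (N := N) (ω := fun i j => ω (τ i) (τ j)) (E := S)
    hθ hK
    (fun i j hij hj => hω.nonneg _ _ (h0.trans (mono 0 i (by omega) (by omega))) (mono i j hij hj)
      ((mono j N hj le_rfl).trans hT))
    (fun i l j hil hlj hj => hω.superadd _ _ _ (h0.trans (mono 0 i (by omega) (by omega)))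
      (mono i l hil (by omega)) (mono l j hlj hj) ((mono j N hj le_rfl).trans hT))
    (fun i => by simp [S]) (fun i => by simp [S])
    (fun k l m hkl hlm hm => ?_) (i := 0) (j := N) (Nat.zero_le _) le_rfl
  · simpa [S, hN.ne, Nat.Ico_zero_eq_range] using key
  · have e : S k m - S k l - S l m = E (τ k) (τ m) - E (τ k) (τ l) - E (τ l) (τ m) := by
      simp only [S, hkl.ne, hlm.ne, (hkl.trans hlm).ne, if_false]
      rw [← Finset.sum_Ico_consecutive _ hkl.le hlm.le]
      abel
    rw [e]
    exact hδ _ _ _ (mono 0 k (by omega) (by omega)) (mono k l hkl.le (by omega))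
      (mono l m hlm.le hm) (mono m N hm le_rfl)

theorem RegularControl.sum_le (hω : RegularControl T ω) {τ : ℕ → ℝ} {N : ℕ} (h0 : 0 ≤ τ 0)
    (hτ : ∀ i < N, τ i ≤ τ (i + 1)) (hT : τ N ≤ T) :
    τ 0 ≤ τ N ∧ ∑ i ∈ Finset.range N, ω (τ i) (τ (i + 1)) ≤ ω (τ 0) (τ N) := by
  induction N with
  | zero => exact ⟨le_rfl, by simpa using hω.nonneg _ _ h0 le_rfl hT⟩
  | succ N ih =>
    have h1 := hτ N (by omega)
    obtain ⟨h2, h3⟩ := ih (fun i hi => hτ i (by omega)) (h1.trans hT)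
    refine ⟨h2.trans h1, ?_⟩
    rw [Finset.sum_range_succ]
    have := hω.superadd _ _ _ h0 h2 h1 hT
    linarith

/-- One factor of the control is summed by superadditivity; the other `θ - 1` powers are bounded by
the largest control of a subinterval. This is why errors of order `θ > 1` disappear as the mesh
vanishes. -/
theorem RegularControl.sum_rpow_le (hω : RegularControl T ω) {θ η : ℝ} (hθ : 1 < θ) {τ : ℕ → ℝ}
    {N : ℕ} (h0 : 0 ≤ τ 0) (hτ : ∀ i < N, τ i ≤ τ (i + 1)) (hT : τ N ≤ T)
    (hη : ∀ i < N, ω (τ i) (τ (i + 1)) ≤ η) :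
    ∑ i ∈ Finset.range N, ω (τ i) (τ (i + 1)) ^ θ ≤ η ^ (θ - 1) * ω (τ 0) (τ N) := by
  rcases Nat.eq_zero_or_pos N with rfl | hN
  · have h := hω.superadd _ _ _ h0 le_rfl le_rfl hT
    have h' := hω.nonneg _ _ h0 le_rfl hT
    have : ω (τ 0) (τ 0) = 0 := by linarith
    simp [this]
  have hb : ∀ i < N, 0 ≤ τ i ∧ τ (i + 1) ≤ T := by
    intro i hi
    refine ⟨h0.trans (hω.sum_le h0 (fun k hk => hτ k (by omega)) ?_).1, ?_⟩
    all_goals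
      have mono : ∀ k, i ≤ k → k ≤ N → τ i ≤ τ k ∧ (i < k → τ (i + 1) ≤ τ k) := by
        intro k hk
        induction k, hk using Nat.le_induction with
        | base => intro _; exact ⟨le_rfl, fun h => absurd h (lt_irrefl _)⟩
        | succ k hk ih =>
          intro hkN
          obtain ⟨a, b⟩ := ih (by omega)
          have c := hτ k (by omega)
          refine ⟨a.trans c, fun _ => ?_⟩
          rcases hk.eq_or_lt with rfl | h
          · exact le_rfl
          · exact (b h).trans c
    · exact (mono N hi.le le_rfl).1.trans hT
    · exact ((mono N hi.le le_rfl).2 hi).trans hT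
  have hη0 : 0 ≤ η := (hω.nonneg _ _ (hb 0 hN).1 (hτ 0 hN) (hb 0 hN).2).trans (hη 0 hN)
  calc ∑ i ∈ Finset.range N, ω (τ i) (τ (i + 1)) ^ θ
      ≤ ∑ i ∈ Finset.range N, η ^ (θ - 1) * ω (τ i) (τ (i + 1)) := by
        refine Finset.sum_le_sum fun i hi => ?_
        have hi := Finset.mem_range.1 hi
        have hp := hω.nonneg _ _ (hb i hi).1 (hτ i hi) (hb i hi).2
        have e : ω (τ i) (τ (i + 1)) ^ θ
            = ω (τ i) (τ (i + 1)) ^ (θ - 1) * ω (τ i) (τ (i + 1)) := by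
          rw [← Real.rpow_add_one' hp (by linarith)]; congr 1; ring
        rw [e]
        exact mul_le_mul_of_nonneg_right (Real.rpow_le_rpow hp (hη i hi) (by linarith)) hp
    _ = η ^ (θ - 1) * ∑ i ∈ Finset.range N, ω (τ i) (τ (i + 1)) := by rw [Finset.mul_sum]
    _ ≤ _ := mul_le_mul_of_nonneg_left (hω.sum_le h0 hτ hT).2 (Real.rpow_nonneg hη0 _)

theorem exists_pos_rpow_mul_le {θ : ℝ} (hθ : 1 < θ) (M : ℝ) {ε : ℝ} (hε : 0 < ε) :
    ∃ η > 0, η ^ (θ - 1) * M ≤ ε := by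
  have hM : 0 < |M| + 1 := by positivity
  refine ⟨(ε / (|M| + 1)) ^ (1 / (θ - 1)), by positivity, ?_⟩
  rw [← Real.rpow_mul (by positivity), one_div_mul_cancel (by linarith), Real.rpow_one,
    div_mul_eq_mul_div, div_le_iff₀ hM]
  have := le_abs_self M
  nlinarith

/-- A two-parameter map of order `θ > 1` is controlled by its defect of additivity. -/
theorem norm_le_of_defect_le (hω : RegularControl T ω) {θ K K₀ : ℝ} (hθ : 1 < θ) (hK : 0 ≤ K)
    (hK₀ : 0 ≤ K₀) {E : ℝ → ℝ → V} {a b : ℝ} (ha : 0 ≤ a) (hb : b ≤ T)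
    (h : ∀ s t, a ≤ s → s ≤ t → t ≤ b → ‖E s t‖ ≤ K₀ * ω s t ^ θ)
    (hδ : ∀ s u t, a ≤ s → s ≤ u → u ≤ t → t ≤ b →
      ‖E s t - E s u - E u t‖ ≤ K * ω s t ^ θ)
    {s t : ℝ} (hs : a ≤ s) (hst : s ≤ t) (ht : t ≤ b) :
    ‖E s t‖ ≤ sewingConst θ * K * ω s t ^ θ := by
  refine le_of_forall_pos_le_add fun ε hε => ?_
  -- A uniform subdivision is taken so fine that the a priori bound makes the Riemann sum of `E` at
  -- most `ε`. Thus `K₀` serves only to let the sum vanish and does not enter the conclusion.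
  obtain ⟨η, hη, hη'⟩ := exists_pos_rpow_mul_le hθ (K₀ * ω s t) hε
  obtain ⟨d, hd, hd'⟩ := hω.small η hη
  obtain ⟨N, hN⟩ := exists_nat_gt ((t - s) / d)
  have hN0 : 0 < N := by
    have : (0 : ℝ) < N := lt_of_le_of_lt (div_nonneg (by linarith) hd.le) hN
    exact_mod_cast this
  have hNr : (0 : ℝ) < N := by exact_mod_cast hN0
  let τ : ℕ → ℝ := fun i => s + i * ((t - s) / N)
  have e0 : τ 0 = s := by simp [τ]
  have eN : τ N = t := by simp only [τ]; field_simp; ring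
  have hstep : ∀ i, τ (i + 1) - τ i = (t - s) / N := by intro i; simp only [τ]; push_cast; ring
  have hpos : 0 ≤ (t - s) / N := div_nonneg (by linarith) hNr.le
  have hmono : Monotone τ := monotone_nat_of_le_succ fun i => by linarith [hstep i]
  have hsm : (t - s) / N ≤ d := by
    rw [div_le_iff₀ hNr]; rw [div_lt_iff₀ hd] at hN; linarith
  have h1 := norm_sub_sum_le (E := E) hω hθ hK (τ := τ) (N := N) (by rw [e0]; linarith)
    (fun i _ => hmono (Nat.le_succ i)) (by rw [eN]; linarith)
    (fun s' u t' h1 h2 h3 h4 => hδ s' u t' (by linarith) h2 h3 (by linarith)) hN0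
  have hin : ∀ i < N, s ≤ τ i ∧ τ (i + 1) ≤ t := fun i hi =>
    ⟨e0 ▸ hmono (Nat.zero_le i), eN ▸ hmono hi⟩
  have h2 := hω.sum_rpow_le (η := η) hθ (τ := τ) (N := N) (by rw [e0]; linarith)
    (fun i _ => hmono (Nat.le_succ i)) (by rw [eN]; linarith)
    (fun i hi => hd' _ _ (by linarith [hin i hi]) (hmono (Nat.le_succ i)) (by linarith [hin i hi])
      (by rw [hstep]; exact hsm))
  rw [e0, eN] at h1 h2
  have h3 : ‖∑ i ∈ Finset.range N, E (τ i) (τ (i + 1))‖ ≤ ε := by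
    refine (norm_sum_le _ _).trans ?_
    calc ∑ i ∈ Finset.range N, ‖E (τ i) (τ (i + 1))‖
        ≤ ∑ i ∈ Finset.range N, K₀ * ω (τ i) (τ (i + 1)) ^ θ := by
          refine Finset.sum_le_sum fun i hi => ?_
          have hi := hin i (Finset.mem_range.1 hi)
          exact h _ _ (by linarith) (hmono (Nat.le_succ i)) (by linarith)
      _ = K₀ * ∑ i ∈ Finset.range N, ω (τ i) (τ (i + 1)) ^ θ := by rw [Finset.mul_sum]
      _ ≤ K₀ * (η ^ (θ - 1) * ω s t) := mul_le_mul_of_nonneg_left h2 hK₀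
      _ ≤ ε := by linarith
  calc ‖E s t‖ = ‖(E s t - ∑ i ∈ Finset.range N, E (τ i) (τ (i + 1)))
        + ∑ i ∈ Finset.range N, E (τ i) (τ (i + 1))‖ := by rw [sub_add_cancel]
    _ ≤ _ := norm_add_le _ _
    _ ≤ _ := add_le_add h1 h3

end Continuous

/-! ### Partitions and finite variation -/

/-- Appending a point to a partition. -/
def Partition.snoc {a b c : ℝ} (π : Partition a b) (h : b < c) : Partition a c where
  n := π.n + 1
  point i := if i ≤ π.n then π.point i else c
  point_zero := by simp [π.point_zero]
  point_last := by simp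
  lt_succ i hi := by
    rcases Nat.lt_or_ge i π.n with h' | h'
    · simp [h'.le, Nat.succ_le_of_lt h', π.lt_succ i h']
    · obtain rfl : i = π.n := by omega
      simp [π.point_last, h]

/-- The partition into one interval, or into none if the interval is a point. -/
noncomputable def Partition.trivial {a b : ℝ} (h : a ≤ b) : Partition a b :=
  open Classical in
  if h' : a = b then ⟨0, fun _ => a, rfl, h', by simp⟩
  else ⟨1, fun i => if i = 0 then a else b, by simp, by simp, by
    intro i hi
    obtain rfl : i = 0 := by omega
    simpa using lt_of_le_of_ne h h'⟩

theorem Partition.point_mono {a b : ℝ} (π : Partition a b) {i j : ℕ} (hij : i ≤ j) (hj : j ≤ π.n) :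
    π.point i ≤ π.point j := by
  induction j, hij using Nat.le_induction with
  | base => exact le_rfl
  | succ j _ ih => exact (ih (by omega)).trans (π.lt_succ j (by omega)).le

theorem Partition.le_point {a b : ℝ} (π : Partition a b) {i : ℕ} (hi : i ≤ π.n) :
    a ≤ π.point i := by
  have := π.point_mono (Nat.zero_le i) hi
  rwa [π.point_zero] at this

theorem Partition.point_le {a b : ℝ} (π : Partition a b) {i : ℕ} (hi : i ≤ π.n) :
    π.point i ≤ b := by
  have := π.point_mono hi le_rfl
  rwa [π.point_last] at this

theorem Partition.sum_snoc {M : Type*} [AddCommMonoid M] {a b c : ℝ} (π : Partition a b)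
    (h : b < c) (f : ℝ → ℝ → M) :
    ∑ i ∈ Finset.range (π.snoc h).n, f ((π.snoc h).point i) ((π.snoc h).point (i + 1))
      = ∑ i ∈ Finset.range π.n, f (π.point i) (π.point (i + 1)) + f b c := by
  simp only [Partition.snoc]
  rw [Finset.sum_range_succ]
  congr 1
  · refine Finset.sum_congr rfl fun i hi => ?_
    have := Finset.mem_range.1 hi
    simp [this.le, Nat.succ_le_of_lt this]
  · simp [π.point_last]

/-- `g` is dominated by the increments of a monotone function on `[0,T]`. -/
def Dominated (T : ℝ) (g : ℝ → ℝ → ℝ) : Prop :=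
  ∃ W : ℝ → ℝ, ∀ s t, 0 ≤ s → s < t → t ≤ T → W s ≤ W t ∧ g s t ≤ W t - W s

theorem Dominated.add {T : ℝ} {f g : ℝ → ℝ → ℝ} (hf : Dominated T f) (hg : Dominated T g) :
    Dominated T fun s t => f s t + g s t := by
  obtain ⟨W, hW⟩ := hf
  obtain ⟨W', hW'⟩ := hg
  refine ⟨fun t => W t + W' t, fun s t h0 hst hT => ?_⟩
  obtain ⟨a, b⟩ := hW s t h0 hst hT
  obtain ⟨c, d⟩ := hW' s t h0 hst hT
  constructor <;> linarith

theorem Dominated.const_mul {T c : ℝ} {f : ℝ → ℝ → ℝ} (hf : Dominated T f) (hc : 0 ≤ c) :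
    Dominated T fun s t => c * f s t := by
  obtain ⟨W, hW⟩ := hf
  refine ⟨fun t => c * W t, fun s t h0 hst hT => ?_⟩
  obtain ⟨a, b⟩ := hW s t h0 hst hT
  refine ⟨mul_le_mul_of_nonneg_left a hc, ?_⟩
  rw [← mul_sub]
  exact mul_le_mul_of_nonneg_left b hc

theorem Dominated.mono {T : ℝ} {f g : ℝ → ℝ → ℝ} (hf : Dominated T f)
    (h : ∀ s t, 0 ≤ s → s < t → t ≤ T → g s t ≤ f s t) : Dominated T g := by
  obtain ⟨W, hW⟩ := hf
  exact ⟨W, fun s t h0 hst hT =>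
    ⟨(hW s t h0 hst hT).1, (h s t h0 hst hT).trans (hW s t h0 hst hT).2⟩⟩

theorem RegularControl.dominated {T : ℝ} {ω : ℝ → ℝ → ℝ} (h : RegularControl T ω) :
    Dominated T ω := by
  refine ⟨fun t => ω 0 t, fun s t h0 hst hT => ?_⟩
  have := h.superadd 0 s t le_rfl h0 hst.le hT
  have := h.nonneg s t h0 hst.le hT
  constructor <;> linarith

theorem dominated_sub (T : ℝ) : Dominated T fun s t => t - s :=
  ⟨id, fun _ _ _ hst _ => ⟨hst.le, le_rfl⟩⟩

theorem add_rpow_le_two_mul {a b q : ℝ} (ha : 0 ≤ a) (hb : 0 ≤ b) (hq : 0 < q) :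
    (a + b) ^ q ≤ 2 ^ q * (a ^ q + b ^ q) := by
  have h : a + b ≤ 2 * max a b := by
    have := le_max_left a b
    have := le_max_right a b
    linarith
  have hm : 0 ≤ max a b := ha.trans (le_max_left _ _)
  calc (a + b) ^ q ≤ (2 * max a b) ^ q := Real.rpow_le_rpow (by positivity) h hq.le
    _ = 2 ^ q * (max a b) ^ q := Real.mul_rpow (by norm_num) hm
    _ ≤ _ := by
      gcongr
      have := Real.rpow_nonneg ha q
      have := Real.rpow_nonneg hb q
      rcases max_cases a b with ⟨h, _⟩ | ⟨h, _⟩ <;> rw [h] <;> linarith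

theorem Dominated.rpow_of_le_add {T q : ℝ} (hq : 0 < q) {f g h : ℝ → ℝ → ℝ}
    (hf : Dominated T fun s t => f s t ^ q) (hg : Dominated T fun s t => g s t ^ q)
    (hf0 : ∀ s t, 0 ≤ s → s < t → t ≤ T → 0 ≤ f s t)
    (hg0 : ∀ s t, 0 ≤ s → s < t → t ≤ T → 0 ≤ g s t)
    (hh0 : ∀ s t, 0 ≤ h s t)
    (hle : ∀ s t, 0 ≤ s → s < t → t ≤ T → h s t ≤ f s t + g s t) :
    Dominated T fun s t => h s t ^ q :=
  ((hf.add hg).const_mul (c := 2 ^ q) (by positivity)).mono fun s t h0 hst hT =>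
    (Real.rpow_le_rpow (hh0 s t) (hle s t h0 hst hT) hq.le).trans
      (add_rpow_le_two_mul (hf0 s t h0 hst hT) (hg0 s t h0 hst hT) hq)

theorem Dominated.rpow_const_mul {T q c : ℝ} (hc : 0 ≤ c) {f : ℝ → ℝ → ℝ}
    (hf : Dominated T fun s t => f s t ^ q)
    (hf0 : ∀ s t, 0 ≤ s → s < t → t ≤ T → 0 ≤ f s t) :
    Dominated T fun s t => (c * f s t) ^ q :=
  (hf.const_mul (c := c ^ q) (by positivity)).mono fun s t h0 hst hT => by
    rw [Real.mul_rpow hc (hf0 s t h0 hst hT)]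

/-- A bounded function keeps finite variation when the exponent increases. -/
theorem Dominated.rpow_exponent {T q q' M : ℝ} (hq : 0 < q) (hqq' : q ≤ q') {f : ℝ → ℝ → ℝ}
    (hf : Dominated T fun s t => f s t ^ q)
    (hf0 : ∀ s t, 0 ≤ s → s < t → t ≤ T → 0 ≤ f s t)
    (hM : ∀ s t, 0 ≤ s → s < t → t ≤ T → f s t ≤ M) :
    Dominated T fun s t => f s t ^ q' := by
  refine (hf.const_mul (c := |M| ^ (q' - q)) (by positivity)).mono fun s t h0 hst hT => ?_
  have h := hf0 s t h0 hst hT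
  have e : f s t ^ q' = f s t ^ (q' - q) * f s t ^ q := by
    rw [← Real.rpow_add_of_nonneg h (by linarith) hq.le]; congr 1; ring
  rw [e]
  gcongr
  exact (hM s t h0 hst hT).trans (le_abs_self M)

section Variation

variable {F : Type*} [NormedAddCommGroup F] {q T : ℝ} {A : ℝ → ℝ → F}

theorem ofReal_sum_norm_rpow (hq : 0 < q) {a b : ℝ} (π : Partition a b) :
    ENNReal.ofReal (∑ i ∈ Finset.range π.n, ‖A (π.point i) (π.point (i + 1))‖ ^ q)
      = ∑ i ∈ Finset.range π.n, ‖A (π.point i) (π.point (i + 1))‖ₑ ^ q := by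
  rw [ENNReal.ofReal_sum_of_nonneg fun i _ => by positivity]
  refine Finset.sum_congr rfl fun i _ => ?_
  rw [← ofReal_norm, ENNReal.ofReal_rpow_of_nonneg (norm_nonneg _) hq.le]

/-- The dominating function at `t` is the supremum of the variation sums over partitions of `[0,t]`.
Appending `[s,t]` to a partition of `[0,s]` adds exactly `‖A s t‖ ^ q`, and appending `[t,T]` shows
that the supremum is finite. -/
theorem dominated_of_variation_lt_top (hq : 0 < q) (h : twoParamVariation q A 0 T < ∞) :
    Dominated T fun s t => ‖A s t‖ ^ q := by
  let S : ∀ {a b : ℝ}, Partition a b → ℝ := fun π =>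
    ∑ i ∈ Finset.range π.n, ‖A (π.point i) (π.point (i + 1))‖ ^ q
  obtain ⟨M, hM⟩ : ∃ M : ℝ, ∀ π : Partition 0 T, S π ≤ M := by
    have h' := (ENNReal.rpow_lt_top_iff_of_pos (by positivity)).1 h
    refine ⟨_, fun π => (ENNReal.ofReal_le_iff_le_toReal h'.ne).1 ?_⟩
    rw [ofReal_sum_norm_rpow hq]
    exact le_iSup (fun π : Partition 0 T =>
      ∑ i ∈ Finset.range π.n, ‖A (π.point i) (π.point (i + 1))‖ₑ ^ q) π
  have hsnoc : ∀ {a b c : ℝ} (π : Partition a b) (h : b < c),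
      S (π.snoc h) = S π + ‖A b c‖ ^ q :=
    fun π h => π.sum_snoc h fun u v => ‖A u v‖ ^ q
  have hbdd : ∀ t ≤ T, BddAbove (range fun π : Partition 0 t => S π) := by
    intro t ht
    refine ⟨M, ?_⟩
    rintro _ ⟨π, rfl⟩
    rcases ht.eq_or_lt with rfl | ht
    · exact hM π
    · have := hM (π.snoc ht)
      rw [hsnoc] at this
      have : 0 ≤ ‖A t T‖ ^ q := by positivity
      show S π ≤ M
      linarith
  refine ⟨fun t => sSup (range fun π : Partition 0 t => S π), fun s t h0 hst hT => ?_⟩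
  have key : sSup (range fun π : Partition 0 s => S π)
      ≤ sSup (range fun π : Partition 0 t => S π) - ‖A s t‖ ^ q := by
    refine csSup_le ⟨_, ⟨Partition.trivial h0, rfl⟩⟩ ?_
    rintro _ ⟨π, rfl⟩
    have := le_csSup (hbdd t hT) ⟨π.snoc hst, rfl⟩
    simp only [hsnoc] at this
    linarith
  have : 0 ≤ ‖A s t‖ ^ q := by positivity
  constructor <;> linarith

/-- The increments of the dominating function telescope, so all variation sums share one bound.
Together with the converse this replaces suprema over partitions by pointwise inequalities. -/
theorem variation_lt_top_of_dominated (hq : 0 < q) (h : Dominated T fun s t => ‖A s t‖ ^ q) :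
    twoParamVariation q A 0 T < ∞ := by
  obtain ⟨W, hW⟩ := h
  refine (ENNReal.rpow_lt_top_iff_of_pos (by positivity)).2 ?_
  refine lt_of_le_of_lt (iSup_le fun π => ?_) (ENNReal.ofReal_lt_top (r := W T - W 0))
  rw [← ofReal_sum_norm_rpow hq]
  refine ENNReal.ofReal_le_ofReal ?_
  calc ∑ i ∈ Finset.range π.n, ‖A (π.point i) (π.point (i + 1))‖ ^ q
      ≤ ∑ i ∈ Finset.range π.n, (W (π.point (i + 1)) - W (π.point i)) := by
        refine Finset.sum_le_sum fun i hi => ?_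
        have hi := Finset.mem_range.1 hi
        exact (hW _ _ (π.le_point hi.le) (π.lt_succ i hi) (π.point_le hi)).2
    _ = W T - W 0 := by
      rw [Finset.sum_range_sub (fun i => W (π.point i)), π.point_last, π.point_zero]

end Variation

theorem RegularControl.add {T : ℝ} {ω ω' : ℝ → ℝ → ℝ} (h : RegularControl T ω)
    (h' : RegularControl T ω') : RegularControl T fun s t => ω s t + ω' s t where
  nonneg s t h0 hst hT := add_nonneg (h.nonneg s t h0 hst hT) (h'.nonneg s t h0 hst hT)
  superadd s u t h0 h1 h2 hT := by
    have := h.superadd s u t h0 h1 h2 hT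
    have := h'.superadd s u t h0 h1 h2 hT
    linarith
  small ε hε := by
    obtain ⟨d, hd, H⟩ := h.small (ε / 2) (by linarith)
    obtain ⟨d', hd', H'⟩ := h'.small (ε / 2) (by linarith)
    refine ⟨min d d', lt_min hd hd', fun s t h0 hst hT hle => ?_⟩
    have := H s t h0 hst hT (hle.trans (min_le_left _ _))
    have := H' s t h0 hst hT (hle.trans (min_le_right _ _))
    linarith

/-- A continuous two-parameter map of finite `q`-variation is dominated, for any exponent
`q' > q`, by a control that is small on short intervals. -/
theorem exists_regularControl {F : Type*} [NormedAddCommGroup F] {q q' T : ℝ} {A : ℝ → ℝ → F}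
    (hA : ContinuousOn (fun z : ℝ × ℝ => A z.1 z.2) (Icc 0 T ×ˢ Icc 0 T))
    (hdiag : ∀ s ∈ Icc 0 T, A s s = 0) (hq : 0 < q) (hqq' : q < q')
    (h : Dominated T fun s t => ‖A s t‖ ^ q) :
    ∃ ω, RegularControl T ω ∧ ∀ s t, 0 ≤ s → s ≤ t → t ≤ T → ‖A s t‖ ^ q' ≤ ω s t := by
  obtain ⟨W, hW⟩ := h
  have hcomp : IsCompact (Icc (0 : ℝ) T ×ˢ Icc (0 : ℝ) T) := isCompact_Icc.prod isCompact_Icc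
  obtain ⟨M, hM⟩ := hcomp.exists_bound_of_continuousOn hA
  have huc := hcomp.uniformContinuousOn_of_continuous hA
  rw [Metric.uniformContinuousOn_iff] at huc
  -- The supremum of `Q d` is the modulus of continuity of `A` off the diagonal. In `‖A‖ ^ q' = ‖A‖
  -- ^ q * ‖A‖ ^ (q' - q)` the first factor is bounded by increments of `W` and the second by the
  -- modulus. Smallness comes from the modulus alone, so `W` need not be continuous.
  let Q : ℝ → Set ℝ := fun d => {x | ∃ u v, 0 ≤ u ∧ u ≤ v ∧ v ≤ T ∧ v - u ≤ d ∧ x = ‖A u v‖}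
  have hbdd : ∀ d, BddAbove (Q d) := by
    intro d
    refine ⟨M, ?_⟩
    rintro _ ⟨u, v, h0, huv, hv, -, rfl⟩
    exact hM (u, v) ⟨⟨h0, huv.trans hv⟩, h0.trans huv, hv⟩
  have hQ0 : ∀ d, 0 ≤ sSup (Q d) := by
    intro d
    apply Real.sSup_nonneg
    rintro _ ⟨u, v, -, -, -, -, rfl⟩
    exact norm_nonneg _
  have hAQ : ∀ s t, 0 ≤ s → s ≤ t → t ≤ T → ‖A s t‖ ≤ sSup (Q (t - s)) := fun s t h0 hst hT =>
    le_csSup (hbdd _) ⟨s, t, h0, hst, hT, le_rfl, rfl⟩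
  have hQm : ∀ s t d, 0 ≤ s → s ≤ t → t ≤ T → t - s ≤ d → sSup (Q (t - s)) ≤ sSup (Q d) := by
    intro s t d h0 hst hT hd
    refine csSup_le_csSup (hbdd _) ⟨_, s, t, h0, hst, hT, le_rfl, rfl⟩ ?_
    rintro _ ⟨u, v, h1, h2, h3, h4, rfl⟩
    exact ⟨u, v, h1, h2, h3, h4.trans hd, rfl⟩
  have hWm : ∀ s t, 0 ≤ s → s ≤ t → t ≤ T → W s ≤ W t := by
    intro s t h0 hst hT
    rcases hst.eq_or_lt with rfl | hst
    · exact le_rfl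
    · exact (hW s t h0 hst hT).1
  have he : 0 < q' - q := by linarith
  refine ⟨fun s t => (W t - W s) * sSup (Q (t - s)) ^ (q' - q), ⟨?_, ?_, ?_⟩, ?_⟩
  · intro s t h0 hst hT
    have := hWm s t h0 hst hT
    have := Real.rpow_nonneg (hQ0 (t - s)) (q' - q)
    exact mul_nonneg (by linarith) this
  · intro s u t h0 hsu hut hT
    have a1 := Real.rpow_le_rpow (hQ0 _)
      (hQm s u (t - s) h0 hsu (hut.trans hT) (by linarith)) he.le
    have a2 := Real.rpow_le_rpow (hQ0 _)
      (hQm u t (t - s) (h0.trans hsu) hut hT (by linarith)) he.le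
    have b1 := hWm s u h0 hsu (hut.trans hT)
    have b2 := hWm u t (h0.trans hsu) hut hT
    have c1 := mul_le_mul_of_nonneg_left a1 (sub_nonneg.2 b1)
    have c2 := mul_le_mul_of_nonneg_left a2 (sub_nonneg.2 b2)
    have e : W t - W s = (W u - W s) + (W t - W u) := by ring
    simp only [e, add_mul]
    linarith
  · intro ε hε
    have hw : 0 < |W T - W 0| + 1 := by positivity
    have hη : 0 < (ε / (|W T - W 0| + 1)) ^ (1 / (q' - q)) := by positivity
    obtain ⟨δ, hδ, H⟩ := huc _ hη
    refine ⟨δ / 2, by linarith, fun s t h0 hst hT hle => ?_⟩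
    have h1 : sSup (Q (t - s)) ≤ (ε / (|W T - W 0| + 1)) ^ (1 / (q' - q)) := by
      apply Real.sSup_le _ hη.le
      rintro _ ⟨u, v, h1, h2, h3, h4, rfl⟩
      -- The comparison is with the diagonal point `(u, u)`, where `A` vanishes.
      have := H (u, v) ⟨⟨h1, h2.trans h3⟩, h1.trans h2, h3⟩ (u, u)
        ⟨⟨h1, h2.trans h3⟩, h1, h2.trans h3⟩ (by
          rw [Prod.dist_eq, dist_self, Real.dist_eq, abs_of_nonneg (by simpa using h2)]
          simp only [max_lt_iff]
          exact ⟨hδ, by linarith⟩)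
      simp only [hdiag u ⟨h1, h2.trans h3⟩, dist_zero_right] at this
      exact this.le
    have h2 := Real.rpow_le_rpow (hQ0 _) h1 he.le
    rw [← Real.rpow_mul (by positivity), one_div_mul_cancel he.ne', Real.rpow_one] at h2
    have h3 : W t - W s ≤ |W T - W 0| + 1 := by
      have := hWm 0 s le_rfl h0 (hst.trans hT)
      have := hWm t T (h0.trans hst) hT le_rfl
      have := le_abs_self (W T - W 0)
      linarith
    calc (W t - W s) * sSup (Q (t - s)) ^ (q' - q)
        ≤ (|W T - W 0| + 1) * (ε / (|W T - W 0| + 1)) :=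
          mul_le_mul h3 h2 (Real.rpow_nonneg (hQ0 _) _) hw.le
      _ = ε := by field_simp
  · intro s t h0 hst hT
    rcases hst.eq_or_lt with rfl | hlt
    · simp [hdiag s ⟨h0, hT⟩, Real.zero_rpow (by linarith : q' ≠ 0)]
    · have e : ‖A s t‖ ^ q' = ‖A s t‖ ^ q * ‖A s t‖ ^ (q' - q) := by
        rw [← Real.rpow_add_of_nonneg (norm_nonneg _) hq.le he.le]; congr 1; ring
      rw [e]
      exact mul_le_mul (hW s t h0 hlt hT).2
        (Real.rpow_le_rpow (norm_nonneg _) (hAQ s t h0 hst hT) he.le) (by positivity)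
        (sub_nonneg.2 (hWm s t h0 hst hT))

/-! ### Taylor estimates for fields of class `C³_b` -/

section Smooth

variable {E F : Type*} [NormedAddCommGroup E] [NormedSpace ℝ E] [NormedAddCommGroup F]
  [NormedSpace ℝ F] {S : Set E}

theorem hasDerivWithinAt_segment {g : E → F} {g' : E → E →L[ℝ] F} (hS : Convex ℝ S)
    (hg : ∀ z ∈ S, HasFDerivWithinAt g (g' z) S z) {z w : E} (hz : z ∈ S) (hw : w ∈ S)
    {θ : ℝ} (hθ : θ ∈ Icc (0 : ℝ) 1) :
    HasDerivWithinAt (fun θ : ℝ => g (z + θ • (w - z))) (g' (z + θ • (w - z)) (w - z))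
      (Icc 0 1) θ := by
  have hm : ∀ θ ∈ Icc (0 : ℝ) 1, z + θ • (w - z) ∈ S := fun θ hθ =>
    hS.add_smul_sub_mem hz hw hθ
  have h1 : HasDerivWithinAt (fun θ : ℝ => z + θ • (w - z)) (w - z) (Icc 0 1) θ := by
    simpa using (((hasDerivAt_id θ).smul_const (w - z)).const_add z).hasDerivWithinAt
  exact (hg _ (hm θ hθ)).comp_hasDerivWithinAt θ h1 hm

/-- The mean value inequality is applied to the difference of `g` along the two segments. Its
derivative splits into the change of `g'` between the segments, proportional to `L`, and `g'`
applied to the difference of the displacements. -/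
theorem norm_double_difference_le {g : E → F} {g' : E → E →L[ℝ] F} {C : ℝ} (hS : Convex ℝ S)
    (hg : ∀ z ∈ S, HasFDerivWithinAt g (g' z) S z) (hb : ∀ z ∈ S, ‖g' z‖ ≤ C)
    (hl : ∀ z ∈ S, ∀ w ∈ S, ‖g' z - g' w‖ ≤ C * ‖z - w‖) {z₁ w₁ z₂ w₂ : E} {L : ℝ}
    (hz₁ : z₁ ∈ S) (hw₁ : w₁ ∈ S) (hz₂ : z₂ ∈ S) (hw₂ : w₂ ∈ S)
    (hz : ‖z₁ - z₂‖ ≤ L) (hw : ‖w₁ - w₂‖ ≤ L) :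
    ‖(g w₁ - g z₁) - (g w₂ - g z₂)‖
      ≤ C * L * ‖w₁ - z₁‖ + C * ‖(w₁ - z₁) - (w₂ - z₂)‖ := by
  have hC : 0 ≤ C := (norm_nonneg _).trans (hb z₁ hz₁)
  have key := norm_image_sub_le_of_norm_deriv_le_segment_01'
    (f := fun θ : ℝ => g (z₁ + θ • (w₁ - z₁)) - g (z₂ + θ • (w₂ - z₂)))
    (f' := fun θ => g' (z₁ + θ • (w₁ - z₁)) (w₁ - z₁) - g' (z₂ + θ • (w₂ - z₂)) (w₂ - z₂))
    (C := C * L * ‖w₁ - z₁‖ + C * ‖(w₁ - z₁) - (w₂ - z₂)‖)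
    (fun θ hθ => (hasDerivWithinAt_segment hS hg hz₁ hw₁ hθ).sub
      (hasDerivWithinAt_segment hS hg hz₂ hw₂ hθ)) (fun θ hθ => ?_)
  · convert key using 2
    simp only [one_smul, zero_smul, add_zero, add_sub_cancel]
    abel
  · have m1 := hS.add_smul_sub_mem hz₁ hw₁ (Ico_subset_Icc_self hθ)
    have m2 := hS.add_smul_sub_mem hz₂ hw₂ (Ico_subset_Icc_self hθ)
    have hd : ‖(z₁ + θ • (w₁ - z₁)) - (z₂ + θ • (w₂ - z₂))‖ ≤ L := by
      have e : (z₁ + θ • (w₁ - z₁)) - (z₂ + θ • (w₂ - z₂))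
          = (1 - θ) • (z₁ - z₂) + θ • (w₁ - w₂) := by module
      rw [e]
      refine (norm_add_le _ _).trans ?_
      rw [norm_smul, norm_smul, Real.norm_of_nonneg (by linarith [hθ.2] : 0 ≤ 1 - θ),
        Real.norm_of_nonneg hθ.1]
      nlinarith [hθ.1, hθ.2]
    have e : g' (z₁ + θ • (w₁ - z₁)) (w₁ - z₁) - g' (z₂ + θ • (w₂ - z₂)) (w₂ - z₂)
        = (g' (z₁ + θ • (w₁ - z₁)) - g' (z₂ + θ • (w₂ - z₂))) (w₁ - z₁)
          + g' (z₂ + θ • (w₂ - z₂)) ((w₁ - z₁) - (w₂ - z₂)) := by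
      rw [map_sub (g' (z₂ + θ • (w₂ - z₂))) (w₁ - z₁), sub_apply]; abel
    rw [e]
    refine (norm_add_le _ _).trans (add_le_add ?_ ?_)
    · refine (ContinuousLinearMap.le_opNorm _ _).trans ?_
      gcongr
      exact (hl _ m1 _ m2).trans (by gcongr)
    · refine (ContinuousLinearMap.le_opNorm _ _).trans ?_
      gcongr
      exact hb _ m2

/-- The mean value inequality for `θ ↦ g (z + θ h) - θ g'(z) h`, with `h = w - z`. Bounding `θ` by
one instead of integrating it costs the usual factor `1/2`. -/
theorem norm_taylor_le {g : E → F} {g' : E → E →L[ℝ] F} {C : ℝ} (hS : Convex ℝ S)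
    (hg : ∀ z ∈ S, HasFDerivWithinAt g (g' z) S z)
    (hl : ∀ z ∈ S, ∀ w ∈ S, ‖g' z - g' w‖ ≤ C * ‖z - w‖) (hC : 0 ≤ C) {z w : E}
    (hz : z ∈ S) (hw : w ∈ S) :
    ‖g w - g z - g' z (w - z)‖ ≤ C * ‖w - z‖ ^ 2 := by
  have key := norm_image_sub_le_of_norm_deriv_le_segment_01'
    (f := fun θ : ℝ => g (z + θ • (w - z)) - θ • g' z (w - z))
    (f' := fun θ => g' (z + θ • (w - z)) (w - z) - (1 : ℝ) • g' z (w - z))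
    (C := C * ‖w - z‖ ^ 2)
    (fun θ hθ => (hasDerivWithinAt_segment hS hg hz hw hθ).sub
      ((hasDerivWithinAt_id θ _).smul_const _)) (fun θ hθ => ?_)
  · convert key using 2
    simp only [one_smul, zero_smul, add_zero, add_sub_cancel, sub_zero]
    abel
  · have m1 := hS.add_smul_sub_mem hz hw (Ico_subset_Icc_self hθ)
    rw [one_smul, ← sub_apply]
    refine (ContinuousLinearMap.le_opNorm _ _).trans ?_
    rw [pow_two, ← mul_assoc]
    gcongr
    refine (hl _ m1 _ hz).trans ?_
    gcongr
    rw [add_sub_cancel_left, norm_smul, Real.norm_of_nonneg hθ.1]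
    nlinarith [hθ.2, norm_nonneg (w - z)]

-- The Taylor remainders of two segments are subtracted before the mean value inequality is used.
-- The derivative contains a double difference of `f'`, bounded by `norm_double_difference_le`
-- through the Lipschitz continuity of `f''`; hence the need for three bounded derivatives.
set_option maxSynthPendingDepth 3 in
theorem norm_taylor_difference_le {f : E → F} {f' : E → E →L[ℝ] F}
    {f'' : E → E →L[ℝ] E →L[ℝ] F} {C : ℝ} (hS : Convex ℝ S)
    (hf : ∀ z ∈ S, HasFDerivWithinAt f (f' z) S z)
    (hf' : ∀ z ∈ S, HasFDerivWithinAt f' (f'' z) S z) (hb : ∀ z ∈ S, ‖f'' z‖ ≤ C)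
    (hl' : ∀ z ∈ S, ∀ w ∈ S, ‖f' z - f' w‖ ≤ C * ‖z - w‖)
    (hl : ∀ z ∈ S, ∀ w ∈ S, ‖f'' z - f'' w‖ ≤ C * ‖z - w‖) {z₁ w₁ z₂ w₂ : E} {L : ℝ}
    (hz₁ : z₁ ∈ S) (hw₁ : w₁ ∈ S) (hz₂ : z₂ ∈ S) (hw₂ : w₂ ∈ S)
    (hz : ‖z₁ - z₂‖ ≤ L) (hw : ‖w₁ - w₂‖ ≤ L) :
    ‖(f w₁ - f z₁ - f' z₁ (w₁ - z₁)) - (f w₂ - f z₂ - f' z₂ (w₂ - z₂))‖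
      ≤ (C * L * ‖w₁ - z₁‖ + C * ‖(w₁ - z₁) - (w₂ - z₂)‖) * ‖w₁ - z₁‖
        + C * ‖w₂ - z₂‖ * ‖(w₁ - z₁) - (w₂ - z₂)‖ := by
  have hC : 0 ≤ C := (norm_nonneg _).trans (hb z₁ hz₁)
  have hL : 0 ≤ L := (norm_nonneg _).trans hz
  have key := norm_image_sub_le_of_norm_deriv_le_segment_01'
    (f := fun θ : ℝ => (f (z₁ + θ • (w₁ - z₁)) - θ • f' z₁ (w₁ - z₁))
      - (f (z₂ + θ • (w₂ - z₂)) - θ • f' z₂ (w₂ - z₂)))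
    (f' := fun θ => (f' (z₁ + θ • (w₁ - z₁)) (w₁ - z₁) - (1 : ℝ) • f' z₁ (w₁ - z₁))
      - (f' (z₂ + θ • (w₂ - z₂)) (w₂ - z₂) - (1 : ℝ) • f' z₂ (w₂ - z₂)))
    (C := (C * L * ‖w₁ - z₁‖ + C * ‖(w₁ - z₁) - (w₂ - z₂)‖) * ‖w₁ - z₁‖
        + C * ‖w₂ - z₂‖ * ‖(w₁ - z₁) - (w₂ - z₂)‖)
    (fun θ hθ => ((hasDerivWithinAt_segment hS hf hz₁ hw₁ hθ).sub
      ((hasDerivWithinAt_id θ _).smul_const _)).sub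
      ((hasDerivWithinAt_segment hS hf hz₂ hw₂ hθ).sub
      ((hasDerivWithinAt_id θ _).smul_const _))) (fun θ hθ => ?_)
  · convert key using 2
    simp only [one_smul, zero_smul, add_zero, add_sub_cancel, sub_zero]
    abel
  · have hθ' := Ico_subset_Icc_self hθ
    have m1 := hS.add_smul_sub_mem hz₁ hw₁ hθ'
    have m2 := hS.add_smul_sub_mem hz₂ hw₂ hθ'
    have hd : ‖(z₁ + θ • (w₁ - z₁)) - (z₂ + θ • (w₂ - z₂))‖ ≤ L := by
      have e : (z₁ + θ • (w₁ - z₁)) - (z₂ + θ • (w₂ - z₂))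
          = (1 - θ) • (z₁ - z₂) + θ • (w₁ - w₂) := by module
      rw [e]
      refine (norm_add_le _ _).trans ?_
      rw [norm_smul, norm_smul, Real.norm_of_nonneg (by linarith [hθ.2] : 0 ≤ 1 - θ),
        Real.norm_of_nonneg hθ.1]
      nlinarith [hθ.1, hθ.2]
    have hsm : ∀ x : E, ‖θ • x‖ ≤ ‖x‖ := fun x => by
      rw [norm_smul, Real.norm_of_nonneg hθ.1]
      nlinarith [hθ.2, norm_nonneg x]
    have dd := norm_double_difference_le hS hf' hb hl hz₁ m1 hz₂ m2 hz hd
    rw [add_sub_cancel_left, add_sub_cancel_left, ← smul_sub] at dd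
    have dd' := dd.trans (add_le_add
      (mul_le_mul_of_nonneg_left (hsm _) (by positivity : 0 ≤ C * L))
      (mul_le_mul_of_nonneg_left (hsm _) hC))
    have hq : ‖f' (z₂ + θ • (w₂ - z₂)) - f' z₂‖ ≤ C * ‖w₂ - z₂‖ := (hl' _ m2 _ hz₂).trans (mul_le_mul_of_nonneg_left
      (by rw [add_sub_cancel_left]; exact hsm _) hC)
    have e : (f' (z₁ + θ • (w₁ - z₁)) (w₁ - z₁) - (1 : ℝ) • f' z₁ (w₁ - z₁))
        - (f' (z₂ + θ • (w₂ - z₂)) (w₂ - z₂) - (1 : ℝ) • f' z₂ (w₂ - z₂))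
        = ((f' (z₁ + θ • (w₁ - z₁)) - f' z₁) - (f' (z₂ + θ • (w₂ - z₂)) - f' z₂)) (w₁ - z₁)
          + (f' (z₂ + θ • (w₂ - z₂)) - f' z₂) ((w₁ - z₁) - (w₂ - z₂)) := by
      rw [map_sub _ (w₁ - z₁)]
      simp only [one_smul, sub_apply]
      abel
    rw [e]
    refine (norm_add_le _ _).trans (add_le_add ?_ ?_)
    · exact (ContinuousLinearMap.le_opNorm _ _).trans
        (mul_le_mul_of_nonneg_right dd' (norm_nonneg _))
    · exact (ContinuousLinearMap.le_opNorm _ _).trans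
        (mul_le_mul_of_nonneg_right hq (norm_nonneg _))

/-- Quantitative consequences of `f ∈ C³_b(S)` with derivative `f'`. -/
structure C3Bounds (S : Set E) (C : ℝ) (f : E → F) (f' : E → E →L[ℝ] F) : Prop where
  one_le : 1 ≤ C
  norm_le : ∀ z ∈ S, ‖f z‖ ≤ C
  deriv_norm_le : ∀ z ∈ S, ‖f' z‖ ≤ C
  lipschitz : ∀ z ∈ S, ∀ w ∈ S, ‖f z - f w‖ ≤ C * ‖z - w‖
  deriv_lipschitz : ∀ z ∈ S, ∀ w ∈ S, ‖f' z - f' w‖ ≤ C * ‖z - w‖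
  taylor : ∀ z ∈ S, ∀ w ∈ S, ‖f w - f z - f' z (w - z)‖ ≤ C * ‖w - z‖ ^ 2
  difference : ∀ z₁ ∈ S, ∀ w₁ ∈ S, ∀ z₂ ∈ S, ∀ w₂ ∈ S, ∀ L, ‖z₁ - z₂‖ ≤ L → ‖w₁ - w₂‖ ≤ L →
    ‖(f w₁ - f z₁) - (f w₂ - f z₂)‖ ≤ C * L * ‖w₁ - z₁‖ + C * ‖(w₁ - z₁) - (w₂ - z₂)‖
  deriv_difference : ∀ z₁ ∈ S, ∀ w₁ ∈ S, ∀ z₂ ∈ S, ∀ w₂ ∈ S, ∀ L, ‖z₁ - z₂‖ ≤ L →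
    ‖w₁ - w₂‖ ≤ L →
    ‖(f' w₁ - f' z₁) - (f' w₂ - f' z₂)‖ ≤ C * L * ‖w₁ - z₁‖ + C * ‖(w₁ - z₁) - (w₂ - z₂)‖
  taylor_difference : ∀ z₁ ∈ S, ∀ w₁ ∈ S, ∀ z₂ ∈ S, ∀ w₂ ∈ S, ∀ L, ‖z₁ - z₂‖ ≤ L →
    ‖w₁ - w₂‖ ≤ L →
    ‖(f w₁ - f z₁ - f' z₁ (w₁ - z₁)) - (f w₂ - f z₂ - f' z₂ (w₂ - z₂))‖
      ≤ (C * L * ‖w₁ - z₁‖ + C * ‖(w₁ - z₁) - (w₂ - z₂)‖) * ‖w₁ - z₁‖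
        + C * ‖w₂ - z₂‖ * ‖(w₁ - z₁) - (w₂ - z₂)‖

set_option maxSynthPendingDepth 3 in
theorem IsCkb.exists_c3Bounds {f : E → F} (hS : Convex ℝ S) (hU : UniqueDiffOn ℝ S)
    (h : IsCkb 3 f S) : ∃ C, C3Bounds S C f (fderivWithin ℝ f S) := by
  obtain ⟨hc, C₀, hC₀⟩ := h
  have hc : ContDiffOn ℝ 3 f S := hc
  set f' := fderivWithin ℝ f S
  set f'' := fderivWithin ℝ f' S
  have hc' : ContDiffOn ℝ 2 f' S := hc.fderivWithin hU (by norm_num)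
  have hc'' : ContDiffOn ℝ 1 f'' S := hc'.fderivWithin hU (by norm_num)
  have d0 : ∀ z ∈ S, HasFDerivWithinAt f (f' z) S z := fun z hz =>
    (hc.differentiableOn (by norm_num) z hz).hasFDerivWithinAt
  have d1 : ∀ z ∈ S, HasFDerivWithinAt f' (f'' z) S z := fun z hz =>
    (hc'.differentiableOn (by norm_num) z hz).hasFDerivWithinAt
  have d2 : ∀ z ∈ S, HasFDerivWithinAt f'' (fderivWithin ℝ f'' S z) S z := fun z hz =>
    (hc''.differentiableOn (by norm_num) z hz).hasFDerivWithinAt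
  -- With `1 ≤ C` lower powers of `C`, and time increments without any constant, can be absorbed
  -- later.
  set C := max 1 C₀
  have hC : ∀ j ≤ 3, ∀ z ∈ S, ‖iteratedFDerivWithin ℝ j f S z‖ ≤ C := fun j hj z hz =>
    (hC₀ j hj z hz).trans (le_max_right _ _)
  have hC1 : 1 ≤ C := le_max_left _ _
  have b0 : ∀ z ∈ S, ‖f z‖ ≤ C := fun z hz => by
    have := hC 0 (by norm_num) z hz
    rwa [norm_iteratedFDerivWithin_zero] at this
  have b1 : ∀ z ∈ S, ‖f' z‖ ≤ C := fun z hz => by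
    have := hC 1 (by norm_num) z hz
    rwa [← norm_iteratedFDerivWithin_fderivWithin hU hz, norm_iteratedFDerivWithin_zero] at this
  have b2 : ∀ z ∈ S, ‖f'' z‖ ≤ C := fun z hz => by
    have := hC 2 (by norm_num) z hz
    rwa [← norm_iteratedFDerivWithin_fderivWithin hU hz,
      ← norm_iteratedFDerivWithin_fderivWithin hU hz, norm_iteratedFDerivWithin_zero] at this
  have b3 : ∀ z ∈ S, ‖fderivWithin ℝ f'' S z‖ ≤ C := fun z hz => by
    have := hC 3 (by norm_num) z hz
    rwa [← norm_iteratedFDerivWithin_fderivWithin hU hz,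
      ← norm_iteratedFDerivWithin_fderivWithin hU hz,
      ← norm_iteratedFDerivWithin_fderivWithin hU hz, norm_iteratedFDerivWithin_zero] at this
  have l0 : ∀ z ∈ S, ∀ w ∈ S, ‖f z - f w‖ ≤ C * ‖z - w‖ := fun z hz w hw =>
    hS.norm_image_sub_le_of_norm_hasFDerivWithin_le d0 b1 hw hz
  have l1 : ∀ z ∈ S, ∀ w ∈ S, ‖f' z - f' w‖ ≤ C * ‖z - w‖ := fun z hz w hw =>
    hS.norm_image_sub_le_of_norm_hasFDerivWithin_le d1 b2 hw hz
  have l2 : ∀ z ∈ S, ∀ w ∈ S, ‖f'' z - f'' w‖ ≤ C * ‖z - w‖ := fun z hz w hw =>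
    hS.norm_image_sub_le_of_norm_hasFDerivWithin_le d2 b3 hw hz
  exact ⟨C, hC1, b0, b1, l0, l1, fun z hz w hw => norm_taylor_le hS d0 l1 (by linarith) hz hw,
    fun z₁ a w₁ b z₂ c w₂ d L e g => norm_double_difference_le hS d0 b1 l1 a b c d e g,
    fun z₁ a w₁ b z₂ c w₂ d L e g => norm_double_difference_le hS d1 b2 l2 a b c d e g,
    fun z₁ a w₁ b z₂ c w₂ d L e g => norm_taylor_difference_le hS d0 d1 b2 l1 l2 a b c d e g⟩

end Smooth

/-! ### Chen's relation for contracted tensors -/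

section Tensor

variable {d : ℕ} {F : Type*} [NormedAddCommGroup F] [NormedSpace ℝ F]

theorem norm_tensorApply_le
    (A : EuclideanSpace ℝ (Fin d) →L[ℝ] EuclideanSpace ℝ (Fin d) →L[ℝ] F)
    (M : EuclideanSpace ℝ (Fin d × Fin d)) :
    ‖tensorApply A M‖ ≤ (d : ℝ) ^ 2 * ‖A‖ * ‖M‖ := by
  have h : ∀ i j : Fin d, ‖M (i, j) • A (EuclideanSpace.single i (1 : ℝ))
      (EuclideanSpace.single j (1 : ℝ))‖ ≤ ‖A‖ * ‖M‖ := by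
    intro i j
    rw [norm_smul, mul_comm]
    have h1 := A.le_opNorm₂ (EuclideanSpace.single i (1 : ℝ)) (EuclideanSpace.single j (1 : ℝ))
    simp only [PiLp.norm_single, norm_one, mul_one] at h1
    exact mul_le_mul h1 (PiLp.norm_apply_le M (i, j)) (norm_nonneg _) A.opNorm_nonneg
  calc ‖tensorApply A M‖ ≤ ∑ _i : Fin d, ∑ _j : Fin d, ‖A‖ * ‖M‖ :=
        norm_sum_le_of_le _ fun i _ => norm_sum_le_of_le _ fun j _ => h i j
    _ = _ := by simp; ring

theorem tensorApply_sub
    (A B : EuclideanSpace ℝ (Fin d) →L[ℝ] EuclideanSpace ℝ (Fin d) →L[ℝ] F)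
    (M : EuclideanSpace ℝ (Fin d × Fin d)) :
    tensorApply (A - B) M = tensorApply A M - tensorApply B M := by
  simp [tensorApply, smul_sub]

theorem apply_apply_eq_sum
    (A : EuclideanSpace ℝ (Fin d) →L[ℝ] EuclideanSpace ℝ (Fin d) →L[ℝ] F)
    (x y : EuclideanSpace ℝ (Fin d)) :
    A x y = ∑ i, ∑ j, (x i * y j) • A (EuclideanSpace.single i (1 : ℝ))
      (EuclideanSpace.single j (1 : ℝ)) := by
  have h : ∀ x : EuclideanSpace ℝ (Fin d), x = ∑ i, x i • EuclideanSpace.single i (1 : ℝ) := by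
    intro x
    simpa using ((EuclideanSpace.basisFun (Fin d) ℝ).sum_repr x).symm
  conv_lhs => rw [h x, h y]
  simp only [map_sum, map_smul, sum_apply, smul_apply,
    smul_smul, Finset.smul_sum]
  rw [Finset.sum_comm]
  refine Finset.sum_congr rfl fun i _ => Finset.sum_congr rfl fun j _ => ?_
  rw [mul_comm]

theorem IsRoughPath.tensorApply_chen {p T : ℝ} {X : ℝ → EuclideanSpace ℝ (Fin d)}
    {XX : ℝ → ℝ → EuclideanSpace ℝ (Fin d × Fin d)} (hX : IsRoughPath p T X XX)
    (A : EuclideanSpace ℝ (Fin d) →L[ℝ] EuclideanSpace ℝ (Fin d) →L[ℝ] F)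
    {s u t : ℝ} (hs : s ∈ Icc 0 T) (hu : u ∈ Icc 0 T) (ht : t ∈ Icc 0 T) :
    tensorApply A (XX s t) = tensorApply A (XX s u) + tensorApply A (XX u t)
      + A (X u - X s) (X t - X u) := by
  rw [apply_apply_eq_sum]
  simp only [tensorApply, ← Finset.sum_add_distrib, ← add_smul]
  refine Finset.sum_congr rfl fun i _ => Finset.sum_congr rfl fun j _ => ?_
  rw [hX.chen s hs u hu t ht i j]
  simp

theorem IsRoughPath.enhancement_self {p T : ℝ} {X : ℝ → EuclideanSpace ℝ (Fin d)}
    {XX : ℝ → ℝ → EuclideanSpace ℝ (Fin d × Fin d)} (hX : IsRoughPath p T X XX)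
    {s : ℝ} (hs : s ∈ Icc 0 T) : XX s s = 0 := by
  ext ⟨i, j⟩
  have := hX.chen s hs s hs s hs i j
  simp at this
  simpa using this

end Tensor

/-! ### Defect of additivity of the local increments -/

section Field

variable {d : ℕ} {V : Type*} [NormedAddCommGroup V] [NormedSpace ℝ V]

/-- The Gubinelli derivative `∇ₓf f` of `f(·, Y)` when `Y' = f(·, Y)`, for a field `f` with
space-time derivative `f'`. -/
noncomputable def fieldDeriv (f : ℝ × V → (EuclideanSpace ℝ (Fin d) →L[ℝ] V))
    (f' : ℝ × V → (ℝ × V →L[ℝ] (EuclideanSpace ℝ (Fin d) →L[ℝ] V))) (z : ℝ × V) :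
    EuclideanSpace ℝ (Fin d) →L[ℝ] EuclideanSpace ℝ (Fin d) →L[ℝ] V :=
  ((f' z).comp (ContinuousLinearMap.inr ℝ ℝ V)).comp (f z)

/-- The local approximation of the rough integral of `f(·, Y)` over `[s,t]` when `Y s = x`. -/
noncomputable def localIncrement (X : ℝ → EuclideanSpace ℝ (Fin d))
    (XX : ℝ → ℝ → EuclideanSpace ℝ (Fin d × Fin d))
    (f : ℝ × V → (EuclideanSpace ℝ (Fin d) →L[ℝ] V))
    (f' : ℝ × V → (ℝ × V →L[ℝ] (EuclideanSpace ℝ (Fin d) →L[ℝ] V))) (s t : ℝ) (x : V) : V :=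
  f (s, x) (X t - X s) + tensorApply (fieldDeriv f f' (s, x)) (XX s t)

theorem norm_comp_inr_le {F : Type*} [NormedAddCommGroup F] [NormedSpace ℝ F]
    (A : ℝ × V →L[ℝ] F) : ‖A.comp (ContinuousLinearMap.inr ℝ ℝ V)‖ ≤ ‖A‖ :=
  (A.opNorm_comp_le _).trans
    (mul_le_of_le_one_right (norm_nonneg _) (ContinuousLinearMap.norm_inr_le_one ℝ ℝ V))

theorem norm_comp_sub_comp_le {E F G : Type*} [NormedAddCommGroup E] [NormedSpace ℝ E]
    [NormedAddCommGroup F] [NormedSpace ℝ F] [NormedAddCommGroup G] [NormedSpace ℝ G]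
    (a b : F →L[ℝ] G) (c e : E →L[ℝ] F) :
    ‖a.comp c - b.comp e‖ ≤ ‖a - b‖ * ‖c‖ + ‖b‖ * ‖c - e‖ := by
  have : a.comp c - b.comp e = (a - b).comp c + b.comp (c - e) := by
    ext x; simp
  rw [this]
  exact (norm_add_le _ _).trans
    (add_le_add (ContinuousLinearMap.opNorm_comp_le _ _) (ContinuousLinearMap.opNorm_comp_le _ _))

/-- A product rule for double differences: each of the four terms contains the difference between
the two families. -/
theorem norm_comp_double_difference_le {E F G : Type*} [NormedAddCommGroup E] [NormedSpace ℝ E]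
    [NormedAddCommGroup F] [NormedSpace ℝ F] [NormedAddCommGroup G] [NormedSpace ℝ G]
    (a₁ a₂ b₁ b₂ : F →L[ℝ] G) (c₁ c₂ e₁ e₂ : E →L[ℝ] F) :
    ‖(b₁.comp e₁ - a₁.comp c₁) - (b₂.comp e₂ - a₂.comp c₂)‖
      ≤ ‖(b₁ - a₁) - (b₂ - a₂)‖ * ‖e₁‖ + ‖b₂ - a₂‖ * ‖e₁ - e₂‖
        + ‖a₁ - a₂‖ * ‖e₁ - c₁‖ + ‖a₂‖ * ‖(e₁ - c₁) - (e₂ - c₂)‖ := by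
  have : (b₁.comp e₁ - a₁.comp c₁) - (b₂.comp e₂ - a₂.comp c₂)
      = ((b₁ - a₁) - (b₂ - a₂)).comp e₁ + (b₂ - a₂).comp (e₁ - e₂)
        + (a₁ - a₂).comp (e₁ - c₁) + a₂.comp ((e₁ - c₁) - (e₂ - c₂)) := by
    ext x
    simp only [sub_apply, add_apply, ContinuousLinearMap.comp_apply, map_sub]
    abel
  rw [this]
  exact norm_add₄_le.trans (add_le_add (add_le_add (add_le_add
    (ContinuousLinearMap.opNorm_comp_le _ _) (ContinuousLinearMap.opNorm_comp_le _ _))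
    (ContinuousLinearMap.opNorm_comp_le _ _)) (ContinuousLinearMap.opNorm_comp_le _ _))

variable {S : Set (ℝ × V)} {C : ℝ} {f : ℝ × V → (EuclideanSpace ℝ (Fin d) →L[ℝ] V)}
  {f' : ℝ × V → (ℝ × V →L[ℝ] (EuclideanSpace ℝ (Fin d) →L[ℝ] V))}

theorem C3Bounds.norm_fieldDeriv_le (hf : C3Bounds S C f f') {z : ℝ × V} (hz : z ∈ S) :
    ‖fieldDeriv f f' z‖ ≤ C ^ 2 := by
  refine (ContinuousLinearMap.opNorm_comp_le _ _).trans ?_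
  rw [pow_two]
  exact mul_le_mul ((norm_comp_inr_le _).trans (hf.deriv_norm_le z hz)) (hf.norm_le z hz)
    (norm_nonneg _) (by linarith [hf.one_le])

theorem C3Bounds.norm_fieldDeriv_sub_le (hf : C3Bounds S C f f') {z w : ℝ × V} (hz : z ∈ S)
    (hw : w ∈ S) : ‖fieldDeriv f f' z - fieldDeriv f f' w‖ ≤ 2 * C ^ 2 * ‖z - w‖ := by
  have hC := hf.one_le
  refine (norm_comp_sub_comp_le _ _ _ _).trans ?_
  rw [← ContinuousLinearMap.sub_comp]
  have h1 := (norm_comp_inr_le (f' z - f' w)).trans (hf.deriv_lipschitz z hz w hw)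
  have h2 := (norm_comp_inr_le (f' w)).trans (hf.deriv_norm_le w hw)
  have h3 := mul_le_mul h1 (hf.norm_le z hz) (norm_nonneg _) (by positivity)
  have h4 := mul_le_mul h2 (hf.lipschitz z hz w hw) (norm_nonneg _) (by positivity)
  linarith

/-- The displacement splits into the first-order direction `(0, f (s, x) ξ)`, whose image under `f'`
is the `fieldDeriv` term, and the pair of the time increment and the remainder of the path. The
latter is second order, as time counts like `𝕏`. -/
theorem taylor_remainder_eq (s u : ℝ) (x y : V) (ξ : EuclideanSpace ℝ (Fin d)) :
    f (u, y) - f (s, x) - fieldDeriv f f' (s, x) ξ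
      = (f (u, y) - f (s, x) - f' (s, x) ((u, y) - (s, x)))
        + f' (s, x) (u - s, y - x - f (s, x) ξ) := by
  have : ((u, y) - (s, x) : ℝ × V)
      = (u - s, y - x - f (s, x) ξ) + (0, f (s, x) ξ) := by ext <;> simp
  rw [this, map_add]
  simp only [fieldDeriv, ContinuousLinearMap.comp_apply, ContinuousLinearMap.inr_apply]
  abel

theorem C3Bounds.norm_remainder_le (hf : C3Bounds S C f f') {s u : ℝ} {x y : V}
    (hz : (s, x) ∈ S) (hw : (u, y) ∈ S) (ξ : EuclideanSpace ℝ (Fin d)) :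
    ‖f (u, y) - f (s, x) - fieldDeriv f f' (s, x) ξ‖
      ≤ C * ‖((u, y) - (s, x) : ℝ × V)‖ ^ 2 + C * (|u - s| + ‖y - x - f (s, x) ξ‖) := by
  have hC := hf.one_le
  rw [taylor_remainder_eq]
  refine (norm_add_le _ _).trans (add_le_add (hf.taylor _ hz _ hw) ?_)
  refine (ContinuousLinearMap.le_opNorm _ _).trans
    (mul_le_mul (hf.deriv_norm_le _ hz) ?_ (norm_nonneg _) (by linarith))
  rw [Prod.norm_def]
  exact max_le (le_add_of_nonneg_right (norm_nonneg _)) (le_add_of_nonneg_left (abs_nonneg _))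

/-- The cross term in Chen's relation is exactly what turns the increment of `f` into its controlled
remainder. What is left is a second-order remainder times an increment of `X`, and a first-order
difference times `𝕏`: both are third order. -/
theorem localIncrement_defect_eq {p T : ℝ} {X : ℝ → EuclideanSpace ℝ (Fin d)}
    {XX : ℝ → ℝ → EuclideanSpace ℝ (Fin d × Fin d)} (hX : IsRoughPath p T X XX)
    {s u t : ℝ} (hs : s ∈ Icc 0 T) (hu : u ∈ Icc 0 T) (ht : t ∈ Icc 0 T) (x y : V) :
    localIncrement X XX f f' s t x - localIncrement X XX f f' s u x
      - localIncrement X XX f f' u t y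
      = -((f (u, y) - f (s, x) - fieldDeriv f f' (s, x) (X u - X s)) (X t - X u))
        - tensorApply (fieldDeriv f f' (u, y) - fieldDeriv f f' (s, x)) (XX u t) := by
  simp only [localIncrement]
  rw [hX.tensorApply_chen _ hs hu ht, tensorApply_sub]
  simp only [sub_apply]
  have : X t - X s = (X u - X s) + (X t - X u) := by abel
  rw [this, map_add]
  abel

/-- The constant in the bound on the defect of additivity of the local increments. -/
noncomputable def defectConst (d : ℕ) (C K : ℝ) : ℝ :=
  C * (C + K) ^ 2 + C * (1 + K) + 2 * (d : ℝ) ^ 2 * C ^ 2 * (C + K)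

/-- Here and below `r ≤ 1` is the common scale: `X` moves by at most `r`, time and remainders by
multiples of `r ^ 2`. The time component is absorbed by means of `1 ≤ C`. -/
theorem norm_add_le_of_remainder (hf : C3Bounds S C f f') {s u r K : ℝ} {x y : V}
    {ξ : EuclideanSpace ℝ (Fin d)} (hz : (s, x) ∈ S) (hr0 : 0 ≤ r) (hr1 : r ≤ 1)
    (hK : 0 ≤ K) (hsu : s ≤ u) (htime : u - s ≤ r ^ 2) (hξ : ‖ξ‖ ≤ r)
    (hR : ‖y - x - f (s, x) ξ‖ ≤ K * r ^ 2) :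
    ‖y - x‖ ≤ (C + K) * r ∧ ‖((u, y) - (s, x) : ℝ × V)‖ ≤ (C + K) * r := by
  have hC := hf.one_le
  have h1 : ‖f (s, x) ξ‖ ≤ C * r := (ContinuousLinearMap.le_opNorm _ _).trans
    (mul_le_mul (hf.norm_le _ hz) hξ (norm_nonneg _) (by linarith))
  have h2 : ‖y - x‖ ≤ (C + K) * r := by
    have : y - x = f (s, x) ξ + (y - x - f (s, x) ξ) := by abel
    rw [this]
    refine (norm_add_le _ _).trans ?_
    have : r ^ 2 ≤ r := by nlinarith
    nlinarith
  refine ⟨h2, ?_⟩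
  rw [Prod.norm_def]
  refine max_le ?_ h2
  simp only [Prod.fst_sub, Real.norm_eq_abs]
  rw [abs_of_nonneg (by linarith)]
  nlinarith [mul_nonneg hK hr0]

theorem norm_localIncrement_defect_le (hf : C3Bounds S C f f') {p T : ℝ}
    {X : ℝ → EuclideanSpace ℝ (Fin d)} {XX : ℝ → ℝ → EuclideanSpace ℝ (Fin d × Fin d)}
    (hX : IsRoughPath p T X XX) {s u t r K : ℝ} (h0 : 0 ≤ s) (hsu : s ≤ u) (hut : u ≤ t)
    (hT : t ≤ T) {x y : V} (hz : (s, x) ∈ S) (hw : (u, y) ∈ S)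
    (hr0 : 0 ≤ r) (hr1 : r ≤ 1) (hK : 0 ≤ K) (htime : u - s ≤ r ^ 2) (hXsu : ‖X u - X s‖ ≤ r)
    (hXut : ‖X t - X u‖ ≤ r) (hXX : ‖XX u t‖ ≤ r ^ 2)
    (hR : ‖y - x - f (s, x) (X u - X s)‖ ≤ K * r ^ 2) :
    ‖localIncrement X XX f f' s t x - localIncrement X XX f f' s u x
      - localIncrement X XX f f' u t y‖ ≤ defectConst d C K * r ^ 3 := by
  have hC := hf.one_le
  rw [localIncrement_defect_eq hX ⟨h0, by linarith⟩ ⟨by linarith, by linarith⟩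
    ⟨by linarith, hT⟩]
  obtain ⟨-, h2⟩ := norm_add_le_of_remainder hf hz hr0 hr1 hK hsu htime hXsu hR
  have h3 : ‖f (u, y) - f (s, x) - fieldDeriv f f' (s, x) (X u - X s)‖
      ≤ (C * (C + K) ^ 2 + C * (1 + K)) * r ^ 2 := by
    refine (hf.norm_remainder_le hz hw _).trans ?_
    rw [abs_of_nonneg (by linarith)]
    have a1 : C * ‖((u, y) - (s, x) : ℝ × V)‖ ^ 2 ≤ C * ((C + K) * r) ^ 2 := by gcongr
    have a2 := mul_le_mul_of_nonneg_left (add_le_add htime hR) (by linarith : 0 ≤ C)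
    linarith
  have h4 : ‖fieldDeriv f f' (u, y) - fieldDeriv f f' (s, x)‖ ≤ 2 * C ^ 2 * ((C + K) * r) :=
    (hf.norm_fieldDeriv_sub_le hw hz).trans (by gcongr)
  have h5 := (ContinuousLinearMap.le_opNorm _ _).trans
    (mul_le_mul h3 hXut (norm_nonneg _) (by positivity))
  have h6 : ‖tensorApply (fieldDeriv f f' (u, y) - fieldDeriv f f' (s, x)) (XX u t)‖
      ≤ (d : ℝ) ^ 2 * (2 * C ^ 2 * ((C + K) * r)) * r ^ 2 :=
    (norm_tensorApply_le _ _).trans (by gcongr)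
  refine (norm_sub_le _ _).trans ?_
  rw [norm_neg]
  refine (add_le_add h5 h6).trans (le_of_eq ?_)
  unfold defectConst
  ring

/-- The constant in the bound on the difference of defects of additivity for two paths. -/
noncomputable def defectDiffConst (d : ℕ) (C M : ℝ) : ℝ :=
  4 * C ^ 3 + 4 * C ^ 2 * (C + M) + C * (1 + M)
    + (d : ℝ) ^ 2 * (2 * C ^ 2 * (2 * C + (C + M)) + 4 * C ^ 3)

/-- Stability of the defect: the bound is linear in the distance `L` of the two paths and keeps the
third order in `r`. Both terms of `localIncrement_defect_eq` are subtracted for the two paths, and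
each resulting product is split so that one factor is a difference. -/
theorem norm_localIncrement_defect_sub_le (hf : C3Bounds S C f f') {p T : ℝ}
    {X : ℝ → EuclideanSpace ℝ (Fin d)} {XX : ℝ → ℝ → EuclideanSpace ℝ (Fin d × Fin d)}
    (hX : IsRoughPath p T X XX) {s u t r M L : ℝ} (h0 : 0 ≤ s) (hsu : s ≤ u) (hut : u ≤ t)
    (hT : t ≤ T) {x₁ y₁ x₂ y₂ : V} (hz₁ : (s, x₁) ∈ S) (hw₁ : (u, y₁) ∈ S)
    (hz₂ : (s, x₂) ∈ S) (hw₂ : (u, y₂) ∈ S)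
    (hr0 : 0 ≤ r) (hr1 : r ≤ 1) (hM : 0 ≤ M) (htime : u - s ≤ r ^ 2) (hXsu : ‖X u - X s‖ ≤ r)
    (hXut : ‖X t - X u‖ ≤ r) (hXX : ‖XX u t‖ ≤ r ^ 2)
    (hR₁ : ‖y₁ - x₁ - f (s, x₁) (X u - X s)‖ ≤ r ^ 2)
    (hR₂ : ‖y₂ - x₂ - f (s, x₂) (X u - X s)‖ ≤ r ^ 2)
    (hx : ‖x₁ - x₂‖ ≤ L) (hy : ‖y₁ - y₂‖ ≤ L)
    (hR : ‖(y₁ - x₁ - f (s, x₁) (X u - X s)) - (y₂ - x₂ - f (s, x₂) (X u - X s))‖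
      ≤ M * L * r ^ 2) :
    ‖(localIncrement X XX f f' s t x₁ - localIncrement X XX f f' s u x₁
      - localIncrement X XX f f' u t y₁)
      - (localIncrement X XX f f' s t x₂ - localIncrement X XX f f' s u x₂
      - localIncrement X XX f f' u t y₂)‖ ≤ defectDiffConst d C M * L * r ^ 3 := by
  have hC := hf.one_le
  have hL : 0 ≤ L := (norm_nonneg _).trans hx
  have hs' : s ∈ Icc 0 T := ⟨h0, by linarith⟩
  have hu' : u ∈ Icc 0 T := ⟨by linarith, by linarith⟩
  have ht' : t ∈ Icc 0 T := ⟨by linarith, hT⟩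
  rw [localIncrement_defect_eq hX hs' hu' ht', localIncrement_defect_eq hX hs' hu' ht']
  set ξ := X u - X s
  set z₁ : ℝ × V := (s, x₁)
  set z₂ : ℝ × V := (s, x₂)
  set w₁ : ℝ × V := (u, y₁)
  set w₂ : ℝ × V := (u, y₂)
  have hzz : ‖z₁ - z₂‖ ≤ L := by
    simp only [z₁, z₂, Prod.mk_sub_mk, sub_self, Prod.norm_mk, norm_zero]
    exact max_le hL hx
  have hww : ‖w₁ - w₂‖ ≤ L := by
    simp only [w₁, w₂, Prod.mk_sub_mk, sub_self, Prod.norm_mk, norm_zero]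
    exact max_le hL hy
  have hh₁ : ‖w₁ - z₁‖ ≤ 2 * C * r := by
    refine (norm_add_le_of_remainder hf hz₁ hr0 hr1 zero_le_one hsu htime hXsu
      (by linarith)).2.trans ?_
    nlinarith
  have hh₂ : ‖w₂ - z₂‖ ≤ 2 * C * r := by
    refine (norm_add_le_of_remainder hf hz₂ hr0 hr1 zero_le_one hsu htime hXsu
      (by linarith)).2.trans ?_
    nlinarith
  have hr2 : r ^ 2 ≤ r := by nlinarith
  -- Both displacements have the same time component, which cancels. The space component is a
  -- difference of `f` applied to the same increment of `X`, plus the difference of the remainders.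
  have hhh : ‖(w₁ - z₁) - (w₂ - z₂)‖ ≤ (C + M) * L * r := by
    have e : (w₁ - z₁) - (w₂ - z₂) = (0, (y₁ - x₁) - (y₂ - x₂)) := by
      ext <;> simp [w₁, z₁, w₂, z₂]
    have e2 : (y₁ - x₁) - (y₂ - x₂) = (f z₁ - f z₂) ξ
        + ((y₁ - x₁ - f z₁ ξ) - (y₂ - x₂ - f z₂ ξ)) := by
      rw [sub_apply]; abel
    have h1 : ‖(f z₁ - f z₂) ξ‖ ≤ C * L * r := (ContinuousLinearMap.le_opNorm _ _).trans
      (mul_le_mul ((hf.lipschitz _ hz₁ _ hz₂).trans (by gcongr)) hXsu (norm_nonneg _)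
        (by positivity))
    rw [e, Prod.norm_mk, norm_zero, max_eq_right (norm_nonneg _), e2]
    refine (norm_add_le _ _).trans ((add_le_add h1 hR).trans ?_)
    have : M * L * r ^ 2 ≤ M * L * r := by gcongr
    linarith
  have t1 := hf.taylor_difference _ hz₁ _ hw₁ _ hz₂ _ hw₂ L hzz hww
  have t1' : ‖(f w₁ - f z₁ - f' z₁ (w₁ - z₁)) - (f w₂ - f z₂ - f' z₂ (w₂ - z₂))‖
      ≤ (C * L * (2 * C * r) + C * ((C + M) * L * r)) * (2 * C * r)
        + C * (2 * C * r) * ((C + M) * L * r) := t1.trans (by gcongr)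
  have t2 : ‖f' z₁ (u - s, y₁ - x₁ - f z₁ ξ) - f' z₂ (u - s, y₂ - x₂ - f z₂ ξ)‖
      ≤ C * L * r ^ 2 + C * (M * L * r ^ 2) := by
    have e : f' z₁ (u - s, y₁ - x₁ - f z₁ ξ) - f' z₂ (u - s, y₂ - x₂ - f z₂ ξ)
        = (f' z₁ - f' z₂) (u - s, y₁ - x₁ - f z₁ ξ)
          + f' z₂ (0, (y₁ - x₁ - f z₁ ξ) - (y₂ - x₂ - f z₂ ξ)) := by
      have : ((0, (y₁ - x₁ - f z₁ ξ) - (y₂ - x₂ - f z₂ ξ)) : ℝ × V)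
          = (u - s, y₁ - x₁ - f z₁ ξ) - (u - s, y₂ - x₂ - f z₂ ξ) := by ext <;> simp
      rw [this, map_sub (f' z₂), sub_apply]; abel
    rw [e]
    refine (norm_add_le _ _).trans (add_le_add ?_ ?_)
    · refine (ContinuousLinearMap.le_opNorm _ _).trans (mul_le_mul
        ((hf.deriv_lipschitz _ hz₁ _ hz₂).trans (by gcongr)) ?_ (norm_nonneg _) (by positivity))
      rw [Prod.norm_mk, Real.norm_of_nonneg (by linarith)]
      exact max_le htime hR₁
    · refine (ContinuousLinearMap.le_opNorm _ _).trans (mul_le_mul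
        (hf.deriv_norm_le _ hz₂) ?_ (norm_nonneg _) (by positivity))
      rw [Prod.norm_mk, norm_zero, max_eq_right (norm_nonneg _)]
      exact hR
  have t3 : ‖(f w₁ - f z₁ - fieldDeriv f f' z₁ ξ) - (f w₂ - f z₂ - fieldDeriv f f' z₂ ξ)‖
      ≤ (4 * C ^ 3 + 4 * C ^ 2 * (C + M) + C * (1 + M)) * L * r ^ 2 := by
    simp only [z₁, z₂, w₁, w₂] at *
    rw [taylor_remainder_eq, taylor_remainder_eq, add_sub_add_comm]
    refine (norm_add_le _ _).trans ((add_le_add t1' t2).trans (le_of_eq ?_))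
    ring
  have t4 : ‖(fieldDeriv f f' w₁ - fieldDeriv f f' z₁)
      - (fieldDeriv f f' w₂ - fieldDeriv f f' z₂)‖
      ≤ (2 * C ^ 2 * (2 * C + (C + M)) + 4 * C ^ 3) * L * r := by
    refine (norm_comp_double_difference_le _ _ _ _ _ _ _ _).trans ?_
    simp only [← ContinuousLinearMap.sub_comp]
    have a1 := ((norm_comp_inr_le _).trans
      (hf.deriv_difference _ hz₁ _ hw₁ _ hz₂ _ hw₂ L hzz hww)).trans
      (by gcongr : _ ≤ C * L * (2 * C * r) + C * ((C + M) * L * r))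
    have a2 := ((norm_comp_inr_le _).trans (hf.deriv_lipschitz _ hw₂ _ hz₂)).trans
      (by gcongr : _ ≤ C * (2 * C * r))
    have a3 := ((norm_comp_inr_le _).trans (hf.deriv_lipschitz _ hz₁ _ hz₂)).trans
      (by gcongr : _ ≤ C * L)
    have a4 := (norm_comp_inr_le _).trans (hf.deriv_norm_le _ hz₂)
    have b1 := hf.norm_le _ hw₁
    have b2 := (hf.lipschitz _ hw₁ _ hw₂).trans (by gcongr : _ ≤ C * L)
    have b3 := (hf.lipschitz _ hw₁ _ hz₁).trans (by gcongr : _ ≤ C * (2 * C * r))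
    have b4 := (hf.difference _ hz₁ _ hw₁ _ hz₂ _ hw₂ L hzz hww).trans
      (by gcongr : _ ≤ C * L * (2 * C * r) + C * ((C + M) * L * r))
    refine (add_le_add (add_le_add (add_le_add
      (mul_le_mul a1 b1 (norm_nonneg _) (by positivity))
      (mul_le_mul a2 b2 (norm_nonneg _) (by positivity)))
      (mul_le_mul a3 b3 (norm_nonneg _) (by positivity)))
      (mul_le_mul a4 b4 (norm_nonneg _) (by positivity))).trans (le_of_eq ?_)
    ring
  have e : -((f w₁ - f z₁ - fieldDeriv f f' z₁ ξ) (X t - X u))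
        - tensorApply (fieldDeriv f f' w₁ - fieldDeriv f f' z₁) (XX u t)
      - (-((f w₂ - f z₂ - fieldDeriv f f' z₂ ξ) (X t - X u))
        - tensorApply (fieldDeriv f f' w₂ - fieldDeriv f f' z₂) (XX u t))
      = -(((f w₁ - f z₁ - fieldDeriv f f' z₁ ξ) - (f w₂ - f z₂ - fieldDeriv f f' z₂ ξ))
          (X t - X u))
        - tensorApply ((fieldDeriv f f' w₁ - fieldDeriv f f' z₁)
          - (fieldDeriv f f' w₂ - fieldDeriv f f' z₂)) (XX u t) := by
    rw [tensorApply_sub (fieldDeriv f f' w₁ - fieldDeriv f f' z₁),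
      sub_apply (f w₁ - f z₁ - fieldDeriv f f' z₁ ξ)]
    abel
  rw [e]
  refine (norm_sub_le _ _).trans ?_
  rw [norm_neg]
  have t5 := (ContinuousLinearMap.le_opNorm _ _).trans
    (mul_le_mul t3 hXut (norm_nonneg _) (by positivity))
  have t6 : ‖tensorApply ((fieldDeriv f f' w₁ - fieldDeriv f f' z₁)
      - (fieldDeriv f f' w₂ - fieldDeriv f f' z₂)) (XX u t)‖
      ≤ (d : ℝ) ^ 2 * ((2 * C ^ 2 * (2 * C + (C + M)) + 4 * C ^ 3) * L * r) * r ^ 2 :=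
    (norm_tensorApply_le _ _).trans (by gcongr)
  refine (add_le_add t5 t6).trans (le_of_eq ?_)
  unfold defectDiffConst
  ring

end Field

/-! ### Measurability and integral bounds for the drift -/

/-- Superposition with a Carathéodory function, both conditions holding almost everywhere. -/
theorem aemeasurable_caratheodory {ι α β : Type*} [TopologicalSpace ι]
    [TopologicalSpace.MetrizableSpace ι] [MeasurableSpace ι] [SecondCountableTopology ι]
    [OpensMeasurableSpace ι] [Nonempty ι] [MeasurableSpace α] {μ : Measure α}
    [TopologicalSpace β] [TopologicalSpace.MetrizableSpace β] [MeasurableSpace β] [BorelSpace β]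
    [SecondCountableTopology β] [Zero β] {Φ : α → ι → β} (hm : ∀ z, AEMeasurable (fun t => Φ t z) μ)
    (hc : ∀ᵐ t ∂μ, Continuous (Φ t)) {g : α → ι} (hg : Measurable g) :
    AEMeasurable (fun t => Φ t (g t)) μ := by
  classical
  let e := TopologicalSpace.denseSeq ι
  have hgood : ∀ᵐ t ∂μ, Continuous (Φ t) ∧ ∀ k, Φ t (e k) = (hm (e k)).mk _ t :=
    hc.and (ae_all_iff.2 fun k => (hm (e k)).ae_eq_mk)
  -- Outside the measurable null set `N`, `Φ t` is continuous and agrees with measurable versions at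
  -- all points of a countable dense set. Setting it to zero on `N` makes it continuous for every
  -- `t`, and measurable for every `z` as a limit along the dense set.
  set N := toMeasurable μ {t | ¬ (Continuous (Φ t) ∧ ∀ k, Φ t (e k) = (hm (e k)).mk _ t)}
  have hN : MeasurableSet N := measurableSet_toMeasurable _ _
  have hN0 : μ N = 0 := by rw [measure_toMeasurable]; exact hgood
  have hNc : ∀ t ∉ N, Continuous (Φ t) ∧ ∀ k, Φ t (e k) = (hm (e k)).mk _ t := by
    intro t ht
    by_contra h
    exact ht (subset_toMeasurable _ _ h)
  let Ψ : ι → α → β := fun z t => if t ∈ N then 0 else Φ t z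
  have hΨc : ∀ t, Continuous fun z => Ψ z t := by
    intro t
    by_cases ht : t ∈ N
    · simp [Ψ, ht, continuous_const]
    · simpa [Ψ, ht] using (hNc t ht).1
  have hΨe : ∀ k, Measurable (Ψ (e k)) := by
    intro k
    have : Ψ (e k) = fun t => if t ∈ N then 0 else (hm (e k)).mk _ t := by
      ext t
      by_cases ht : t ∈ N
      · simp [Ψ, ht]
      · simp [Ψ, ht, (hNc t ht).2 k]
    rw [this]
    exact Measurable.ite hN measurable_const (hm (e k)).measurable_mk
  have hΨm : ∀ z, Measurable (Ψ z) := by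
    intro z
    obtain ⟨x, hx, hlim⟩ := mem_closure_iff_seq_limit.1 (TopologicalSpace.denseRange_denseSeq ι z)
    refine measurable_of_tendsto_metrizable (f := fun k => Ψ (x k)) (fun k => ?_)
      (tendsto_pi_nhds.2 fun t => ((hΨc t).tendsto z).comp hlim)
    obtain ⟨i, hi⟩ := hx k
    rw [← hi]
    exact hΨe i
  have hΨ := stronglyMeasurable_uncurry_of_continuous_of_stronglyMeasurable hΨc
    fun z => (hΨm z).stronglyMeasurable
  refine ⟨fun t => Ψ (g t) t, (hΨ.measurable.comp (hg.prodMk measurable_id)), ?_⟩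
  have : ∀ᵐ t ∂μ, t ∉ N := by rw [ae_iff]; simpa using hN0
  filter_upwards [this] with t ht
  simp [Ψ, ht]

/-- Bounds on the integrals `∫ g(r, Y_r) dr` of a bounded Lipschitz drift `g` on `[0,T]`. -/
structure DriftBounds {V : Type*} [NormedAddCommGroup V] [NormedSpace ℝ V] [MeasurableSpace V]
    (T C : ℝ) (g : ℝ → V → V) : Prop where
  integrableOn : ∀ Y : ℝ → V, AEMeasurable Y (volume.restrict (Icc 0 T)) →
    IntegrableOn (fun r => g r (Y r)) (Icc 0 T)
  norm_le : ∀ᵐ r ∂volume.restrict (Icc 0 T), ∀ x, ‖g r x‖ ≤ C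
  lipschitz : ∀ᵐ r ∂volume.restrict (Icc 0 T), ∀ x x', ‖g r x - g r x'‖ ≤ C * ‖x - x'‖

theorem IsDrift.exists_driftBounds {n m : ℕ} {T : ℝ} (hT : 0 < T)
    {U : Set (EuclideanSpace ℝ (Fin m))}
    {b : ℝ → EuclideanSpace ℝ (Fin n) → EuclideanSpace ℝ (Fin m) → EuclideanSpace ℝ (Fin n)}
    {u : ℝ → EuclideanSpace ℝ (Fin m)} (hb : IsDrift T U b) (hu : IsControl T U u) :
    ∃ C, 0 ≤ C ∧ DriftBounds T C fun r x => b r x (u r) := by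
  obtain ⟨C, hC, hbl⟩ := hb.bounded_lipschitz
  have hmem : ∀ᵐ r ∂volume.restrict (Icc 0 T), u r ∈ U :=
    (ae_restrict_iff' measurableSet_Icc).2 (ae_of_all _ hu.mem)
  have hn : ∀ᵐ r ∂volume.restrict (Icc 0 T), ∀ x, ‖b r x (u r)‖ ≤ C := by
    filter_upwards [hmem, hbl] with r h1 h2 using (h2 _ h1).1
  refine ⟨C, hC, fun Y hY => ?_, hn, ?_⟩
  · have hU : U.Nonempty := ⟨u 0, hu.mem 0 ⟨le_rfl, hT.le⟩⟩
    -- A measurable version of the control with all its values in `U` is a map into the subtype `U`,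
    -- on which `b` is a Carathéodory function.
    obtain ⟨v, hv, hvU, huv⟩ := hu.measurable.exists_ae_eq_range_subset hmem hU
    have hvU' : ∀ r, v r ∈ U := fun r => hvU ⟨r, rfl⟩
    have : Nonempty U := hU.to_subtype
    have key := aemeasurable_caratheodory (μ := volume.restrict (Icc 0 T))
      (Φ := fun r (z : EuclideanSpace ℝ (Fin n) × U) => b r z.1 z.2)
      (fun z => hb.measurable z.1 z.2 z.2.2)
      (by
        filter_upwards [hb.continuous] with r hr
        have hm : Continuous fun z : EuclideanSpace ℝ (Fin n) × U =>
          (z.1, (z.2 : EuclideanSpace ℝ (Fin m))) := by fun_prop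
        exact hr.comp_continuous hm fun z => ⟨mem_univ _, z.2.2⟩)
      (g := fun r => (hY.mk _ r, ⟨v r, hvU' r⟩)) (hY.measurable_mk.prodMk hv.subtype_mk)
    have hmeas : AEMeasurable (fun r => b r (Y r) (u r)) (volume.restrict (Icc 0 T)) := by
      refine key.congr ?_
      filter_upwards [hY.ae_eq_mk, huv] with r h1 h2
      simp only [h1, h2]
    refine Integrable.of_bound hmeas.aestronglyMeasurable C ?_
    filter_upwards [hn] with r hr using hr _
  · filter_upwards [hmem, hbl] with r h1 h2 using (h2 _ h1).2

namespace DriftBounds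

variable {V : Type*} [NormedAddCommGroup V] [NormedSpace ℝ V] [MeasurableSpace V]
  {T C : ℝ} {g : ℝ → V → V}

theorem intervalIntegrable (h : DriftBounds T C g) {Y : ℝ → V}
    (hY : AEMeasurable Y (volume.restrict (Icc 0 T))) {s t : ℝ} (h0 : 0 ≤ s) (hst : s ≤ t)
    (hT : t ≤ T) : IntervalIntegrable (fun r => g r (Y r)) volume s t :=
  ((h.integrableOn Y hY).mono_set (by
    rw [uIcc_of_le hst]; exact Icc_subset_Icc h0 hT)).intervalIntegrable

theorem ae_uIoc {P : ℝ → Prop} (h : ∀ᵐ r ∂volume.restrict (Icc 0 T), P r) {s t : ℝ} (h0 : 0 ≤ s)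
    (hst : s ≤ t) (hT : t ≤ T) : ∀ᵐ r, r ∈ uIoc s t → P r := by
  filter_upwards [(ae_restrict_iff' measurableSet_Icc).1 h] with r hr hm
  rw [uIoc_of_le hst] at hm
  exact hr ⟨h0.trans hm.1.le, hm.2.trans hT⟩

theorem norm_integral_le (h : DriftBounds T C g) (Y : ℝ → V) {s t : ℝ} (h0 : 0 ≤ s)
    (hst : s ≤ t) (hT : t ≤ T) : ‖∫ r in s..t, g r (Y r)‖ ≤ C * (t - s) := by
  have := intervalIntegral.norm_integral_le_of_norm_le_const_ae (C := C)
    (f := fun r => g r (Y r)) (a := s) (b := t) (by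
      filter_upwards [ae_uIoc h.norm_le h0 hst hT] with r hr hm using hr hm _)
  rwa [abs_of_nonneg (sub_nonneg.2 hst)] at this

theorem norm_integral_sub_le (h : DriftBounds T C g) (hC : 0 ≤ C) {Y Z : ℝ → V}
    (hY : AEMeasurable Y (volume.restrict (Icc 0 T)))
    (hZ : AEMeasurable Z (volume.restrict (Icc 0 T))) {s t L : ℝ} (h0 : 0 ≤ s)
    (hst : s ≤ t) (hT : t ≤ T) (hL : ∀ r ∈ Icc s t, ‖Y r - Z r‖ ≤ L) :
    ‖(∫ r in s..t, g r (Y r)) - ∫ r in s..t, g r (Z r)‖ ≤ C * L * (t - s) := by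
  rw [← intervalIntegral.integral_sub (h.intervalIntegrable hY h0 hst hT)
    (h.intervalIntegrable hZ h0 hst hT)]
  have := intervalIntegral.norm_integral_le_of_norm_le_const_ae (C := C * L)
    (f := fun r => g r (Y r) - g r (Z r)) (a := s) (b := t) (by
      filter_upwards [ae_uIoc h.lipschitz h0 hst hT] with r hr hm
      refine (hr hm _ _).trans (mul_le_mul_of_nonneg_left (hL r ?_) hC)
      rw [uIoc_of_le hst] at hm
      exact Ioc_subset_Icc_self hm)
  rwa [abs_of_nonneg (sub_nonneg.2 hst)] at this

theorem integral_sub_integral (h : DriftBounds T C g) {Y : ℝ → V}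
    (hY : AEMeasurable Y (volume.restrict (Icc 0 T))) {s t : ℝ} (h0 : 0 ≤ s)
    (hst : s ≤ t) (hT : t ≤ T) :
    (∫ r in (0 : ℝ)..t, g r (Y r)) - ∫ r in (0 : ℝ)..s, g r (Y r) = ∫ r in s..t, g r (Y r) :=
  intervalIntegral.integral_interval_sub_left
    (h.intervalIntegrable hY le_rfl (h0.trans hst) hT)
    (h.intervalIntegrable hY le_rfl h0 (hst.trans hT))

end DriftBounds

/-! ### One control for the rough path and time -/

/-- The control `ω` dominates the rough path and time, with Hölder-type exponent `α > 1/3`. -/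
structure RoughBounds {d : ℕ} (T α : ℝ) (ω : ℝ → ℝ → ℝ) (X : ℝ → EuclideanSpace ℝ (Fin d))
    (XX : ℝ → ℝ → EuclideanSpace ℝ (Fin d × Fin d)) : Prop where
  control : RegularControl T ω
  exponent : 1 < 3 * α
  path : ∀ s t, 0 ≤ s → s ≤ t → t ≤ T → ‖X t - X s‖ ≤ ω s t ^ α
  enhancement : ∀ s t, 0 ≤ s → s ≤ t → t ≤ T → ‖XX s t‖ ≤ (ω s t ^ α) ^ 2
  time : ∀ s t, 0 ≤ s → s ≤ t → t ≤ T → t - s ≤ (ω s t ^ α) ^ 2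

theorem rpow_pow_three {x : ℝ} (hx : 0 ≤ x) (α : ℝ) : (x ^ α) ^ 3 = x ^ (3 * α) := by
  rw [mul_comm, Real.rpow_mul hx]; norm_cast

theorem RoughBounds.rho_mono {d : ℕ} {T α : ℝ} {ω : ℝ → ℝ → ℝ} {X : ℝ → EuclideanSpace ℝ (Fin d)}
    {XX : ℝ → ℝ → EuclideanSpace ℝ (Fin d × Fin d)} (h : RoughBounds T α ω X XX)
    {s s' t' t : ℝ} (hs : 0 ≤ s) (h1 : s ≤ s') (h2 : s' ≤ t') (h3 : t' ≤ t) (ht : t ≤ T) :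
    ω s' t' ^ α ≤ ω s t ^ α :=
  Real.rpow_le_rpow (h.control.nonneg _ _ (hs.trans h1) h2 (h3.trans ht))
    (h.control.mono hs h1 h2 h3 ht) (by linarith [h.exponent])

theorem RoughBounds.rho_small {d : ℕ} {T α : ℝ} {ω : ℝ → ℝ → ℝ}
    {X : ℝ → EuclideanSpace ℝ (Fin d)}
    {XX : ℝ → ℝ → EuclideanSpace ℝ (Fin d × Fin d)} (h : RoughBounds T α ω X XX)
    {ε : ℝ} (hε : 0 < ε) :
    ∃ h > 0, ∀ s t, 0 ≤ s → s ≤ t → t ≤ T → t - s ≤ h → ω s t ^ α ≤ ε := by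
  have hα : 0 < α := by linarith [h.exponent]
  obtain ⟨η, hη, H⟩ := h.control.small (ε ^ (1 / α)) (by positivity)
  refine ⟨η, hη, fun s t h0 hst hT hle => ?_⟩
  have := Real.rpow_le_rpow (h.control.nonneg s t h0 hst hT) (H s t h0 hst hT hle) hα.le
  rwa [← Real.rpow_mul hε.le, one_div_mul_cancel hα.ne', Real.rpow_one] at this

/-! ### Euler schemes and their limit -/

section Euler

variable {d : ℕ} {V : Type*} [NormedAddCommGroup V] [NormedSpace ℝ V]

/-- The error of one step of the Euler scheme from `(s, x)` to `(t, y)`. -/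
noncomputable def stepError (X : ℝ → EuclideanSpace ℝ (Fin d))
    (XX : ℝ → ℝ → EuclideanSpace ℝ (Fin d × Fin d))
    (f : ℝ × V → (EuclideanSpace ℝ (Fin d) →L[ℝ] V))
    (f' : ℝ × V → (ℝ × V →L[ℝ] (EuclideanSpace ℝ (Fin d) →L[ℝ] V)))
    (g : ℝ → V → V) (s t : ℝ) (x y : V) : V :=
  y - x - localIncrement X XX f f' s t x - ∫ r in s..t, g r x

/-- The constant bounding the remainder of a path with small step errors. -/
noncomputable def remainderConst (d : ℕ) (C Cb : ℝ) : ℝ := (d : ℝ) ^ 2 * C ^ 2 + Cb + 1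

/-- The constant bounding the defect of additivity of the step errors. -/
noncomputable def stepDefectConst (d : ℕ) (C Cb : ℝ) : ℝ :=
  defectConst d C (remainderConst d C Cb) + Cb * (C + remainderConst d C Cb)

variable {T α C Cb : ℝ} {ω : ℝ → ℝ → ℝ} {X : ℝ → EuclideanSpace ℝ (Fin d)}
  {XX : ℝ → ℝ → EuclideanSpace ℝ (Fin d × Fin d)}
  {f : ℝ × V → (EuclideanSpace ℝ (Fin d) →L[ℝ] V)}
  {f' : ℝ × V → (ℝ × V →L[ℝ] (EuclideanSpace ℝ (Fin d) →L[ℝ] V))} {g : ℝ → V → V}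

theorem stepError_self {p : ℝ} (hX : IsRoughPath p T X XX) {s : ℝ} (hs : s ∈ Icc 0 T) (x : V) :
    stepError X XX f f' g s s x x = 0 := by
  simp [stepError, localIncrement, hX.enhancement_self hs, tensorApply]

variable [MeasurableSpace V]

/-- The condition `K * r ≤ 1` trades the factor `K` for one power of `r`, so `remainderConst` does
not depend on `K`. This prevents circularity when `K` is later built from constants depending on
`remainderConst`. -/
theorem norm_remainder_le_of_stepError (hf : C3Bounds (Icc 0 T ×ˢ univ) C f f')
    (hω : RoughBounds T α ω X XX) (hg : DriftBounds T Cb g) (hCb : 0 ≤ Cb) {s u K r : ℝ}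
    (h0 : 0 ≤ s) (hsu : s ≤ u) (hT : u ≤ T) {x y : V} (hr : ω s u ^ α ≤ r)
    (hK : 0 ≤ K) (hKr : K * r ≤ 1) (h : ‖stepError X XX f f' g s u x y‖ ≤ K * (ω s u ^ α) ^ 3) :
    ‖y - x - f (s, x) (X u - X s)‖ ≤ remainderConst d C Cb * r ^ 2 := by
  have hρ : 0 ≤ ω s u ^ α := Real.rpow_nonneg (hω.control.nonneg _ _ h0 hsu hT) _
  have hS : (s, x) ∈ Icc 0 T ×ˢ (univ : Set V) := ⟨⟨h0, by dsimp; linarith⟩, mem_univ _⟩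
  have e : y - x - f (s, x) (X u - X s) = tensorApply (fieldDeriv f f' (s, x)) (XX s u)
      + (∫ r in s..u, g r x) + stepError X XX f f' g s u x y := by
    simp only [stepError, localIncrement]; abel
  have h1 : ‖tensorApply (fieldDeriv f f' (s, x)) (XX s u)‖ ≤ (d : ℝ) ^ 2 * C ^ 2 * r ^ 2 :=
    (norm_tensorApply_le _ _).trans (by
      gcongr
      · exact hf.norm_fieldDeriv_le hS
      · exact (hω.enhancement s u h0 hsu hT).trans (by gcongr))
  have h2 : ‖∫ r in s..u, g r x‖ ≤ Cb * r ^ 2 :=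
    (hg.norm_integral_le (fun _ => x) h0 hsu hT).trans
      (mul_le_mul_of_nonneg_left ((hω.time s u h0 hsu hT).trans (by gcongr)) hCb)
  have h3 : K * (ω s u ^ α) ^ 3 ≤ r ^ 2 := by
    calc K * (ω s u ^ α) ^ 3 ≤ K * r ^ 3 := by gcongr
      _ = (K * r) * r ^ 2 := by ring
      _ ≤ 1 * r ^ 2 := by gcongr
      _ = r ^ 2 := one_mul _
  rw [e]
  refine norm_add₃_le.trans ((add_le_add (add_le_add h1 h2) (h.trans h3)).trans (le_of_eq ?_))
  unfold remainderConst
  ring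

/-- The endpoint `w` cancels, which leaves the defect of the local increments and the change of the
frozen drift from `x` to `y` on `[u,t]`. The latter is a first-order displacement times a
second-order time, hence also third order. -/
theorem norm_stepError_defect_le {p : ℝ} (hf : C3Bounds (Icc 0 T ×ˢ univ) C f f')
    (hX : IsRoughPath p T X XX)
    (hω : RoughBounds T α ω X XX) (hg : DriftBounds T Cb g) (hCb : 0 ≤ Cb) {s u t K : ℝ}
    (h0 : 0 ≤ s) (hsu : s ≤ u) (hut : u ≤ t) (hT : t ≤ T) {x y w : V} (hr1 : ω s t ^ α ≤ 1)
    (hK : 0 ≤ K) (hKr : K * ω s t ^ α ≤ 1)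
    (h : ‖stepError X XX f f' g s u x y‖ ≤ K * (ω s u ^ α) ^ 3) :
    ‖stepError X XX f f' g s t x w - stepError X XX f f' g s u x y
      - stepError X XX f f' g u t y w‖ ≤ stepDefectConst d C Cb * (ω s t ^ α) ^ 3 := by
  have hC := hf.one_le
  have hr0 : 0 ≤ ω s t ^ α := Real.rpow_nonneg (hω.control.nonneg _ _ h0 (hsu.trans hut) hT) _
  have hru := hω.rho_mono h0 le_rfl hsu hut hT
  have hrt := hω.rho_mono h0 hsu hut le_rfl hT
  have hu0 : 0 ≤ ω s u ^ α := Real.rpow_nonneg (hω.control.nonneg _ _ h0 hsu (hut.trans hT)) _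
  have ht0 : 0 ≤ ω u t ^ α := Real.rpow_nonneg (hω.control.nonneg _ _ (h0.trans hsu) hut hT) _
  have hR := norm_remainder_le_of_stepError hf hω hg hCb h0 hsu (hut.trans hT) hru hK hKr h
  have hrem : 0 ≤ remainderConst d C Cb := by unfold remainderConst; positivity
  have hz : (s, x) ∈ Icc 0 T ×ˢ (univ : Set V) := ⟨⟨h0, by dsimp; linarith⟩, mem_univ _⟩
  have hw : (u, y) ∈ Icc 0 T ×ˢ (univ : Set V) :=
    ⟨⟨by dsimp; linarith, by dsimp; linarith⟩, mem_univ _⟩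
  have htime := (hω.time s u h0 hsu (hut.trans hT)).trans
    (by gcongr : _ ≤ (ω s t ^ α) ^ 2)
  have hXsu := (hω.path s u h0 hsu (hut.trans hT)).trans hru
  have key := norm_localIncrement_defect_le hf hX h0 hsu hut hT hz hw hr0 hr1 hrem htime hXsu
    ((hω.path u t (h0.trans hsu) hut hT).trans hrt)
    ((hω.enhancement u t (h0.trans hsu) hut hT).trans (by gcongr)) hR
  have hy := (norm_add_le_of_remainder hf hz hr0 hr1 hrem hsu htime hXsu hR).1
  have hI : (∫ r in s..u, g r x) + ∫ r in u..t, g r x = ∫ r in s..t, g r x :=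
    intervalIntegral.integral_add_adjacent_intervals
      (hg.intervalIntegrable (Y := fun _ => x) aemeasurable_const h0 hsu (hut.trans hT))
      (hg.intervalIntegrable (Y := fun _ => x) aemeasurable_const (h0.trans hsu) hut hT)
  have hd : ‖(∫ r in u..t, g r y) - ∫ r in u..t, g r x‖
      ≤ Cb * ((C + remainderConst d C Cb) * ω s t ^ α) * (ω s t ^ α) ^ 2 := by
    refine (hg.norm_integral_sub_le (Y := fun _ => y) (Z := fun _ => x) hCb aemeasurable_const
      aemeasurable_const (h0.trans hsu) hut hT (fun _ _ => hy)).trans ?_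
    gcongr
    exact (hω.time u t (h0.trans hsu) hut hT).trans (by gcongr)
  have e : stepError X XX f f' g s t x w - stepError X XX f f' g s u x y
      - stepError X XX f f' g u t y w
      = -(localIncrement X XX f f' s t x - localIncrement X XX f f' s u x
        - localIncrement X XX f f' u t y)
        + ((∫ r in u..t, g r y) - ∫ r in u..t, g r x) := by
    simp only [stepError, ← hI]; abel
  rw [e]
  refine (norm_add_le _ _).trans ?_
  rw [norm_neg]
  refine (add_le_add key hd).trans (le_of_eq ?_)
  unfold stepDefectConst
  ring

-- Used to pass the bound on step errors to pointwise limits of Euler schemes; the field, its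
-- Gubinelli derivative and the frozen drift integral are Lipschitz in `x`.
set_option maxSynthPendingDepth 3 in
theorem continuous_stepError (hf : C3Bounds (Icc 0 T ×ˢ univ) C f f')
    (hg : DriftBounds T Cb g) (hCb : 0 ≤ Cb) {s t : ℝ}
    (h0 : 0 ≤ s) (hst : s ≤ t) (hT : t ≤ T) :
    Continuous fun q : V × V => stepError X XX f f' g s t q.1 q.2 := by
  have hS : ∀ x : V, (s, x) ∈ Icc 0 T ×ˢ (univ : Set V) := fun x =>
    ⟨⟨h0, by dsimp; linarith⟩, mem_univ _⟩
  have hn : ∀ x y : V, ‖((s, x) - (s, y) : ℝ × V)‖ = ‖x - y‖ := fun x y => by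
    rw [Prod.mk_sub_mk, sub_self, Prod.norm_mk, norm_zero, max_eq_right (norm_nonneg _)]
  have c1 : Continuous fun x : V => f (s, x) :=
    (LipschitzWith.of_dist_le' (K := C) fun x y => by
      rw [dist_eq_norm, dist_eq_norm, ← hn]
      exact hf.lipschitz _ (hS x) _ (hS y)).continuous
  have c2 : Continuous fun x : V => fieldDeriv f f' (s, x) :=
    (LipschitzWith.of_dist_le' (f := fun x : V => fieldDeriv f f' (s, x))
      (K := 2 * C ^ 2) fun x y => by
      rw [dist_eq_norm, dist_eq_norm, ← hn]
      exact hf.norm_fieldDeriv_sub_le (hS x) (hS y)).continuous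
  have c3 : Continuous fun x : V => ∫ r in s..t, g r x :=
    (LipschitzWith.of_dist_le' (K := Cb * (t - s)) fun x y => by
      rw [dist_eq_norm, dist_eq_norm]
      refine (hg.norm_integral_sub_le (Y := fun _ => x) (Z := fun _ => y) hCb aemeasurable_const
        aemeasurable_const h0 hst hT (fun _ _ => le_rfl)).trans (le_of_eq ?_)
      ring).continuous
  have c4 : Continuous fun x : V => localIncrement X XX f f' s t x :=
    (c1.clm_apply continuous_const).add (continuous_finsetSum _ fun i _ =>
      continuous_finsetSum _ fun j _ =>
        ((c2.clm_apply continuous_const).clm_apply continuous_const).const_smul _)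
  exact ((continuous_snd.sub continuous_fst).sub (c4.comp continuous_fst)).sub
    (c3.comp continuous_fst)

/-- Enumeration of a finite set of reals by a monotone sequence. -/
theorem exists_monotone_enumeration (P : Finset ℝ) (hP : P.Nonempty) :
    ∃ τ : ℕ → ℝ, Monotone τ ∧ (∀ i, τ i ∈ P) ∧ ∀ s ∈ P, ∃ i, τ i = s := by
  have hc : 0 < P.card := hP.card_pos
  refine ⟨fun i => P.orderEmbOfFin rfl ⟨min i (P.card - 1), by omega⟩, fun i j hij => ?_,
    fun i => Finset.orderEmbOfFin_mem _ _ _, fun s hs => ?_⟩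
  · exact (P.orderEmbOfFin rfl).monotone (by simp only [Fin.mk_le_mk]; omega)
  · have : s ∈ Set.range (P.orderEmbOfFin rfl) := by rw [Finset.range_orderEmbOfFin]; exact hs
    obtain ⟨i, rfl⟩ := this
    exact ⟨i, congrArg (P.orderEmbOfFin rfl) (Fin.ext (by simp only; omega))⟩

/-- The a priori bound for the Euler scheme along a finite set of times. -/
theorem exists_euler_scheme {p : ℝ} (hf : C3Bounds (Icc 0 T ×ˢ univ) C f f')
    (hX : IsRoughPath p T X XX) (hω : RoughBounds T α ω X XX) (hg : DriftBounds T Cb g)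
    (hCb : 0 ≤ Cb) {δ : ℝ} (hδ1 : δ ≤ 1)
    (hδK : sewingConst (3 * α) * stepDefectConst d C Cb * δ ≤ 1) (y : V) (P : Finset ℝ)
    (hP : ∀ s ∈ P, s ∈ Icc 0 T) (h0P : 0 ∈ P) :
    ∃ Y : ℝ → V, Y 0 = y ∧ ∀ s ∈ P, ∀ t ∈ P, s ≤ t → ω s t ^ α ≤ δ →
      ‖stepError X XX f f' g s t (Y s) (Y t)‖
        ≤ sewingConst (3 * α) * stepDefectConst d C Cb * (ω s t ^ α) ^ 3 := by
  classical
  have hC := hf.one_le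
  have hrem : 0 ≤ remainderConst d C Cb := by unfold remainderConst; positivity
  have hK2 : 0 ≤ stepDefectConst d C Cb := by unfold stepDefectConst defectConst; positivity
  have hsc := sewingConst_pos hω.exponent
  set K := sewingConst (3 * α) * stepDefectConst d C Cb with hKdef
  have hK : 0 ≤ K := by positivity
  obtain ⟨τ, hτ, hτP, hPτ⟩ := exists_monotone_enumeration P ⟨0, h0P⟩
  have hτT : ∀ i, τ i ∈ Icc 0 T := fun i => hP _ (hτP i)
  -- Each value is chosen so that the step error between consecutive points is zero, as the discrete
  -- sewing lemma requires.
  let z : ℕ → V := fun i => Nat.rec y (fun i x => x + localIncrement X XX f f' (τ i) (τ (i + 1)) x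
    + ∫ r in (τ i)..(τ (i + 1)), g r x) i
  have hz : ∀ i, stepError X XX f f' g (τ i) (τ (i + 1)) (z i) (z (i + 1)) = 0 := by
    intro i
    have : z (i + 1) = z i + localIncrement X XX f f' (τ i) (τ (i + 1)) (z i)
      + ∫ r in (τ i)..(τ (i + 1)), g r (z i) := rfl
    rw [this, stepError]; abel
  -- Induction on the number of steps. The defect over `[k,m]` needs the bound only on the shorter
  -- `[k,l]`, and its constant does not depend on `K`; sewing therefore reproduces the same `K` at
  -- every stage.
  have key : ∀ n i j, j - i = n → i ≤ j → ω (τ i) (τ j) ^ α ≤ δ →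
      ‖stepError X XX f f' g (τ i) (τ j) (z i) (z j)‖ ≤ K * (ω (τ i) (τ j) ^ α) ^ 3 := by
    intro n
    induction n using Nat.strong_induction_on with
    | _ n ih =>
      intro i j hn hij hle
      have hnn : ∀ k l, k ≤ l → 0 ≤ ω (τ k) (τ l) := fun k l hkl =>
        hω.control.nonneg _ _ (hτT k).1 (hτ hkl) (hτT l).2
      have hmono : ∀ k l, i ≤ k → k ≤ l → l ≤ j → ω (τ k) (τ l) ^ α ≤ δ := fun k l h1 h2 h3 =>
        (hω.rho_mono (hτT i).1 (hτ h1) (hτ h2) (hτ h3) (hτT j).2).trans hle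
      rcases hij.eq_or_lt with rfl | hlt
      · rw [stepError_self hX (hτT i), norm_zero]
        have := Real.rpow_nonneg (hnn i i le_rfl) α
        positivity
      have := sewing_discrete_step (N := j) (ω := fun k l => ω (τ k) (τ l))
        (E := fun k l => stepError X XX f f' g (τ k) (τ l) (z k) (z l)) hω.exponent hK2
        (fun k l hkl _ => hnn k l hkl)
        (fun k l m hkl hlm _ => hω.control.superadd _ _ _ (hτT k).1 (hτ hkl) (hτ hlm) (hτT m).2)
        (fun k => stepError_self hX (hτT k) _) hz hlt le_rfl
        (fun k l m hik hkl hlm hmj => ?_) (fun k l hik hkl hlj hlen => ?_)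
      · rwa [rpow_pow_three (hnn i j hij)]
      · rw [← rpow_pow_three (hnn k m (by omega))]
        have hkm := hmono k m hik (by omega) hmj
        refine norm_stepError_defect_le hf hX hω hg hCb (hτT k).1 (hτ hkl.le) (hτ hlm.le)
          (hτT m).2 (hkm.trans hδ1) hK ((mul_le_mul_of_nonneg_left hkm hK).trans hδK)
          (ih (l - k) (by omega) k l rfl hkl.le (hmono k l hik hkl.le (by omega)))
      · rw [← hKdef, ← rpow_pow_three (hnn k l hkl)]
        exact ih (l - k) (by omega) k l rfl hkl (hmono k l hik hkl hlj)
  -- The enumeration may repeat its values, so the first index is used. This gives index `0` to time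
  -- `0`; values off `P` are irrelevant.
  let idx : ℝ → ℕ := fun s => if h : ∃ i, τ i = s then Nat.find h else 0
  have hidx : ∀ s ∈ P, τ (idx s) = s := by
    intro s hs
    simp only [idx, dif_pos (hPτ s hs)]
    exact Nat.find_spec (hPτ s hs)
  have hτ0 : τ 0 = 0 := by
    obtain ⟨i, hi⟩ := hPτ 0 h0P
    exact le_antisymm (hi ▸ hτ (Nat.zero_le i)) (hτT 0).1
  have hidx0 : idx 0 = 0 := by
    simp only [idx, dif_pos (hPτ 0 h0P)]
    exact (Nat.find_eq_zero _).2 hτ0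
  refine ⟨fun s => z (idx s), by simp only [hidx0]; rfl, fun s hs t ht hst hle => ?_⟩
  rcases hst.eq_or_lt with rfl | hlt
  · rw [stepError_self hX (hP s hs), norm_zero]
    have := Real.rpow_nonneg (hω.control.nonneg s s (hP s hs).1 le_rfl (hP s hs).2) α
    positivity
  · have hlt' : idx s ≤ idx t := by
      by_contra hcon
      have := hτ (not_le.1 hcon).le
      rw [hidx s hs, hidx t ht] at this
      linarith
    have := key _ (idx s) (idx t) rfl hlt' (by rwa [hidx s hs, hidx t ht])
    rwa [hidx s hs, hidx t ht] at this

/-- Existence of a path satisfying the local expansion of a solution, as a limit of Euler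
schemes. -/
theorem exists_local_solution [ProperSpace V] {p : ℝ} (hTpos : 0 < T)
    (hf : C3Bounds (Icc 0 T ×ˢ univ) C f f')
    (hX : IsRoughPath p T X XX) (hω : RoughBounds T α ω X XX) (hg : DriftBounds T Cb g)
    (hCb : 0 ≤ Cb) (y : V) :
    ∃ (Y : ℝ → V) (K δ : ℝ), Y 0 = y ∧ 0 ≤ K ∧ 0 < δ ∧ δ ≤ 1 ∧ K * δ ≤ 1 ∧
      ∀ s t, 0 ≤ s → s ≤ t → t ≤ T → ω s t ^ α ≤ δ →
      ‖stepError X XX f f' g s t (Y s) (Y t)‖ ≤ K * (ω s t ^ α) ^ 3 := by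
  classical
  have hC := hf.one_le
  have hrem : 0 ≤ remainderConst d C Cb := by unfold remainderConst; positivity
  have hK2 : 0 ≤ stepDefectConst d C Cb := by unfold stepDefectConst defectConst; positivity
  have hsc := sewingConst_pos hω.exponent
  set K := sewingConst (3 * α) * stepDefectConst d C Cb with hKdef
  have hK : 0 ≤ K := by positivity
  -- This choice ensures both `δ ≤ 1` and `K * δ ≤ 1`.
  set δ := 1 / (K + 1) with hδdef
  have hδ0 : 0 < δ := by positivity
  have hδ1 : δ ≤ 1 := by rw [hδdef, div_le_one (by linarith)]; linarith
  have hKδ : K * δ ≤ 1 := by rw [hδdef, mul_one_div, div_le_one (by linarith)]; linarith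
  have hex : ∀ Q : Finset ℝ, ∃ Y : ℝ → V, Y 0 = y ∧ ∀ s ∈ Q, ∀ t ∈ Q, 0 ≤ s → s ≤ t → t ≤ T →
      ω s t ^ α ≤ δ → ‖stepError X XX f f' g s t (Y s) (Y t)‖ ≤ K * (ω s t ^ α) ^ 3 := by
    intro Q
    obtain ⟨Y, hY0, hY⟩ := exists_euler_scheme hf hX hω hg hCb hδ1 hKδ y
      (insert 0 (Q.filter (· ∈ Icc 0 T))) (by
        intro s hs
        rcases Finset.mem_insert.1 hs with rfl | hs
        · exact ⟨le_rfl, hTpos.le⟩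
        · exact (Finset.mem_filter.1 hs).2) (Finset.mem_insert_self _ _)
    refine ⟨Y, hY0, fun s hs t ht h0 hst hT => hY s ?_ t ?_ hst⟩
    · exact Finset.mem_insert_of_mem (Finset.mem_filter.2 ⟨hs, h0, hst.trans hT⟩)
    · exact Finset.mem_insert_of_mem (Finset.mem_filter.2 ⟨ht, h0.trans hst, hT⟩)
  choose Z hZ0 hZ using hex
  obtain ⟨η, hη, hηδ⟩ := hω.rho_small hδ0
  obtain ⟨N, hN⟩ := exists_nat_gt (T / η)
  have hNr : (0 : ℝ) < N := lt_trans (by positivity) hN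
  have hstep : T / N ≤ η := by
    rw [div_le_iff₀ hNr]; rw [div_lt_iff₀ hη] at hN; linarith
  -- If the set of times contains this grid, each of its points in `[0,T]` is reached from `0` in at
  -- most `N + 1` moves of time length at most `η`, each displacing the scheme by at most `M`. The
  -- resulting bound does not depend on the set.
  let grid : Finset ℝ := (Finset.range (N + 1)).image fun k : ℕ => k * (T / N)
  have hgrid : ∀ k ≤ N, (k : ℝ) * (T / N) ∈ grid := fun k hk =>
    Finset.mem_image.2 ⟨k, Finset.mem_range.2 (by omega), rfl⟩
  set M := C + remainderConst d C Cb with hM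
  have hM0 : 0 ≤ M := by positivity
  have hstepM : ∀ Q : Finset ℝ, ∀ s ∈ Q, ∀ t ∈ Q, 0 ≤ s → s ≤ t → t ≤ T → t - s ≤ η →
      ‖Z Q t - Z Q s‖ ≤ M := by
    intro Q s hs t ht h0 hst hT hle
    have hr := hηδ s t h0 hst hT hle
    have hr0 : 0 ≤ ω s t ^ α := Real.rpow_nonneg (hω.control.nonneg s t h0 hst hT) _
    have h1 := norm_remainder_le_of_stepError hf hω hg hCb h0 hst hT le_rfl hK
      ((mul_le_mul_of_nonneg_left hr hK).trans hKδ) (hZ Q s hs t ht h0 hst hT hr)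
    refine (norm_add_le_of_remainder hf ⟨⟨h0, by dsimp; linarith⟩, mem_univ _⟩ hr0 (hr.trans hδ1)
      hrem hst (hω.time s t h0 hst hT) (hω.path s t h0 hst hT) h1).1.trans ?_
    exact mul_le_of_le_one_right hM0 (hr.trans hδ1)
  have hTN : 0 ≤ T / N := by positivity
  have hkN : ∀ k : ℕ, k ≤ N → (k : ℝ) * (T / N) ≤ T := by
    intro k hk
    have : (k : ℝ) ≤ N := by exact_mod_cast hk
    calc (k : ℝ) * (T / N) ≤ N * (T / N) := by gcongr
      _ = T := by field_simp
  have hbdgrid : ∀ Q : Finset ℝ, grid ⊆ Q → ∀ k ≤ N, ‖Z Q (k * (T / N)) - y‖ ≤ k * M := by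
    intro Q hQ k
    induction k with
    | zero => intro _; simp [hZ0]
    | succ k ih =>
      intro hk
      have h1 := ih (by omega)
      have h2 := hstepM Q _ (hQ (hgrid k (by omega))) _ (hQ (hgrid (k + 1) hk)) (by positivity)
        (by push_cast; nlinarith) (hkN _ hk) (by push_cast; linarith)
      have e : Z Q (↑(k + 1) * (T / N)) - y = (Z Q (↑(k + 1) * (T / N)) - Z Q (k * (T / N)))
          + (Z Q (k * (T / N)) - y) := by abel
      rw [e]
      refine (norm_add_le _ _).trans ?_
      push_cast at *
      linarith
  have hbd : ∀ t ∈ Icc 0 T, ∀ Q : Finset ℝ, grid ⊆ Q → t ∈ Q →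
      Z Q t ∈ Metric.closedBall y ((N + 1) * M) := by
    intro t ht Q hQ htQ
    have hk : (⌊t / (T / N)⌋₊ : ℝ) ≤ t / (T / N) := Nat.floor_le (by have := ht.1; positivity)
    have hk' := Nat.lt_floor_add_one (t / (T / N))
    have hTN' : 0 < T / N := by positivity
    rw [le_div_iff₀ hTN'] at hk
    rw [div_lt_iff₀ hTN'] at hk'
    have hkle : ⌊t / (T / N)⌋₊ ≤ N := by
      have : t / (T / N) ≤ N := by
        rw [div_le_iff₀ hTN']; calc t ≤ T := ht.2
          _ = N * (T / N) := by field_simp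
      exact Nat.floor_le_of_le this
    have h1 := hbdgrid Q hQ _ hkle
    have h2 := hstepM Q _ (hQ (hgrid _ hkle)) t htQ (by positivity) hk ht.2 (by linarith)
    rw [mem_closedBall_iff_norm]
    have e : Z Q t - y = (Z Q t - Z Q (⌊t / (T / N)⌋₊ * (T / N)))
      + (Z Q (⌊t / (T / N)⌋₊ * (T / N)) - y) := by abel
    rw [e]
    refine (norm_add_le _ _).trans ?_
    have : (⌊t / (T / N)⌋₊ : ℝ) ≤ N := by exact_mod_cast hkle
    nlinarith
  -- One ultrafilter finer than the order of finite sets gives limits at all times at once, by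
  -- compactness of closed balls. The estimate for a pair `s, t` holds for all sets containing both,
  -- hence in the limit.
  let 𝒰 : Ultrafilter (Finset ℝ) := Ultrafilter.of atTop
  have h𝒰 : (𝒰 : Filter (Finset ℝ)) ≤ atTop := Ultrafilter.of_le _
  have hlim : ∀ t, ∃ x, t ∈ Icc 0 T → Tendsto (fun Q => Z Q t) 𝒰 (𝓝 x) := by
    intro t
    by_cases ht : t ∈ Icc 0 T
    · have hev : ∀ᶠ Q in (𝒰 : Filter (Finset ℝ)), Z Q t ∈ Metric.closedBall y ((N + 1) * M) := by
        refine h𝒰 ?_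
        filter_upwards [eventually_ge_atTop (grid ∪ {t})] with Q hQ
        exact hbd t ht Q (Finset.union_subset_left hQ)
          (hQ (Finset.mem_union_right _ (Finset.mem_singleton_self t)))
      obtain ⟨x, -, hx⟩ := (isCompact_closedBall y ((N + 1) * M)).ultrafilter_le_nhds
        (𝒰.map fun Q => Z Q t) (le_principal_iff.2 hev)
      exact ⟨x, fun _ => hx⟩
    · exact ⟨0, fun h => absurd h ht⟩
  choose Y hY using hlim
  refine ⟨Y, K, δ, ?_, hK, hδ0, hδ1, hKδ, fun s t h0 hst hT hle => ?_⟩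
  · refine tendsto_nhds_unique (hY 0 ⟨le_rfl, hTpos.le⟩) ?_
    simp only [hZ0]
    exact tendsto_const_nhds
  · have hc := (continuous_stepError (X := X) (XX := XX) hf hg hCb h0 hst hT).norm
    have hlim := hc.continuousAt.tendsto.comp
      ((hY s ⟨h0, hst.trans hT⟩).prodMk_nhds (hY t ⟨h0.trans hst, hT⟩))
    refine le_of_tendsto hlim (h𝒰 ?_)
    filter_upwards [eventually_ge_atTop {s, t}] with Q hQ
    exact hZ Q s (hQ (by simp)) t (hQ (by simp)) h0 hst hT hle

end Euler

/-! ### Riemann sums and their limits -/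

section Partitions

theorem meshToZero_eventually (a b : ℝ) {ε : ℝ} (hε : 0 < ε) :
    ∀ᶠ π in meshToZero a b, ∀ i < π.n, π.point (i + 1) - π.point i ≤ ε := by
  have h : ∀ᶠ x : ℝ≥0 in 𝓝 0, x < Real.toNNReal ε := gt_mem_nhds (by simpa using hε)
  filter_upwards [h.comap Partition.mesh] with π hπ i hi
  have h1 : Real.toNNReal (π.point (i + 1) - π.point i) ≤ π.mesh :=
    Finset.le_sup (f := fun i => Real.toNNReal (π.point (i + 1) - π.point i))
      (Finset.mem_range.2 hi)
  exact (Real.toNNReal_le_toNNReal_iff hε.le).1 (h1.trans hπ.le)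

theorem exists_of_meshToZero_eventually {a b : ℝ} {P : Partition a b → Prop}
    (h : ∀ᶠ π in meshToZero a b, P π) :
    ∃ ε > 0, ∀ π : Partition a b, (∀ i < π.n, π.point (i + 1) - π.point i ≤ ε) → P π := by
  obtain ⟨s, hs, hsP⟩ := mem_comap.1 h
  obtain ⟨r, hr, hrs⟩ := NNReal.nhds_zero_basis.mem_iff.1 hs
  refine ⟨r / 2, by positivity, fun π hπ => hsP (hrs ?_)⟩
  have h1 : π.mesh ≤ r / 2 := by
    refine Finset.sup_le fun i hi => ?_
    rw [Real.toNNReal_le_iff_le_coe]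
    simpa using hπ i (Finset.mem_range.1 hi)
  exact lt_of_le_of_lt h1 (NNReal.half_lt_self hr.ne')

/-- A fine partition of `[a,b]` is prolonged by a uniform subdivision of `[b,c]`. The two Riemann
sums then share their part over `[a,b]`, and their difference is a Riemann sum over `[b,c]`. -/
theorem Partition.exists_extension {M : Type*} [AddCommMonoid M] {a b c ε : ℝ}
    (π : Partition a b) (hbc : b < c) (hε : 0 < ε)
    (hπ : ∀ i < π.n, π.point (i + 1) - π.point i ≤ ε) (Ξ : ℝ → ℝ → M) :
    ∃ (π' : Partition a c) (τ : ℕ → ℝ) (N : ℕ), 0 < N ∧ τ 0 = b ∧ τ N = c ∧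
      (∀ i, τ i ≤ τ (i + 1)) ∧ (∀ i < π'.n, π'.point (i + 1) - π'.point i ≤ ε) ∧
      ∑ i ∈ Finset.range π'.n, Ξ (π'.point i) (π'.point (i + 1))
        = ∑ i ∈ Finset.range π.n, Ξ (π.point i) (π.point (i + 1))
          + ∑ i ∈ Finset.range N, Ξ (τ i) (τ (i + 1)) := by
  obtain ⟨N, hN⟩ := exists_nat_gt ((c - b) / ε)
  have hNr : (0 : ℝ) < N := lt_trans (div_pos (by linarith) hε) hN
  have hstep : (c - b) / N ≤ ε := by
    rw [div_le_iff₀ hNr]; rw [div_lt_iff₀ hε] at hN; linarith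
  have hpos : 0 < (c - b) / N := div_pos (by linarith) hNr
  let τ : ℕ → ℝ := fun i => b + i * ((c - b) / N)
  have hτ : ∀ i, τ (i + 1) = τ i + (c - b) / N := fun i => by simp only [τ]; push_cast; ring
  have h0 : τ 0 = b := by simp [τ]
  have hNc : τ N = c := by simp only [τ]; field_simp; ring
  have key : ∀ k, ∃ π' : Partition a (τ k),
      (∀ i < π'.n, π'.point (i + 1) - π'.point i ≤ ε) ∧
      ∑ i ∈ Finset.range π'.n, Ξ (π'.point i) (π'.point (i + 1))
        = ∑ i ∈ Finset.range π.n, Ξ (π.point i) (π.point (i + 1))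
          + ∑ i ∈ Finset.range k, Ξ (τ i) (τ (i + 1)) := by
    intro k
    induction k with
    | zero => rw [h0]; exact ⟨π, hπ, by simp⟩
    | succ k ih =>
      obtain ⟨π', h1, h2⟩ := ih
      have hlt : τ k < τ (k + 1) := by rw [hτ]; linarith
      refine ⟨π'.snoc hlt, fun i hi => ?_, ?_⟩
      · simp only [Partition.snoc] at hi ⊢
        rcases Nat.lt_or_ge i π'.n with h | h
        · simpa [h.le, Nat.succ_le_of_lt h] using h1 i h
        · obtain rfl : i = π'.n := by omega
          simp [π'.point_last, hτ, hstep]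
      · rw [π'.sum_snoc hlt Ξ, h2, Finset.sum_range_succ, add_assoc]
  obtain ⟨π', h1, h2⟩ := hNc ▸ key N
  exact ⟨π', τ, N, by exact_mod_cast hNr, h0, hNc, fun i => by rw [hτ]; linarith, h1, h2⟩

theorem Partition.exists_fine {a b ε : ℝ} (hab : a ≤ b) (hε : 0 < ε) :
    ∃ π : Partition a b, ∀ i < π.n, π.point (i + 1) - π.point i ≤ ε := by
  rcases hab.eq_or_lt with rfl | hlt
  · exact ⟨⟨0, fun _ => a, rfl, rfl, by simp⟩, by simp⟩
  · let π₀ : Partition a a := ⟨0, fun _ => a, rfl, rfl, by simp⟩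
    obtain ⟨π, -, -, -, -, -, -, h, -⟩ := π₀.exists_extension hlt hε (by simp [π₀])
      (fun _ _ => (0 : ℝ))
    exact ⟨π, h⟩

variable {V : Type*} [NormedAddCommGroup V] {T : ℝ} {ω : ℝ → ℝ → ℝ}

/-- Riemann sums of a local approximation of order `θ > 1` converge. -/
theorem tendsto_riemann_sum (hω : RegularControl T ω) {θ K : ℝ} (hθ : 1 < θ) (hK : 0 ≤ K)
    {Ξ : ℝ → ℝ → V} {I : ℝ → V}
    (h : ∀ s t, 0 ≤ s → s ≤ t → t ≤ T → ‖I t - I s - Ξ s t‖ ≤ K * ω s t ^ θ)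
    {a b : ℝ} (ha : 0 ≤ a) (hb : b ≤ T) :
    Tendsto (fun π : Partition a b =>
      ∑ i ∈ Finset.range π.n, Ξ (π.point i) (π.point (i + 1))) (meshToZero a b)
      (𝓝 (I b - I a)) := by
  rw [Metric.tendsto_nhds]
  intro ε hε
  obtain ⟨η, hη, hη'⟩ := exists_pos_rpow_mul_le hθ (K * ω a b) (half_pos hε)
  obtain ⟨δ, hδ, hδ'⟩ := hω.small η hη
  filter_upwards [meshToZero_eventually a b hδ] with π hπ
  have hin : ∀ i < π.n, 0 ≤ π.point i ∧ π.point (i + 1) ≤ T := fun i hi =>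
    ⟨ha.trans (π.le_point hi.le), (π.point_le hi).trans hb⟩
  have h2 := hω.sum_rpow_le (η := η) hθ (τ := π.point) (N := π.n) (by rwa [π.point_zero])
    (fun i hi => (π.lt_succ i hi).le) (by rwa [π.point_last])
    (fun i hi => hδ' _ _ (hin i hi).1 (π.lt_succ i hi).le (hin i hi).2 (hπ i hi))
  rw [π.point_zero, π.point_last] at h2
  have e : I b - I a = ∑ i ∈ Finset.range π.n, (I (π.point (i + 1)) - I (π.point i)) := by
    rw [Finset.sum_range_sub (fun i => I (π.point i)), π.point_zero, π.point_last]
  rw [dist_comm, dist_eq_norm, e, ← Finset.sum_sub_distrib]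
  calc _ ≤ ∑ i ∈ Finset.range π.n, K * ω (π.point i) (π.point (i + 1)) ^ θ :=
        norm_sum_le_of_le _ fun i hi => by
          have hi := Finset.mem_range.1 hi
          exact h _ _ (hin i hi).1 (π.lt_succ i hi).le (hin i hi).2
    _ = K * ∑ i ∈ Finset.range π.n, ω (π.point i) (π.point (i + 1)) ^ θ := by rw [Finset.mul_sum]
    _ ≤ K * (η ^ (θ - 1) * ω a b) := mul_le_mul_of_nonneg_left h2 hK
    _ < ε := by linarith

/-- If the Riemann sums of a local approximation with small defect of additivity converge, the
limit is close to the local approximation. -/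
theorem norm_sub_le_of_tendsto_riemann_sum (hω : RegularControl T ω) {θ K : ℝ} (hθ : 1 < θ)
    (hK : 0 ≤ K) {Ξ : ℝ → ℝ → V} {I : ℝ → V} {s t : ℝ} (h0 : 0 ≤ s) (hst : s < t) (hT : t ≤ T)
    (hδ : ∀ a u b, s ≤ a → a ≤ u → u ≤ b → b ≤ t →
      ‖Ξ a b - Ξ a u - Ξ u b‖ ≤ K * ω a b ^ θ)
    (hs : Tendsto (fun π : Partition 0 s =>
      ∑ i ∈ Finset.range π.n, Ξ (π.point i) (π.point (i + 1))) (meshToZero 0 s) (𝓝 (I s)))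
    (ht : Tendsto (fun π : Partition 0 t =>
      ∑ i ∈ Finset.range π.n, Ξ (π.point i) (π.point (i + 1))) (meshToZero 0 t) (𝓝 (I t))) :
    ‖I t - I s - Ξ s t‖ ≤ sewingConst θ * K * ω s t ^ θ := by
  refine le_of_forall_pos_le_add fun ε hε => ?_
  obtain ⟨ε₁, hε₁, H₁⟩ := exists_of_meshToZero_eventually
    (Metric.tendsto_nhds.1 hs (ε / 2) (half_pos hε))
  obtain ⟨ε₂, hε₂, H₂⟩ := exists_of_meshToZero_eventually
    (Metric.tendsto_nhds.1 ht (ε / 2) (half_pos hε))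
  obtain ⟨π, hπ⟩ := Partition.exists_fine h0 (lt_min hε₁ hε₂)
  -- The sum over `π` is near `I s` and that over its extension near `I t`. The sum over `[s,t]` is
  -- thus near `I t - I s`, and `norm_sub_sum_le` compares it with `Ξ s t`.
  obtain ⟨π', τ, N, hN, hτ0, hτN, hτ, hπ', hsum⟩ := π.exists_extension hst (lt_min hε₁ hε₂) hπ Ξ
  have h1 := H₁ π fun i hi => (hπ i hi).trans (min_le_left _ _)
  have h2 := H₂ π' fun i hi => (hπ' i hi).trans (min_le_right _ _)
  have h3 := norm_sub_sum_le (E := Ξ) hω hθ hK (τ := τ) (N := N) (by rwa [hτ0])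
    (fun i _ => hτ i) (by rwa [hτN]) (by rw [hτ0, hτN]; exact hδ) hN
  rw [hτ0, hτN] at h3
  rw [hsum, dist_comm, dist_eq_norm] at h2
  rw [dist_eq_norm] at h1
  generalize ∑ i ∈ Finset.range π.n, Ξ (π.point i) (π.point (i + 1)) = S at *
  generalize ∑ i ∈ Finset.range N, Ξ (τ i) (τ (i + 1)) = S' at *
  have e : I t - I s - Ξ s t = (I t - (S + S')) + (S - I s) - (Ξ s t - S') := by abel
  rw [e]
  refine (norm_sub_le _ _).trans ?_
  have := norm_add_le (I t - (S + S')) (S - I s)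
  linarith

end Partitions

/-! ### Local expansions: existence and uniqueness -/

section Expansion

variable {d : ℕ} {V : Type*} [NormedAddCommGroup V] [NormedSpace ℝ V]

/-- The error in the local expansion of a path `Y` with drift `g` and diffusion field `f`. -/
noncomputable def expansionError (X : ℝ → EuclideanSpace ℝ (Fin d))
    (XX : ℝ → ℝ → EuclideanSpace ℝ (Fin d × Fin d))
    (f : ℝ × V → (EuclideanSpace ℝ (Fin d) →L[ℝ] V))
    (f' : ℝ × V → (ℝ × V →L[ℝ] (EuclideanSpace ℝ (Fin d) →L[ℝ] V)))
    (g : ℝ → V → V) (Y : ℝ → V) (s t : ℝ) : V :=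
  Y t - Y s - (∫ r in s..t, g r (Y r)) - localIncrement X XX f f' s t (Y s)

variable {T α C Cb : ℝ} {ω : ℝ → ℝ → ℝ} {X : ℝ → EuclideanSpace ℝ (Fin d)}
  {XX : ℝ → ℝ → EuclideanSpace ℝ (Fin d × Fin d)}
  {f : ℝ × V → (EuclideanSpace ℝ (Fin d) →L[ℝ] V)}
  {f' : ℝ × V → (ℝ × V →L[ℝ] (EuclideanSpace ℝ (Fin d) →L[ℝ] V))} {g : ℝ → V → V}

theorem norm_localIncrement_le (hf : C3Bounds (Icc 0 T ×ˢ univ) C f f')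
    (hω : RoughBounds T α ω X XX) {s t : ℝ} (h0 : 0 ≤ s) (hst : s ≤ t) (hT : t ≤ T) (x : V) :
    ‖localIncrement X XX f f' s t x‖
      ≤ C * ω s t ^ α + (d : ℝ) ^ 2 * C ^ 2 * (ω s t ^ α) ^ 2 := by
  have hC := hf.one_le
  have hz : (s, x) ∈ Icc 0 T ×ˢ (univ : Set V) := ⟨⟨h0, by dsimp; linarith⟩, mem_univ _⟩
  refine (norm_add_le _ _).trans (add_le_add ?_ ?_)
  · exact (ContinuousLinearMap.le_opNorm _ _).trans (mul_le_mul (hf.norm_le _ hz)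
      (hω.path s t h0 hst hT) (norm_nonneg _) (by linarith))
  · refine (norm_tensorApply_le _ _).trans ?_
    gcongr
    · exact hf.norm_fieldDeriv_le hz
    · exact hω.enhancement s t h0 hst hT

variable [MeasurableSpace V]

/-- The path increments and the drift integral along the path are additive, so only the local
increments contribute. -/
theorem expansionError_defect (hg : DriftBounds T Cb g) {Y : ℝ → V}
    (hY : AEMeasurable Y (volume.restrict (Icc 0 T))) {s u t : ℝ} (h0 : 0 ≤ s) (hsu : s ≤ u)
    (hut : u ≤ t) (hT : t ≤ T) :
    expansionError X XX f f' g Y s t - expansionError X XX f f' g Y s u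
      - expansionError X XX f f' g Y u t
      = -(localIncrement X XX f f' s t (Y s) - localIncrement X XX f f' s u (Y s)
        - localIncrement X XX f f' u t (Y u)) := by
  have := intervalIntegral.integral_add_adjacent_intervals
    (hg.intervalIntegrable hY h0 hsu (hut.trans hT))
    (hg.intervalIntegrable hY (h0.trans hsu) hut hT)
  simp only [expansionError, ← this]
  abel

/-- Existence of a continuous path with a local expansion of order `3α > 1`. -/
theorem exists_expansion [BorelSpace V] [ProperSpace V] {p : ℝ} (hTpos : 0 < T)
    (hf : C3Bounds (Icc 0 T ×ˢ univ) C f f') (hX : IsRoughPath p T X XX)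
    (hω : RoughBounds T α ω X XX) (hg : DriftBounds T Cb g) (hCb : 0 ≤ Cb) (y : V) :
    ∃ (Y : ℝ → V) (K : ℝ), Y 0 = y ∧ ContinuousOn Y (Icc 0 T) ∧ 0 ≤ K ∧
      ∀ s t, 0 ≤ s → s ≤ t → t ≤ T →
        ‖expansionError X XX f f' g Y s t‖ ≤ K * (ω s t ^ α) ^ 3 := by
  have hC := hf.one_le
  have hrem : 0 ≤ remainderConst d C Cb := by unfold remainderConst; positivity
  obtain ⟨Y, K, δ, hY0, hK, hδ0, hδ1, hKδ, hY⟩ := exists_local_solution hTpos hf hX hω hg hCb y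
  have hρ : ∀ s t, 0 ≤ s → s ≤ t → t ≤ T → 0 ≤ ω s t ^ α := fun s t h0 hst hT =>
    Real.rpow_nonneg (hω.control.nonneg s t h0 hst hT) _
  set M := C + remainderConst d C Cb
  have hM : 0 ≤ M := by positivity
  have hYM : ∀ s t, 0 ≤ s → s ≤ t → t ≤ T → ω s t ^ α ≤ δ → ‖Y t - Y s‖ ≤ M * ω s t ^ α := by
    intro s t h0 hst hT hr
    have h1 := norm_remainder_le_of_stepError hf hω hg hCb h0 hst hT le_rfl hK
      ((mul_le_mul_of_nonneg_left hr hK).trans hKδ) (hY s t h0 hst hT hr)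
    exact (norm_add_le_of_remainder hf ⟨⟨h0, by dsimp; linarith⟩, mem_univ _⟩
      (hρ s t h0 hst hT) (hr.trans hδ1) hrem hst (hω.time s t h0 hst hT)
      (hω.path s t h0 hst hT) h1).1
  have hcont : ContinuousOn Y (Icc 0 T) := by
    rw [Metric.continuousOn_iff]
    intro a ha ε hε
    obtain ⟨η, hη, H⟩ := hω.rho_small (lt_min hδ0 (by positivity : 0 < ε / (2 * (M + 1))))
    refine ⟨η, hη, fun c hc hca => ?_⟩
    rw [Real.dist_eq] at hca
    have main : ∀ s t, 0 ≤ s → s ≤ t → t ≤ T → t - s ≤ η → ‖Y t - Y s‖ < ε := by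
      intro s t h0 hst hT hle
      have hr := H s t h0 hst hT hle
      refine lt_of_le_of_lt (hYM s t h0 hst hT (hr.trans (min_le_left _ _))) ?_
      calc M * ω s t ^ α ≤ (M + 1) * (ε / (2 * (M + 1))) :=
            mul_le_mul (by linarith) (hr.trans (min_le_right _ _)) (hρ s t h0 hst hT)
              (by linarith)
        _ = ε / 2 := by field_simp
        _ < ε := by linarith
    rcases le_total a c with h | h
    · rw [dist_eq_norm]
      rw [abs_of_nonneg (by linarith)] at hca
      exact main a c ha.1 h hc.2 hca.le
    · rw [dist_comm, dist_eq_norm]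
      rw [abs_of_nonpos (by linarith)] at hca
      exact main c a hc.1 h ha.2 (by linarith)
  have hYm := hcont.aemeasurable (μ := volume) measurableSet_Icc
  -- Replacing the frozen drift by the drift along the path costs `Cb` times the displacement `M ρ`
  -- times the time `ρ²`.
  have hloc : ∀ s t, 0 ≤ s → s ≤ t → t ≤ T → ω s t ^ α ≤ δ →
      ‖expansionError X XX f f' g Y s t‖ ≤ (K + Cb * M) * (ω s t ^ α) ^ 3 := by
    intro s t h0 hst hT hr
    have e : expansionError X XX f f' g Y s t = stepError X XX f f' g s t (Y s) (Y t)
        + ((∫ r in s..t, g r (Y s)) - ∫ r in s..t, g r (Y r)) := by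
      simp only [expansionError, stepError]; abel
    have h1 : ‖(∫ r in s..t, g r (Y s)) - ∫ r in s..t, g r (Y r)‖
        ≤ Cb * (M * ω s t ^ α) * (t - s) :=
      hg.norm_integral_sub_le (Y := fun _ => Y s) hCb aemeasurable_const hYm h0 hst hT
        fun r hr' => by
          rw [norm_sub_rev]
          have h2 := hω.rho_mono h0 le_rfl hr'.1 hr'.2 hT
          exact (hYM s r h0 hr'.1 (hr'.2.trans hT) (h2.trans hr)).trans (by gcongr)
    have h2 := h1.trans (mul_le_mul_of_nonneg_left (hω.time s t h0 hst hT)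
      (mul_nonneg hCb (mul_nonneg hM (hρ s t h0 hst hT))))
    rw [e]
    refine (norm_add_le _ _).trans ((add_le_add (hY s t h0 hst hT hr) h2).trans (le_of_eq ?_))
    ring
  obtain ⟨B, hB⟩ := isCompact_Icc.exists_bound_of_continuousOn hcont
  have hB0 : 0 ≤ B := (norm_nonneg _).trans (hB 0 ⟨le_rfl, hTpos.le⟩)
  -- A crude bound for intervals with `ρ > δ`, where `1 ≤ ρ³ / δ³` turns it into a third-order one.
  set D := B + B + Cb * T + (C * ω 0 T ^ α + (d : ℝ) ^ 2 * C ^ 2 * (ω 0 T ^ α) ^ 2)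
  have hρT := hρ 0 T le_rfl hTpos.le le_rfl
  have hD : 0 ≤ D := by positivity
  refine ⟨Y, K + Cb * M + D / δ ^ 3, hY0, hcont, by positivity, fun s t h0 hst hT => ?_⟩
  have hr0 := hρ s t h0 hst hT
  rcases le_or_gt (ω s t ^ α) δ with hr | hr
  · refine (hloc s t h0 hst hT hr).trans ?_
    have : 0 ≤ D / δ ^ 3 := by positivity
    exact mul_le_mul_of_nonneg_right (by linarith) (by positivity)
  · have h1 : ‖expansionError X XX f f' g Y s t‖ ≤ D := by
      have a1 := hB s ⟨h0, hst.trans hT⟩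
      have a2 := hB t ⟨h0.trans hst, hT⟩
      have a3 := (hg.norm_integral_le Y h0 hst hT).trans
        (mul_le_mul_of_nonneg_left (by linarith : t - s ≤ T) hCb)
      have hm := hω.rho_mono le_rfl h0 hst hT le_rfl
      have a4 := (norm_localIncrement_le hf hω h0 hst hT (Y s)).trans
        (by gcongr : _ ≤ C * ω 0 T ^ α + (d : ℝ) ^ 2 * C ^ 2 * (ω 0 T ^ α) ^ 2)
      have b1 := norm_sub_le (Y t - Y s - ∫ r in s..t, g r (Y r))
        (localIncrement X XX f f' s t (Y s))
      have b2 := norm_sub_le (Y t - Y s) (∫ r in s..t, g r (Y r))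
      have b3 := norm_sub_le (Y t) (Y s)
      simp only [expansionError]
      linarith
    have h2 : D ≤ D / δ ^ 3 * (ω s t ^ α) ^ 3 := by
      rw [div_mul_eq_mul_div, le_div_iff₀ (by positivity)]
      gcongr
    have h3 : 0 ≤ (K + Cb * M) * (ω s t ^ α) ^ 3 := by positivity
    rw [add_mul]
    linarith

/-- Two paths with local expansions and the same initial value agree. -/
theorem eqOn_of_expansion {p : ℝ} (hf : C3Bounds (Icc 0 T ×ˢ univ) C f f') (hX : IsRoughPath p T X XX)
    (hω : RoughBounds T α ω X XX) (hg : DriftBounds T Cb g) (hCb : 0 ≤ Cb) {Y Z : ℝ → V}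
    (hYm : AEMeasurable Y (volume.restrict (Icc 0 T)))
    (hZm : AEMeasurable Z (volume.restrict (Icc 0 T))) {K₀ : ℝ} (hK₀ : 0 ≤ K₀)
    (hRY : ∀ s t, 0 ≤ s → s ≤ t → t ≤ T →
      ‖Y t - Y s - f (s, Y s) (X t - X s)‖ ≤ (ω s t ^ α) ^ 2)
    (hRZ : ∀ s t, 0 ≤ s → s ≤ t → t ≤ T →
      ‖Z t - Z s - f (s, Z s) (X t - X s)‖ ≤ (ω s t ^ α) ^ 2)
    (hEY : ∀ s t, 0 ≤ s → s ≤ t → t ≤ T → ω s t ^ α ≤ 1 →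
      ‖expansionError X XX f f' g Y s t‖ ≤ K₀ * (ω s t ^ α) ^ 3)
    (hEZ : ∀ s t, 0 ≤ s → s ≤ t → t ≤ T → ω s t ^ α ≤ 1 →
      ‖expansionError X XX f f' g Z s t‖ ≤ K₀ * (ω s t ^ α) ^ 3)
    (h0 : Y 0 = Z 0) : EqOn Y Z (Icc 0 T) := by
  have hC := hf.one_le
  have hsc := sewingConst_pos hω.exponent
  have hρ : ∀ s t, 0 ≤ s → s ≤ t → t ≤ T → 0 ≤ ω s t ^ α := fun s t h0 hst hT =>
    Real.rpow_nonneg (hω.control.nonneg s t h0 hst hT) _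
  -- The three summands bound the difference of the remainders: drift, Gubinelli derivative
  -- contracted with `𝕏`, and expansion error.
  set M := Cb + 2 * (d : ℝ) ^ 2 * C ^ 2 + 1 with hM
  have hM0 : 0 ≤ M := by positivity
  have hK3 : 0 ≤ defectDiffConst d C M := by unfold defectDiffConst; positivity
  -- The factor `2` makes the sewing bound on `E` at most `L / 2 * lam * ρ³`. The interval size `δ`
  -- is then chosen so that `lam * δ ≤ 1` and `(Cb + 1) * δ ≤ 1 / 2`.
  set lam := 2 * (sewingConst (3 * α) * defectDiffConst d C M) + 1 with hlam
  have hlam1 : 1 ≤ lam := by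
    have : 0 ≤ sewingConst (3 * α) * defectDiffConst d C M := by positivity
    linarith
  set δ := 1 / (2 * (Cb + 1) + lam) with hδ
  have hden : 0 < 2 * (Cb + 1) + lam := by positivity
  have hδ0 : 0 < δ := by positivity
  have hδ1 : δ ≤ 1 := by rw [hδ, div_le_one hden]; linarith
  have hδl : lam * δ ≤ 1 := by rw [hδ, mul_one_div, div_le_one hden]; linarith
  have hδb : (Cb + 1) * δ ≤ 1 / 2 := by
    rw [hδ, mul_one_div, div_le_iff₀ hden]; linarith
  let E : ℝ → ℝ → V := fun s t =>
    expansionError X XX f f' g Y s t - expansionError X XX f f' g Z s t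
  have local_eq : ∀ a b, 0 ≤ a → a ≤ b → b ≤ T → ω a b ^ α ≤ δ → Y a = Z a →
      ∀ t ∈ Icc a b, Y t = Z t := by
    intro a b ha hab hb hωδ hYZ
    have hsub : ∀ s t, a ≤ s → s ≤ t → t ≤ b → ω s t ^ α ≤ δ := fun s t h1 h2 h3 =>
      (hω.rho_mono ha h1 h2 h3 hb).trans hωδ
    -- The contraction: bounds on the distance of the paths and on the difference `E` of their
    -- expansion errors, both proportional to `L`, improve together by a factor of two.
    have hhalf : ∀ L : ℝ, 0 ≤ L → ((∀ t ∈ Icc a b, ‖Y t - Z t‖ ≤ L) ∧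
        ∀ s t, a ≤ s → s ≤ t → t ≤ b → ‖E s t‖ ≤ L * lam * (ω s t ^ α) ^ 3) →
        ((∀ t ∈ Icc a b, ‖Y t - Z t‖ ≤ L / 2) ∧
        ∀ s t, a ≤ s → s ≤ t → t ≤ b → ‖E s t‖ ≤ L / 2 * lam * (ω s t ^ α) ^ 3) := by
      rintro L hL ⟨hΔ, hE⟩
      have hI : ∀ s t, a ≤ s → s ≤ t → t ≤ b →
          ‖(∫ r in s..t, g r (Y r)) - ∫ r in s..t, g r (Z r)‖
            ≤ Cb * L * (ω s t ^ α) ^ 2 := fun s t h1 h2 h3 =>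
        (hg.norm_integral_sub_le hCb hYm hZm (ha.trans h1) h2 (h3.trans hb)
          fun r hr => hΔ r ⟨h1.trans hr.1, hr.2.trans h3⟩).trans
          (mul_le_mul_of_nonneg_left (hω.time s t (ha.trans h1) h2 (h3.trans hb))
            (by positivity))
      have hcube : ∀ s t, a ≤ s → s ≤ t → t ≤ b →
          L * lam * (ω s t ^ α) ^ 3 ≤ L * (ω s t ^ α) ^ 2 := by
        intro s t h1 h2 h3
        have hr0 := hρ s t (ha.trans h1) h2 (h3.trans hb)
        have hl : lam * ω s t ^ α ≤ 1 :=
          (mul_le_mul_of_nonneg_left (hsub s t h1 h2 h3) (by linarith)).trans hδl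
        calc L * lam * (ω s t ^ α) ^ 3 = L * (ω s t ^ α) ^ 2 * (lam * ω s t ^ α) := by ring
          _ ≤ L * (ω s t ^ α) ^ 2 * 1 := by gcongr
          _ = _ := mul_one _
      have hR : ∀ s t, a ≤ s → s ≤ t → t ≤ b →
          ‖(Y t - Y s - f (s, Y s) (X t - X s)) - (Z t - Z s - f (s, Z s) (X t - X s))‖
            ≤ M * L * (ω s t ^ α) ^ 2 := by
        intro s t h1 h2 h3
        have hzS : ∀ x : V, (s, x) ∈ Icc 0 T ×ˢ (univ : Set V) := fun x =>
          ⟨⟨ha.trans h1, by dsimp; linarith⟩, mem_univ _⟩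
        have e : (Y t - Y s - f (s, Y s) (X t - X s)) - (Z t - Z s - f (s, Z s) (X t - X s))
            = ((∫ r in s..t, g r (Y r)) - ∫ r in s..t, g r (Z r))
              + tensorApply (fieldDeriv f f' (s, Y s) - fieldDeriv f f' (s, Z s)) (XX s t)
              + E s t := by
          simp only [E, expansionError, localIncrement, tensorApply_sub]
          abel
        have ht : ‖tensorApply (fieldDeriv f f' (s, Y s) - fieldDeriv f f' (s, Z s)) (XX s t)‖
            ≤ (d : ℝ) ^ 2 * (2 * C ^ 2 * L) * (ω s t ^ α) ^ 2 := by
          refine (norm_tensorApply_le _ _).trans ?_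
          gcongr
          · refine (hf.norm_fieldDeriv_sub_le (hzS _) (hzS _)).trans ?_
            gcongr
            rw [Prod.mk_sub_mk, sub_self, Prod.norm_mk, norm_zero]
            exact max_le hL (hΔ s ⟨h1, h2.trans h3⟩)
          · exact hω.enhancement s t (ha.trans h1) h2 (h3.trans hb)
        rw [e]
        refine norm_add₃_le.trans ((add_le_add (add_le_add (hI s t h1 h2 h3) ht)
          ((hE s t h1 h2 h3).trans (hcube s t h1 h2 h3))).trans (le_of_eq ?_))
        rw [hM]; ring
      have hE' : ∀ s t, a ≤ s → s ≤ t → t ≤ b → ‖E s t‖ ≤ L / 2 * lam * (ω s t ^ α) ^ 3 := by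
        intro s t h1 h2 h3
        have hnn : ∀ s t, a ≤ s → s ≤ t → t ≤ b → 0 ≤ ω s t := fun s t h1 h2 h3 =>
          hω.control.nonneg s t (ha.trans h1) h2 (h3.trans hb)
        -- The assumed bound with constant `L * lam` only supplies the a priori order. The constant
        -- obtained comes from the defect of `E`, which is linear in `L` and independent of `lam`.
        have key := norm_le_of_defect_le hω.control (K := defectDiffConst d C M * L)
          (K₀ := L * lam) (E := E) hω.exponent (by positivity) (by positivity) ha hb
          (fun s t h1 h2 h3 => by
            rw [← rpow_pow_three (hnn s t h1 h2 h3)]; exact hE s t h1 h2 h3)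
          (fun s u t h1 h2 h3 h4 => by
            rw [← rpow_pow_three (hnn s t h1 (h2.trans h3) h4)]
            have e : E s t - E s u - E u t
                = -((localIncrement X XX f f' s t (Y s) - localIncrement X XX f f' s u (Y s)
                    - localIncrement X XX f f' u t (Y u))
                  - (localIncrement X XX f f' s t (Z s) - localIncrement X XX f f' s u (Z s)
                    - localIncrement X XX f f' u t (Z u))) := by
              have e1 := expansionError_defect (X := X) (XX := XX) (f := f) (f' := f') hg hYm
                (ha.trans h1) h2 h3 (h4.trans hb)
              have e2 := expansionError_defect (X := X) (XX := XX) (f := f) (f' := f') hg hZm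
                (ha.trans h1) h2 h3 (h4.trans hb)
              rw [neg_sub, ← neg_neg (localIncrement X XX f f' s t (Z s) - _ - _), ← e2,
                sub_eq_add_neg (-_), ← e1]
              simp only [E]
              abel
            rw [e, norm_neg]
            have s0 := ha.trans h1
            have tT := h4.trans hb
            have hru := hω.rho_mono s0 le_rfl h2 h3 tT
            have hrt := hω.rho_mono s0 h2 h3 le_rfl tT
            have hr0 := hρ s t s0 (h2.trans h3) tT
            have hu0 := hρ s u s0 h2 (h3.trans tT)
            have ht0 := hρ u t (s0.trans h2) h3 tT
            have hsq : (ω s u ^ α) ^ 2 ≤ (ω s t ^ α) ^ 2 := by gcongr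
            have hzS : ∀ x : V, (s, x) ∈ Icc 0 T ×ˢ (univ : Set V) := fun x =>
              ⟨⟨s0, by dsimp; linarith⟩, mem_univ _⟩
            have hwS : ∀ x : V, (u, x) ∈ Icc 0 T ×ˢ (univ : Set V) := fun x =>
              ⟨⟨by dsimp; linarith, by dsimp; linarith⟩, mem_univ _⟩
            exact norm_localIncrement_defect_sub_le hf hX s0 h2 h3 tT (hzS _) (hwS _) (hzS _)
              (hwS _) hr0 ((hsub s t h1 (h2.trans h3) h4).trans hδ1) hM0
              ((hω.time s u s0 h2 (h3.trans tT)).trans hsq)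
              ((hω.path s u s0 h2 (h3.trans tT)).trans hru)
              ((hω.path u t (s0.trans h2) h3 tT).trans hrt)
              ((hω.enhancement u t (s0.trans h2) h3 tT).trans (by gcongr))
              ((hRY s u s0 h2 (h3.trans tT)).trans hsq)
              ((hRZ s u s0 h2 (h3.trans tT)).trans hsq)
              (hΔ s ⟨h1, by linarith⟩) (hΔ u ⟨by linarith, by linarith⟩)
              ((hR s u h1 h2 (h3.trans h4)).trans (by gcongr)))
          h1 h2 h3
        rw [← rpow_pow_three (hnn s t h1 h2 h3)] at key
        refine key.trans ?_
        have hr0 := hρ s t (ha.trans h1) h2 (h3.trans hb)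
        refine mul_le_mul_of_nonneg_right ?_ (by positivity)
        rw [hlam]
        nlinarith
      refine ⟨fun t ht => ?_, hE'⟩
      have hr0 := hρ a t ha ht.1 (ht.2.trans hb)
      have hr := hsub a t le_rfl ht.1 ht.2
      have e : Y t - Z t = ((∫ r in a..t, g r (Y r)) - ∫ r in a..t, g r (Z r)) + E a t := by
        simp only [E, expansionError, hYZ]; abel
      rw [e]
      refine (norm_add_le _ _).trans ((add_le_add (hI a t le_rfl ht.1 ht.2)
        ((hE a t le_rfl ht.1 ht.2).trans (hcube a t le_rfl ht.1 ht.2))).trans ?_)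
      calc Cb * L * (ω a t ^ α) ^ 2 + L * (ω a t ^ α) ^ 2
          = L * ((Cb + 1) * (ω a t ^ α) ^ 2) := by ring
        _ ≤ L * ((Cb + 1) * δ) := by
          gcongr
          nlinarith
        _ ≤ L * (1 / 2) := by gcongr
        _ = L / 2 := by ring
    -- The iteration starts from a priori bounds: since `ρ ≤ 1`, each path moves by at most `C + 1 ≤
    -- 2 * C` from the common value at `a`, and the two expansion errors add up to `2 * K₀`.
    have hinit : (∀ t ∈ Icc a b, ‖Y t - Z t‖ ≤ 4 * C + 2 * K₀) ∧
        ∀ s t, a ≤ s → s ≤ t → t ≤ b → ‖E s t‖ ≤ (4 * C + 2 * K₀) * lam * (ω s t ^ α) ^ 3 := by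
      constructor
      · intro t ht
        have hr0 := hρ a t ha ht.1 (ht.2.trans hb)
        have hr := (hsub a t le_rfl ht.1 ht.2).trans hδ1
        have htT := ht.2.trans hb
        have hz : ∀ x : V, (a, x) ∈ Icc 0 T ×ˢ (univ : Set V) := fun x =>
          ⟨⟨ha, by dsimp; linarith⟩, mem_univ _⟩
        have h1 := (norm_add_le_of_remainder hf (hz _) hr0 hr zero_le_one ht.1
          (hω.time a t ha ht.1 htT) (hω.path a t ha ht.1 htT)
          (by rw [one_mul]; exact hRY a t ha ht.1 htT)).1
        have h2 := (norm_add_le_of_remainder hf (hz _) hr0 hr zero_le_one ht.1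
          (hω.time a t ha ht.1 htT) (hω.path a t ha ht.1 htT)
          (by rw [one_mul]; exact hRZ a t ha ht.1 htT)).1
        have e : Y t - Z t = (Y t - Y a) - (Z t - Z a) := by rw [hYZ]; abel
        rw [e]
        refine (norm_sub_le _ _).trans ?_
        have h3 : (C + 1) * ω a t ^ α ≤ C + 1 := mul_le_of_le_one_right (by linarith) hr
        linarith
      · intro s t h1 h2 h3
        have hr := (hsub s t h1 h2 h3).trans hδ1
        have hr0 := hρ s t (ha.trans h1) h2 (h3.trans hb)
        have a1 := hEY s t (ha.trans h1) h2 (h3.trans hb) hr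
        have a2 := hEZ s t (ha.trans h1) h2 (h3.trans hb) hr
        refine (norm_sub_le _ _).trans ((add_le_add a1 a2).trans ?_)
        rw [← add_mul]
        refine mul_le_mul_of_nonneg_right ?_ (by positivity)
        nlinarith
    have hall : ∀ k : ℕ, (∀ t ∈ Icc a b, ‖Y t - Z t‖ ≤ (4 * C + 2 * K₀) / 2 ^ k) ∧
        ∀ s t, a ≤ s → s ≤ t → t ≤ b →
          ‖E s t‖ ≤ (4 * C + 2 * K₀) / 2 ^ k * lam * (ω s t ^ α) ^ 3 := by
      intro k
      induction k with
      | zero => simpa using hinit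
      | succ k ih =>
        have := hhalf _ (by positivity) ih
        rwa [div_div, ← pow_succ] at this
    intro t ht
    have hlim : Tendsto (fun k : ℕ => (4 * C + 2 * K₀) / 2 ^ k) atTop (𝓝 0) := by
      have := (tendsto_pow_atTop_nhds_zero_of_lt_one (r := (1 / 2 : ℝ)) (by norm_num)
        (by norm_num)).const_mul (4 * C + 2 * K₀)
      simpa [div_eq_mul_inv] using this
    have : ‖Y t - Z t‖ ≤ 0 := ge_of_tendsto' hlim fun k => (hall k).1 t ht
    exact sub_eq_zero.1 (norm_le_zero_iff.1 this)
  -- Smallness of the control is uniform in time, so steps of one fixed length `η` propagate the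
  -- equality over `[0,T]`.
  obtain ⟨η, hη, H⟩ := hω.rho_small hδ0
  have hstep : ∀ k : ℕ, ∀ t ∈ Icc 0 T, t ≤ k * η → Y t = Z t := by
    intro k
    induction k with
    | zero =>
      intro t ht hle
      have : t = 0 := le_antisymm (by simpa using hle) ht.1
      rw [this, h0]
    | succ k ih =>
      intro t ht hle
      rcases le_or_gt t (k * η) with h | h
      · exact ih t ht h
      · have hk0 : 0 ≤ (k : ℝ) * η := by positivity
        refine local_eq (k * η) t hk0 h.le ht.2 (H _ _ hk0 h.le ht.2 ?_)
          (ih _ ⟨hk0, h.le.trans ht.2⟩ le_rfl) t ⟨h.le, le_rfl⟩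
        push_cast at hle
        linarith
  intro t ht
  obtain ⟨k, hk⟩ := exists_nat_gt (t / η)
  rw [div_lt_iff₀ hη] at hk
  exact hstep k t ht hk.le

end Expansion

/-! ### Choice of the control and `p`-variation regularity -/

theorem Dominated.exists_bound {T : ℝ} {g : ℝ → ℝ → ℝ} (h : Dominated T g) :
    ∃ M, ∀ s t, 0 ≤ s → s < t → t ≤ T → g s t ≤ M := by
  obtain ⟨W, hW⟩ := h
  refine ⟨W T - W 0, fun s t h0 hst hT => ?_⟩
  have h1 : W 0 ≤ W s := by
    rcases h0.eq_or_lt with rfl | h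
    · exact le_rfl
    · exact (hW 0 s le_rfl h (hst.le.trans hT)).1
  have h2 : W t ≤ W T := by
    rcases hT.eq_or_lt with rfl | h
    · exact le_rfl
    · exact (hW t T (h0.trans hst.le) h le_rfl).1
  linarith [(hW s t h0 hst hT).2]

theorem Dominated.rpow_of_le {T q q' : ℝ} (hq : 0 < q) (hqq' : q ≤ q') {f : ℝ → ℝ → ℝ}
    (hf : Dominated T fun s t => f s t ^ q)
    (hf0 : ∀ s t, 0 ≤ s → s < t → t ≤ T → 0 ≤ f s t) :
    Dominated T fun s t => f s t ^ q' := by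
  obtain ⟨M, hM⟩ := hf.exists_bound
  refine hf.rpow_exponent (M := |M| ^ (1 / q)) hq hqq' hf0 fun s t h0 hst hT => ?_
  have := Real.rpow_le_rpow (Real.rpow_nonneg (hf0 s t h0 hst hT) q)
    ((hM s t h0 hst hT).trans (le_abs_self M)) (by positivity : 0 ≤ 1 / q)
  rwa [← Real.rpow_mul (hf0 s t h0 hst hT), mul_one_div_cancel hq.ne', Real.rpow_one] at this

theorem le_rpow_one_div {x w q : ℝ} (hx : 0 ≤ x) (hq : 0 < q) (h : x ^ q ≤ w) :
    x ≤ w ^ (1 / q) := by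
  have := Real.rpow_le_rpow (Real.rpow_nonneg hx q) h (by positivity : 0 ≤ 1 / q)
  rwa [← Real.rpow_mul hx, mul_one_div_cancel hq.ne', Real.rpow_one] at this

theorem rpow_one_div_half {w q : ℝ} (hw : 0 ≤ w) : w ^ (1 / (q / 2)) = (w ^ (1 / q)) ^ 2 := by
  rw [← Real.rpow_natCast, ← Real.rpow_mul hw]
  congr 1
  rw [one_div_div]; push_cast; ring

theorem dominated_sub_rpow {T q : ℝ} (hq : 1 ≤ q) : Dominated T fun s t => (t - s) ^ q :=
  Dominated.rpow_of_le (f := fun s t => t - s) one_pos hq (by simpa using dominated_sub T)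
    fun _ _ _ hst _ => by linarith

/-- A control for a rough path and for two further maps of finite `p/2`-variation. -/
theorem IsRoughPath.exists_roughBounds {d : ℕ} {p T : ℝ} (hp : 2 ≤ p) (hp3 : p < 3)
    {X : ℝ → EuclideanSpace ℝ (Fin d)} {XX : ℝ → ℝ → EuclideanSpace ℝ (Fin d × Fin d)}
    (hX : IsRoughPath p T X XX) {F : Type*} [NormedAddCommGroup F] (A B : ℝ → ℝ → F)
    (hA : ContinuousOn (fun z : ℝ × ℝ => A z.1 z.2) (Icc 0 T ×ˢ Icc 0 T))
    (hA0 : ∀ s ∈ Icc 0 T, A s s = 0) (hAv : Dominated T fun s t => ‖A s t‖ ^ (p / 2))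
    (hB : ContinuousOn (fun z : ℝ × ℝ => B z.1 z.2) (Icc 0 T ×ˢ Icc 0 T))
    (hB0 : ∀ s ∈ Icc 0 T, B s s = 0) (hBv : Dominated T fun s t => ‖B s t‖ ^ (p / 2)) :
    ∃ ω, RoughBounds T (2 / (p + 3)) ω X XX ∧ ∀ s t, 0 ≤ s → s ≤ t → t ≤ T →
      ‖A s t‖ ≤ (ω s t ^ (2 / (p + 3))) ^ 2 ∧ ‖B s t‖ ≤ (ω s t ^ (2 / (p + 3))) ^ 2 := by
  -- The exponent `(p + 3) / 2` is the midpoint of `p` and `3`: above `p`, as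
  -- `exists_regularControl` requires, and below `3`, so that its inverse `α` exceeds `1/3`.
  -- Second-order objects use half of it, which exceeds `1` and thus also suits time.
  have e1 : (2 / (p + 3)) = 1 / ((p + 3) / 2) := by rw [one_div_div]
  obtain ⟨ω₁, h₁, H₁⟩ := exists_regularControl (A := fun s t => X t - X s) (q' := (p + 3) / 2)
    ((hX.continuousOn_path.comp continuousOn_snd fun z hz => hz.2).sub
      (hX.continuousOn_path.comp continuousOn_fst fun z hz => hz.1))
    (fun s _ => sub_self _) (by linarith : 0 < p) (by linarith)
    (dominated_of_variation_lt_top (by linarith) hX.variation_path_lt_top)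
  obtain ⟨ω₂, h₂, H₂⟩ := exists_regularControl (A := XX) (q' := (p + 3) / 2 / 2)
    hX.continuousOn_enhancement (fun s hs => hX.enhancement_self hs)
    (by linarith : 0 < p / 2) (by linarith)
    (dominated_of_variation_lt_top (by linarith) hX.variation_enhancement_lt_top)
  obtain ⟨ω₃, h₃, H₃⟩ := exists_regularControl (A := fun s t : ℝ => t - s) (T := T)
    (q' := (p + 3) / 2 / 2) (by fun_prop) (fun s _ => sub_self _) one_pos (by linarith)
    ((dominated_sub T).mono fun s t _ hst _ => by
      simp only [Real.rpow_one]
      exact (Real.norm_of_nonneg (by linarith)).le)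
  obtain ⟨ω₄, h₄, H₄⟩ := exists_regularControl (q' := (p + 3) / 2 / 2) hA hA0
    (by linarith : 0 < p / 2) (by linarith) hAv
  obtain ⟨ω₅, h₅, H₅⟩ := exists_regularControl (q' := (p + 3) / 2 / 2) hB hB0
    (by linarith : 0 < p / 2) (by linarith) hBv
  have hsq : ∀ {x w : ℝ}, 0 ≤ x → 0 ≤ w → x ^ ((p + 3) / 2 / 2) ≤ w →
      x ≤ (w ^ (2 / (p + 3))) ^ 2 := by
    intro x w hx hw h
    rw [e1, ← rpow_one_div_half hw]
    exact le_rpow_one_div hx (by linarith) h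
  refine ⟨fun s t => ω₁ s t + ω₂ s t + ω₃ s t + ω₄ s t + ω₅ s t,
    ⟨(((h₁.add h₂).add h₃).add h₄).add h₅, ?_, fun s t h0 hst hT => ?_, fun s t h0 hst hT => ?_,
      fun s t h0 hst hT => ?_⟩, fun s t h0 hst hT => ?_⟩
  · rw [← mul_div_assoc, lt_div_iff₀ (by linarith)]; linarith
  all_goals
    have n1 := h₁.nonneg s t h0 hst hT
    have n2 := h₂.nonneg s t h0 hst hT
    have n3 := h₃.nonneg s t h0 hst hT
    have n4 := h₄.nonneg s t h0 hst hT
    have n5 := h₅.nonneg s t h0 hst hT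
  · rw [e1]
    exact le_rpow_one_div (norm_nonneg _) (by linarith) ((H₁ s t h0 hst hT).trans (by linarith))
  · exact hsq (norm_nonneg _) (by linarith) ((H₂ s t h0 hst hT).trans (by linarith))
  · refine (le_abs_self _).trans ?_
    exact hsq (abs_nonneg _) (by linarith) ((H₃ s t h0 hst hT).trans (by linarith))
  · exact ⟨hsq (norm_nonneg _) (by linarith) ((H₄ s t h0 hst hT).trans (by linarith)),
      hsq (norm_nonneg _) (by linarith) ((H₅ s t h0 hst hT).trans (by linarith))⟩

theorem dominated_comp {V : Type*} [NormedAddCommGroup V] {p T : ℝ} {Y : ℝ → V}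
    (hp : 2 ≤ p) {F : Type*} [NormedAddCommGroup F] {L : ℝ} (hL : 0 ≤ L)
    {G : ℝ → F} (hG : ∀ s ∈ Icc 0 T, ∀ t ∈ Icc 0 T,
      ‖G t - G s‖ ≤ L * ‖((t, Y t) - (s, Y s) : ℝ × V)‖)
    (hY : Dominated T fun s t => ‖((t, Y t) - (s, Y s) : ℝ × V)‖ ^ p) :
    Dominated T fun s t => ‖G t - G s‖ ^ p :=
  (hY.rpow_const_mul hL fun _ _ _ _ _ => norm_nonneg _).mono fun s t h0 hst hT =>
    Real.rpow_le_rpow (norm_nonneg _)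
      (hG s ⟨h0, hst.le.trans hT⟩ t ⟨h0.trans hst.le, hT⟩) (by linarith)

theorem continuousOn_comp_of_lipschitz {V : Type*} [NormedAddCommGroup V] {T : ℝ}
    {Y : ℝ → V} {F : Type*} [NormedAddCommGroup F] {L : ℝ}
    {G : ℝ → F} (hG : ∀ s ∈ Icc 0 T, ∀ t ∈ Icc 0 T,
      ‖G t - G s‖ ≤ L * ‖((t, Y t) - (s, Y s) : ℝ × V)‖) (hY : ContinuousOn Y (Icc 0 T)) :
    ContinuousOn G (Icc 0 T) := by
  intro s hs
  have hc : ContinuousWithinAt (fun t => ((t, Y t) : ℝ × V)) (Icc 0 T) s :=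
    continuousWithinAt_id.prodMk (hY s hs)
  rw [ContinuousWithinAt, tendsto_iff_norm_sub_tendsto_zero] at hc ⊢
  refine squeeze_zero' (Eventually.of_forall fun _ => norm_nonneg _)
    (eventually_mem_nhdsWithin.mono fun t ht => hG s hs t ht) ?_
  simpa using hc.const_mul L

section Regularity

variable {d : ℕ} {V : Type*} [NormedAddCommGroup V] [NormedSpace ℝ V]
  {p T α C Cb : ℝ} {ω : ℝ → ℝ → ℝ} {X : ℝ → EuclideanSpace ℝ (Fin d)}
  {XX : ℝ → ℝ → EuclideanSpace ℝ (Fin d × Fin d)}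
  {f : ℝ × V → (EuclideanSpace ℝ (Fin d) →L[ℝ] V)}
  {f' : ℝ × V → (ℝ × V →L[ℝ] (EuclideanSpace ℝ (Fin d) →L[ℝ] V))} {g : ℝ → V → V} {Y : ℝ → V}

theorem expansionError_eq [MeasurableSpace V] (hg : DriftBounds T Cb g)
    (hY : AEMeasurable Y (volume.restrict (Icc 0 T))) (y : V) {s t : ℝ} (h0 : 0 ≤ s)
    (hst : s ≤ t) (hT : t ≤ T) :
    expansionError X XX f f' g Y s t
      = (Y t - y - ∫ r in (0 : ℝ)..t, g r (Y r)) - (Y s - y - ∫ r in (0 : ℝ)..s, g r (Y r))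
        - localIncrement X XX f f' s t (Y s) := by
  simp only [expansionError, ← hg.integral_sub_integral hY h0 hst hT]
  abel

/-- The control belongs to an exponent larger than `p`, so bounds by its powers alone would lose
variation. Instead the remainder is written as a bounded tensor applied to `𝕏`, a drift integral and
a third-order error; each has finite `p/2`-variation, the last because `1 ≤ 3 * α * (p / 2)`. -/
theorem dominated_remainder [MeasurableSpace V] (hp : 2 ≤ p) (hαp : 1 ≤ 3 * α * (p / 2))
    (hf : C3Bounds (Icc 0 T ×ˢ univ) C f f')
    (hX : IsRoughPath p T X XX) (hω : RoughBounds T α ω X XX) (hg : DriftBounds T Cb g)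
    (hCb : 0 ≤ Cb) {K : ℝ} (hK : 0 ≤ K)
    (hE : ∀ s t, 0 ≤ s → s ≤ t → t ≤ T →
      ‖expansionError X XX f f' g Y s t‖ ≤ K * (ω s t ^ α) ^ 3) :
    Dominated T fun s t => ‖Y t - Y s - f (s, Y s) (X t - X s)‖ ^ (p / 2) := by
  have hq : 0 < p / 2 := by linarith
  have hnn : ∀ s t, 0 ≤ s → s < t → t ≤ T → 0 ≤ ω s t := fun s t h0 hst hT =>
    hω.control.nonneg s t h0 hst.le hT
  have d1 : Dominated T fun s t => ((d : ℝ) ^ 2 * C ^ 2 * ‖XX s t‖) ^ (p / 2) :=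
    (dominated_of_variation_lt_top hq hX.variation_enhancement_lt_top).rpow_const_mul
      (by positivity) fun _ _ _ _ _ => norm_nonneg _
  have d2 : Dominated T fun s t => (Cb * (t - s)) ^ (p / 2) :=
    (dominated_sub_rpow (by linarith)).rpow_const_mul hCb fun _ _ _ hst _ => by linarith
  have d3 : Dominated T fun s t => (K * (ω s t ^ α) ^ 3) ^ (p / 2) := by
    refine Dominated.rpow_const_mul hK ?_ fun s t h0 hst hT => by
      have := Real.rpow_nonneg (hnn s t h0 hst hT) α
      positivity
    refine (Dominated.rpow_of_le (f := ω) one_pos hαp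
      (by simpa using hω.control.dominated) hnn).mono fun s t h0 hst hT => ?_
    rw [rpow_pow_three (hnn s t h0 hst hT), ← Real.rpow_mul (hnn s t h0 hst hT)]
  have n3 : ∀ s t, 0 ≤ s → s < t → t ≤ T → 0 ≤ K * (ω s t ^ α) ^ 3 := fun s t h0 hst hT => by
    have := Real.rpow_nonneg (hnn s t h0 hst hT) α
    positivity
  have n2 : ∀ s t, 0 ≤ s → s < t → t ≤ T → 0 ≤ Cb * (t - s) := fun s t h0 hst hT =>
    mul_nonneg hCb (by linarith)
  have d23 := Dominated.rpow_of_le_add (h := fun s t => |Cb * (t - s) + K * (ω s t ^ α) ^ 3|)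
    hq d2 d3 n2 n3 (fun _ _ => abs_nonneg _) (fun s t h0 hst hT =>
      (abs_of_nonneg (add_nonneg (n2 s t h0 hst hT) (n3 s t h0 hst hT))).le)
  refine Dominated.rpow_of_le_add hq d1 d23 (fun _ _ _ _ _ => by positivity)
    (fun _ _ _ _ _ => abs_nonneg _) (fun _ _ => norm_nonneg _) fun s t h0 hst hT => ?_
  have hz : (s, Y s) ∈ Icc 0 T ×ˢ (univ : Set V) := ⟨⟨h0, by dsimp; linarith⟩, mem_univ _⟩
  have e : Y t - Y s - f (s, Y s) (X t - X s) = tensorApply (fieldDeriv f f' (s, Y s)) (XX s t)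
      + ((∫ r in s..t, g r (Y r)) + expansionError X XX f f' g Y s t) := by
    simp only [expansionError, localIncrement]; abel
  rw [e]
  refine (norm_add_le _ _).trans (add_le_add ?_ ?_)
  · refine (norm_tensorApply_le _ _).trans ?_
    gcongr
    exact hf.norm_fieldDeriv_le hz
  · exact (norm_add_le _ _).trans ((add_le_add (hg.norm_integral_le Y h0 hst.le hT)
      (hE s t h0 hst.le hT)).trans (le_abs_self _))

/-- The pair of time and path is treated at once, so that every function Lipschitz in `(t, Y_t)`
inherits finite `p`-variation. -/
theorem dominated_path (hp : 2 ≤ p) (hf : C3Bounds (Icc 0 T ×ˢ univ) C f f')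
    (hX : IsRoughPath p T X XX)
    (hR : Dominated T fun s t => ‖Y t - Y s - f (s, Y s) (X t - X s)‖ ^ (p / 2)) :
    Dominated T fun s t => ‖((t, Y t) - (s, Y s) : ℝ × V)‖ ^ p := by
  have hp0 : 0 < p := by linarith
  have hC := hf.one_le
  have d1 : Dominated T fun s t => (C * ‖X t - X s‖) ^ p :=
    (dominated_of_variation_lt_top hp0 hX.variation_path_lt_top).rpow_const_mul
      (by linarith) fun _ _ _ _ _ => norm_nonneg _
  have d2 := hR.rpow_of_le (by linarith) (by linarith : p / 2 ≤ p) fun _ _ _ _ _ => norm_nonneg _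
  have d3 : Dominated T fun s t => ‖Y t - Y s‖ ^ p := by
    refine Dominated.rpow_of_le_add hp0 d1 d2 (fun _ _ _ _ _ => by positivity)
      (fun _ _ _ _ _ => norm_nonneg _) (fun _ _ => norm_nonneg _) fun s t h0 hst hT => ?_
    have e : Y t - Y s = f (s, Y s) (X t - X s) + (Y t - Y s - f (s, Y s) (X t - X s)) := by abel
    rw [e]
    refine (norm_add_le _ _).trans (add_le_add ?_ (by rw [← e]))
    exact (ContinuousLinearMap.le_opNorm _ _).trans (mul_le_mul_of_nonneg_right
      (hf.norm_le _ ⟨⟨h0, by dsimp; linarith⟩, mem_univ _⟩) (norm_nonneg _))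
  refine Dominated.rpow_of_le_add hp0 (dominated_sub_rpow (by linarith)) d3
    (fun _ _ _ hst _ => by linarith) (fun _ _ _ _ _ => norm_nonneg _)
    (fun _ _ => norm_nonneg _) fun s t h0 hst hT => ?_
  rw [Prod.mk_sub_mk, Prod.norm_mk, Real.norm_of_nonneg (by linarith)]
  exact max_le (le_add_of_nonneg_right (norm_nonneg _)) (le_add_of_nonneg_left (by linarith))

/-- In `C3Bounds.norm_remainder_le` the quadratic term has finite `p/2`-variation because the
displacement has finite `p`-variation; the rest is time and the remainder of `Y`. -/
theorem dominated_remainder_comp (hp : 2 ≤ p) (hf : C3Bounds (Icc 0 T ×ˢ univ) C f f')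
    (hR : Dominated T fun s t => ‖Y t - Y s - f (s, Y s) (X t - X s)‖ ^ (p / 2))
    (hY : Dominated T fun s t => ‖((t, Y t) - (s, Y s) : ℝ × V)‖ ^ p) :
    Dominated T fun s t =>
      ‖f (t, Y t) - f (s, Y s) - fieldDeriv f f' (s, Y s) (X t - X s)‖ ^ (p / 2) := by
  have hq : 0 < p / 2 := by linarith
  have hC := hf.one_le
  have d1 : Dominated T fun s t => (C * ‖((t, Y t) - (s, Y s) : ℝ × V)‖ ^ 2) ^ (p / 2) := by
    refine Dominated.rpow_const_mul (by linarith) (hY.mono fun s t _ _ _ => le_of_eq ?_)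
      fun _ _ _ _ _ => by positivity
    rw [← Real.rpow_natCast, ← Real.rpow_mul (norm_nonneg _)]
    congr 1; push_cast; ring
  have d2 : Dominated T fun s t => |(t - s) + ‖Y t - Y s - f (s, Y s) (X t - X s)‖| ^ (p / 2) :=
    Dominated.rpow_of_le_add hq (dominated_sub_rpow (by linarith)) hR
      (fun _ _ _ hst _ => by linarith) (fun _ _ _ _ _ => norm_nonneg _)
      (fun _ _ => abs_nonneg _) fun s t _ hst _ =>
        (abs_of_nonneg (add_nonneg (by linarith) (norm_nonneg _))).le
  refine Dominated.rpow_of_le_add hq d1 (d2.rpow_const_mul (c := C) (by linarith)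
    fun _ _ _ _ _ => abs_nonneg _) (fun _ _ _ _ _ => by positivity)
    (fun _ _ _ _ _ => by positivity) (fun _ _ => norm_nonneg _) fun s t h0 hst hT => ?_
  refine (hf.norm_remainder_le ⟨⟨h0, by dsimp; linarith⟩, mem_univ _⟩
    ⟨⟨by dsimp; linarith, hT⟩, mem_univ _⟩ _).trans (add_le_add le_rfl ?_)
  rw [abs_of_nonneg (by linarith : 0 ≤ t - s)]
  gcongr
  exact le_abs_self _

theorem norm_field_sub_le (hf : C3Bounds (Icc 0 T ×ˢ univ) C f f') :
    ∀ s ∈ Icc 0 T, ∀ t ∈ Icc 0 T,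
      ‖f (t, Y t) - f (s, Y s)‖ ≤ C * ‖((t, Y t) - (s, Y s) : ℝ × V)‖ := fun _ hs _ ht =>
  hf.lipschitz _ ⟨ht, mem_univ _⟩ _ ⟨hs, mem_univ _⟩

theorem isControlled_of_dominated (hp : 2 ≤ p) (hf : C3Bounds (Icc 0 T ×ˢ univ) C f f')
    (hX : IsRoughPath p T X XX) (hYc : ContinuousOn Y (Icc 0 T))
    (hR : Dominated T fun s t => ‖Y t - Y s - f (s, Y s) (X t - X s)‖ ^ (p / 2)) :
    IsControlled p T X Y fun t => f (t, Y t) := by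
  have hC := hf.one_le
  have hY := dominated_path hp hf hX hR
  have hYY : ∀ s ∈ Icc 0 T, ∀ t ∈ Icc 0 T,
      ‖Y t - Y s‖ ≤ 1 * ‖((t, Y t) - (s, Y s) : ℝ × V)‖ := fun s _ t _ => by
    rw [one_mul]
    exact norm_snd_le ((t, Y t) - (s, Y s) : ℝ × V)
  exact ⟨⟨hYc, variation_lt_top_of_dominated (by linarith)
      (dominated_comp hp zero_le_one hYY hY)⟩,
    ⟨continuousOn_comp_of_lipschitz (norm_field_sub_le hf) hYc,
      variation_lt_top_of_dominated (by linarith)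
        (dominated_comp hp (by linarith) (norm_field_sub_le hf) hY)⟩,
    variation_lt_top_of_dominated (by linarith) hR⟩

theorem isControlled_field_of_dominated (hp : 2 ≤ p) (hf : C3Bounds (Icc 0 T ×ˢ univ) C f f')
    (hX : IsRoughPath p T X XX) (hYc : ContinuousOn Y (Icc 0 T))
    (hR : Dominated T fun s t => ‖Y t - Y s - f (s, Y s) (X t - X s)‖ ^ (p / 2))
    {G : ℝ → EuclideanSpace ℝ (Fin d) →L[ℝ] EuclideanSpace ℝ (Fin d) →L[ℝ] V}
    (hG : ∀ t ∈ Icc 0 T, G t = fieldDeriv f f' (t, Y t)) :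
    IsControlled p T X (fun t => f (t, Y t)) G := by
  have hC := hf.one_le
  have hY := dominated_path hp hf hX hR
  have hlip : ∀ s ∈ Icc 0 T, ∀ t ∈ Icc 0 T,
      ‖G t - G s‖ ≤ 2 * C ^ 2 * ‖((t, Y t) - (s, Y s) : ℝ × V)‖ := by
    intro s hs t ht
    rw [hG s hs, hG t ht]
    exact hf.norm_fieldDeriv_sub_le ⟨ht, mem_univ _⟩ ⟨hs, mem_univ _⟩
  refine ⟨(isControlled_of_dominated hp hf hX hYc hR).deriv,
    ⟨continuousOn_comp_of_lipschitz hlip hYc, variation_lt_top_of_dominated (by linarith)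
      (dominated_comp hp (by positivity) hlip hY)⟩,
    variation_lt_top_of_dominated (by linarith)
      ((dominated_remainder_comp hp hf hR hY).mono fun s t h0 hst hT => ?_)⟩
  simp only [remainder]
  rw [hG s ⟨h0, hst.le.trans hT⟩]

end Regularity

/-! ### Solutions of the RDE -/

section Solution

variable {n m d : ℕ} {p T C Cb : ℝ} {y : EuclideanSpace ℝ (Fin n)}
  {U : Set (EuclideanSpace ℝ (Fin m))} {u : ℝ → EuclideanSpace ℝ (Fin m)}
  {b : ℝ → EuclideanSpace ℝ (Fin n) → EuclideanSpace ℝ (Fin m) → EuclideanSpace ℝ (Fin n)}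
  {σ : ℝ → EuclideanSpace ℝ (Fin n) → (EuclideanSpace ℝ (Fin d) →L[ℝ] EuclideanSpace ℝ (Fin n))}
  {X : ℝ → EuclideanSpace ℝ (Fin d)} {XX : ℝ → ℝ → EuclideanSpace ℝ (Fin d × Fin d)}
  {f' : ℝ × EuclideanSpace ℝ (Fin n) → (ℝ × EuclideanSpace ℝ (Fin n) →L[ℝ]
    (EuclideanSpace ℝ (Fin d) →L[ℝ] EuclideanSpace ℝ (Fin n)))}
  {Y : ℝ → EuclideanSpace ℝ (Fin n)}
  {Y' : ℝ → EuclideanSpace ℝ (Fin d) →L[ℝ] EuclideanSpace ℝ (Fin n)}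

/-- At the endpoints of `[0,T]` the space-time derivative is one-sided in time. The whole slice at
time `t` lies in the domain, though, so its restriction to space is the full derivative of `σ t`. -/
theorem compDeriv_eq_fieldDeriv
    (hd : ∀ z ∈ Icc 0 T ×ˢ univ, HasFDerivWithinAt
      (fun z : ℝ × EuclideanSpace ℝ (Fin n) => σ z.1 z.2) (f' z) (Icc 0 T ×ˢ univ) z)
    {t : ℝ} (ht : t ∈ Icc 0 T) (hY' : Y' t = σ t (Y t)) :
    compDeriv σ Y Y' t = fieldDeriv (fun z => σ z.1 z.2) f' (t, Y t) := by
  have h1 : HasFDerivWithinAt (fun x : EuclideanSpace ℝ (Fin n) => (t, x))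
      (ContinuousLinearMap.inr ℝ ℝ (EuclideanSpace ℝ (Fin n))) univ (Y t) :=
    (hasFDerivAt_prodMk_right t (Y t)).hasFDerivWithinAt
  have h2 := (hd (t, Y t) ⟨ht, mem_univ _⟩).comp (Y t) h1 fun x _ => ⟨ht, mem_univ _⟩
  have h3 : HasFDerivAt (σ t) ((f' (t, Y t)).comp
      (ContinuousLinearMap.inr ℝ ℝ (EuclideanSpace ℝ (Fin n)))) (Y t) :=
    hasFDerivWithinAt_univ.1 h2
  simp only [compDeriv, fieldDeriv, h3.fderiv, hY']

theorem compensatedSum_eq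
    (hd : ∀ z ∈ Icc 0 T ×ˢ univ, HasFDerivWithinAt
      (fun z : ℝ × EuclideanSpace ℝ (Fin n) => σ z.1 z.2) (f' z) (Icc 0 T ×ˢ univ) z)
    (hY' : ∀ t ∈ Icc 0 T, Y' t = σ t (Y t)) {t : ℝ} (hT : t ≤ T) (π : Partition 0 t) :
    compensatedSum X XX (fun s => σ s (Y s)) (compDeriv σ Y Y') π
      = ∑ i ∈ Finset.range π.n, localIncrement X XX (fun z => σ z.1 z.2) f'
        (π.point i) (π.point (i + 1)) (Y (π.point i)) := by
  refine Finset.sum_congr rfl fun i hi => ?_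
  have hi := (Finset.mem_range.1 hi).le
  have hm : π.point i ∈ Icc 0 T := ⟨π.le_point hi, (π.point_le hi).trans hT⟩
  rw [compDeriv_eq_fieldDeriv hd hm (hY' _ hm), localIncrement]

theorem meshToZero_neBot {a b : ℝ} (hab : a ≤ b) : (meshToZero a b).NeBot := by
  refine ⟨fun h => ?_⟩
  obtain ⟨ε, hε, H⟩ := exists_of_meshToZero_eventually (P := fun _ : Partition a b => False)
    (by rw [h]; exact eventually_bot)
  obtain ⟨π, hπ⟩ := Partition.exists_fine hab hε
  exact H π hπ

/-- The only partition of a point is the empty one, so the rough integral over it is zero by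
uniqueness of limits. -/
theorem IsRDESolution.initial (hT : 0 ≤ T) (h : IsRDESolution p T y b u σ X XX Y Y') :
    Y 0 = y := by
  have h0 := h.equation 0 ⟨le_rfl, hT⟩
  have hz : ∀ π : Partition (0 : ℝ) 0,
      compensatedSum X XX (fun s => σ s (Y s)) (compDeriv σ Y Y') π = 0 := by
    intro π
    have hn : π.n = 0 := by
      by_contra hn
      have h1 := π.lt_succ 0 (by omega)
      have h2 := π.point_le (i := 0 + 1) (by omega)
      rw [π.point_zero] at h1
      linarith
    simp [compensatedSum, hn]
  have := meshToZero_neBot (le_refl (0 : ℝ))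
  unfold HasRoughIntegral at h0
  simp only [hz] at h0
  have := tendsto_nhds_unique h0 tendsto_const_nhds
  rw [intervalIntegral.integral_same, sub_zero, sub_eq_zero] at this
  exact this

/-- The equation only asserts convergence of the Riemann sums. As the control also dominates the
remainder of `Y`, the local increments have a third-order defect with constant `defectConst d C 1`,
whatever the solution, and sewing yields the expansion. -/
theorem IsRDESolution.norm_expansionError_le {α : ℝ} {ω : ℝ → ℝ → ℝ}
    (hd : ∀ z ∈ Icc 0 T ×ˢ univ, HasFDerivWithinAt
      (fun z : ℝ × EuclideanSpace ℝ (Fin n) => σ z.1 z.2) (f' z) (Icc 0 T ×ˢ univ) z)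
    (hf : C3Bounds (Icc 0 T ×ˢ univ) C (fun z => σ z.1 z.2) f')
    (hX : IsRoughPath p T X XX) (hω : RoughBounds T α ω X XX)
    (hg : DriftBounds T Cb fun r x => b r x (u r))
    (h : IsRDESolution p T y b u σ X XX Y Y')
    (hR : ∀ s t, 0 ≤ s → s ≤ t → t ≤ T →
      ‖Y t - Y s - σ s (Y s) (X t - X s)‖ ≤ (ω s t ^ α) ^ 2)
    {s t : ℝ} (h0 : 0 ≤ s) (hst : s ≤ t) (hT : t ≤ T) (hr : ω s t ^ α ≤ 1) :
    ‖expansionError X XX (fun z => σ z.1 z.2) f' (fun r x => b r x (u r)) Y s t‖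
      ≤ sewingConst (3 * α) * defectConst d C 1 * (ω s t ^ α) ^ 3 := by
  have hC := hf.one_le
  have hsc := sewingConst_pos hω.exponent
  have hK : 0 ≤ defectConst d C 1 := by unfold defectConst; positivity
  have hρ : ∀ s t, 0 ≤ s → s ≤ t → t ≤ T → 0 ≤ ω s t ^ α := fun s t h0 hst hT =>
    Real.rpow_nonneg (hω.control.nonneg s t h0 hst hT) _
  have hYm : AEMeasurable Y (volume.restrict (Icc 0 T)) :=
    h.controlled.path.1.aemeasurable measurableSet_Icc
  rcases hst.eq_or_lt with rfl | hlt
  · have : expansionError X XX (fun z => σ z.1 z.2) f' (fun r x => b r x (u r)) Y s s = 0 := by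
      simp [expansionError, localIncrement, hX.enhancement_self ⟨h0, hT⟩, tensorApply]
    rw [this, norm_zero]
    have := hρ s s h0 le_rfl hT
    positivity
  have heq : ∀ t, 0 ≤ t → t ≤ T → Tendsto (fun π : Partition 0 t =>
      ∑ i ∈ Finset.range π.n, localIncrement X XX (fun z => σ z.1 z.2) f'
        (π.point i) (π.point (i + 1)) (Y (π.point i))) (meshToZero 0 t)
      (𝓝 (Y t - y - ∫ s in (0 : ℝ)..t, b s (Y s) (u s))) := fun t ht0 htT =>
    (h.equation t ⟨ht0, htT⟩).congr fun π => compensatedSum_eq hd h.deriv_eq htT π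
  have key := norm_sub_le_of_tendsto_riemann_sum hω.control (K := defectConst d C 1)
    (Ξ := fun s t => localIncrement X XX (fun z => σ z.1 z.2) f' s t (Y s))
    (I := fun t => Y t - y - ∫ s in (0 : ℝ)..t, b s (Y s) (u s))
    hω.exponent hK h0 hlt hT (fun a v c h1 h2 h3 h4 => ?_)
    (heq s h0 (hst.trans hT)) (heq t (h0.trans hst) hT)
  · rw [← rpow_pow_three (hω.control.nonneg s t h0 hst hT)] at key
    exact (congrArg norm (expansionError_eq hg hYm y h0 hst hT)).trans_le key
  · have a0 := h0.trans h1
    have cT := h4.trans hT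
    have hac := h2.trans h3
    rw [← rpow_pow_three (hω.control.nonneg a c a0 hac cT)]
    have hav := hω.rho_mono a0 le_rfl h2 h3 cT
    have hvc := hω.rho_mono a0 h2 h3 le_rfl cT
    have n1 := hρ a v a0 h2 (h3.trans cT)
    have n2 := hρ v c (a0.trans h2) h3 cT
    have hsq : (ω a v ^ α) ^ 2 ≤ (ω a c ^ α) ^ 2 := by gcongr
    exact norm_localIncrement_defect_le hf hX a0 h2 h3 cT
      ⟨⟨a0, by dsimp; linarith⟩, mem_univ _⟩
      ⟨⟨by dsimp; linarith, by dsimp; linarith⟩, mem_univ _⟩ (hρ a c a0 hac cT)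
      ((hω.rho_mono h0 h1 hac h4 hT).trans hr) zero_le_one
      ((hω.time a v a0 h2 (h3.trans cT)).trans hsq)
      ((hω.path a v a0 h2 (h3.trans cT)).trans hav)
      ((hω.path v c (a0.trans h2) h3 cT).trans hvc)
      ((hω.enhancement v c (a0.trans h2) h3 cT).trans (by gcongr))
      (by rw [one_mul]; exact (hR a v a0 h2 (h3.trans cT)).trans hsq)

theorem IsControlled.continuousOn_remainder (hX : IsRoughPath p T X XX)
    (h : IsControlled p T X Y Y') :
    ContinuousOn (fun z : ℝ × ℝ => remainder X Y Y' z.1 z.2) (Icc 0 T ×ˢ Icc 0 T) := by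
  have m1 : MapsTo (Prod.fst : ℝ × ℝ → ℝ) (Icc (0 : ℝ) T ×ˢ Icc (0 : ℝ) T) (Icc 0 T) :=
    fun z hz => hz.1
  have m2 : MapsTo (Prod.snd : ℝ × ℝ → ℝ) (Icc (0 : ℝ) T ×ˢ Icc (0 : ℝ) T) (Icc 0 T) :=
    fun z hz => hz.2
  exact ((h.path.1.comp continuousOn_snd m2).sub (h.path.1.comp continuousOn_fst m1)).sub
    ((h.deriv.1.comp continuousOn_fst m1).clm_apply
      ((hX.continuousOn_path.comp continuousOn_snd m2).sub
        (hX.continuousOn_path.comp continuousOn_fst m1)))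

theorem IsRDESolution.eqOn (hp : p ∈ Ico (2 : ℝ) 3) (hT : 0 ≤ T)
    (hd : ∀ z ∈ Icc 0 T ×ˢ univ, HasFDerivWithinAt
      (fun z : ℝ × EuclideanSpace ℝ (Fin n) => σ z.1 z.2) (f' z) (Icc 0 T ×ˢ univ) z)
    (hf : C3Bounds (Icc 0 T ×ˢ univ) C (fun z => σ z.1 z.2) f')
    (hX : IsRoughPath p T X XX) (hg : DriftBounds T Cb fun r x => b r x (u r)) (hCb : 0 ≤ Cb)
    {Z : ℝ → EuclideanSpace ℝ (Fin n)}
    {Z' : ℝ → EuclideanSpace ℝ (Fin d) →L[ℝ] EuclideanSpace ℝ (Fin n)}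
    (hY : IsRDESolution p T y b u σ X XX Y Y') (hZ : IsRDESolution p T y b u σ X XX Z Z') :
    EqOn Y Z (Icc 0 T) := by
  have hp2 : 0 < p / 2 := by linarith [hp.1]
  -- A single control dominates the rough path, time and the remainders of both solutions, so that
  -- their expansions can be compared.
  obtain ⟨ω, hω, hR⟩ := hX.exists_roughBounds hp.1 hp.2 (remainder X Y Y') (remainder X Z Z')
    (hY.controlled.continuousOn_remainder hX) (fun s _ => by simp [remainder])
    (dominated_of_variation_lt_top hp2 hY.controlled.remainder_lt_top)
    (hZ.controlled.continuousOn_remainder hX) (fun s _ => by simp [remainder])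
    (dominated_of_variation_lt_top hp2 hZ.controlled.remainder_lt_top)
  have hRY : ∀ s t, 0 ≤ s → s ≤ t → t ≤ T →
      ‖Y t - Y s - σ s (Y s) (X t - X s)‖ ≤ (ω s t ^ (2 / (p + 3))) ^ 2 := by
    intro s t h0 hst hT
    rw [← hY.deriv_eq s ⟨h0, hst.trans hT⟩]
    exact (hR s t h0 hst hT).1
  have hRZ : ∀ s t, 0 ≤ s → s ≤ t → t ≤ T →
      ‖Z t - Z s - σ s (Z s) (X t - X s)‖ ≤ (ω s t ^ (2 / (p + 3))) ^ 2 := by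
    intro s t h0 hst hT
    rw [← hZ.deriv_eq s ⟨h0, hst.trans hT⟩]
    exact (hR s t h0 hst hT).2
  have hC := hf.one_le
  have hsc := sewingConst_pos hω.exponent
  have hK : 0 ≤ defectConst d C 1 := by unfold defectConst; positivity
  exact eqOn_of_expansion hf hX hω hg hCb (hY.controlled.path.1.aemeasurable measurableSet_Icc)
    (hZ.controlled.path.1.aemeasurable measurableSet_Icc) (mul_nonneg hsc.le hK) hRY hRZ
    (fun s t h0 hst hT hr => hY.norm_expansionError_le hd hf hX hω hg hRY h0 hst hT hr)
    (fun s t h0 hst hT hr => hZ.norm_expansionError_le hd hf hX hω hg hRZ h0 hst hT hr)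
    ((hY.initial hT).trans (hZ.initial hT).symm)

theorem exists_isRDESolution (hp : p ∈ Ico (2 : ℝ) 3) (hT : 0 < T)
    (hd : ∀ z ∈ Icc 0 T ×ˢ univ, HasFDerivWithinAt
      (fun z : ℝ × EuclideanSpace ℝ (Fin n) => σ z.1 z.2) (f' z) (Icc 0 T ×ˢ univ) z)
    (hf : C3Bounds (Icc 0 T ×ˢ univ) C (fun z => σ z.1 z.2) f')
    (hX : IsRoughPath p T X XX) (hg : DriftBounds T Cb fun r x => b r x (u r)) (hCb : 0 ≤ Cb)
    (y : EuclideanSpace ℝ (Fin n)) :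
    ∃ Y, IsRDESolution p T y b u σ X XX Y (fun t => σ t (Y t)) ∧
      IsControlled p T X (fun t => σ t (Y t)) (compDeriv σ Y fun t => σ t (Y t)) := by
  have hp2 : 0 < p / 2 := by linarith [hp.1]
  -- For existence there is no remainder to control yet, so zero maps fill both slots.
  have hz : Dominated T fun _ _ => ‖(0 : ℝ)‖ ^ (p / 2) :=
    ⟨fun _ => 0, fun _ _ _ _ _ => by simp [Real.zero_rpow hp2.ne']⟩
  obtain ⟨ω, hω, -⟩ := hX.exists_roughBounds hp.1 hp.2 (fun _ _ => (0 : ℝ)) (fun _ _ => (0 : ℝ))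
    continuousOn_const (fun _ _ => rfl) hz continuousOn_const (fun _ _ => rfl) hz
  obtain ⟨Y, K, hY0, hYc, hK, hE⟩ := exists_expansion hT hf hX hω hg hCb y
  have hYm : AEMeasurable Y (volume.restrict (Icc 0 T)) := hYc.aemeasurable measurableSet_Icc
  have hαp : 1 ≤ 3 * (2 / (p + 3)) * (p / 2) := by
    have : 3 * (2 / (p + 3)) * (p / 2) = 3 * p / (p + 3) := by ring
    rw [this, le_div_iff₀ (by linarith)]
    linarith [hp.1]
  have hdR := dominated_remainder hp.1 hαp hf hX hω hg hCb hK hE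
  refine ⟨Y, ⟨isControlled_of_dominated hp.1 hf hX hYc hdR, fun _ _ => rfl,
    hg.integrableOn Y hYm, fun t ht => ?_⟩,
    isControlled_field_of_dominated hp.1 hf hX hYc hdR fun t ht =>
      compDeriv_eq_fieldDeriv hd ht rfl⟩
  have key := tendsto_riemann_sum hω.control hω.exponent hK
    (Ξ := fun s t => localIncrement X XX (fun z => σ z.1 z.2) f' s t (Y s))
      (I := fun t => Y t - y - ∫ s in (0 : ℝ)..t, b s (Y s) (u s))
      (fun s t h0 hst hT => ?_) le_rfl ht.2
  · have hI0 : Y 0 - y - ∫ s in (0 : ℝ)..0, b s (Y s) (u s) = 0 := by simp [hY0]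
    simp only [hI0, sub_zero] at key
    exact key.congr fun π => (compensatedSum_eq hd (fun _ _ => rfl) ht.2 π).symm
  · rw [← rpow_pow_three (hω.control.nonneg s t h0 hst hT)]
    exact (congrArg norm (expansionError_eq hg hYm y h0 hst hT)).symm.trans_le
      (hE s t h0 hst hT)

end Solution

end RoughDE

theorem theorem3p3 {n m d : ℕ} (p : ℝ) (hp : p ∈ Set.Ico (2 : ℝ) 3) (T : ℝ) (hT : 0 < T)
    (y : EuclideanSpace ℝ (Fin n))
    (U : Set (EuclideanSpace ℝ (Fin m)))
    (u : ℝ → EuclideanSpace ℝ (Fin m)) (hu : RoughDE.IsControl T U u)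
    (b : ℝ → EuclideanSpace ℝ (Fin n) → EuclideanSpace ℝ (Fin m) → EuclideanSpace ℝ (Fin n))
    (hb : RoughDE.IsDrift T U b)
    (σ : ℝ → EuclideanSpace ℝ (Fin n) →
      (EuclideanSpace ℝ (Fin d) →L[ℝ] EuclideanSpace ℝ (Fin n)))
    (hσ : RoughDE.IsCkb 3 (fun z : ℝ × EuclideanSpace ℝ (Fin n) => σ z.1 z.2)
      (Set.Icc 0 T ×ˢ Set.univ))
    (X : ℝ → EuclideanSpace ℝ (Fin d)) (XX : ℝ → ℝ → EuclideanSpace ℝ (Fin d × Fin d))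
    (hX : RoughDE.IsRoughPath p T X XX) :
    ∃ (Y : ℝ → EuclideanSpace ℝ (Fin n))
      (Y' : ℝ → EuclideanSpace ℝ (Fin d) →L[ℝ] EuclideanSpace ℝ (Fin n)),
      RoughDE.IsRDESolution p T y b u σ X XX Y Y' ∧
      RoughDE.IsControlled p T X (fun t => σ t (Y t)) (RoughDE.compDeriv σ Y Y') ∧
      ∀ (V : ℝ → EuclideanSpace ℝ (Fin n))
        (V' : ℝ → EuclideanSpace ℝ (Fin d) →L[ℝ] EuclideanSpace ℝ (Fin n)),
        RoughDE.IsRDESolution p T y b u σ X XX V V' →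
          Set.EqOn V Y (Set.Icc 0 T) ∧ Set.EqOn V' Y' (Set.Icc 0 T) := by
  have hS : Convex ℝ (Set.Icc 0 T ×ˢ (Set.univ : Set (EuclideanSpace ℝ (Fin n)))) :=
    (convex_Icc 0 T).prod convex_univ
  -- Derivatives within the strip are unique because `0 < T`.
  obtain ⟨C, hf⟩ := hσ.exists_c3Bounds hS ((uniqueDiffOn_Icc hT).prod uniqueDiffOn_univ)
  have hd := fun z hz =>
    (hσ.1.differentiableOn (by norm_num) z hz).hasFDerivWithinAt
  obtain ⟨Cb, hCb, hg⟩ := hb.exists_driftBounds hT hu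
  obtain ⟨Y, hY, hσY⟩ := RoughDE.exists_isRDESolution hp hT hd hf hX hg hCb y
  refine ⟨Y, fun t => σ t (Y t), hY, hσY, fun V V' hV => ?_⟩
  have hVY := hV.eqOn hp hT.le hd hf hX hg hCb hY
  exact ⟨hVY, fun t ht => by rw [hV.deriv_eq t ht, hVY ht]⟩
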